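/- Let $\mu_0>0$. Consider the Chew–Goldberger–Low (CGL) plasma equations in three space dimensions without gravity ($\Phi=0$), for the density $\rho$, velocity $\mathbf u$, magnetic field $\mathbf B$ and pressures $p_\parallel,p_\perp$ as functions of $(t,\mathbf x)$: $$\rho_t+\nabla\cdot(\rho\mathbf u)=0,\qquad (\rho\mathbf u)_t+\nabla\cdot(\rho\mathbf u\mathbf u+\mathsf p+\mathsf M_B)=0,\qquad \mathbf B_t-\nabla\times(\mathbf u\times\mathbf B)=0,\qquad \nabla\cdot\mathbf B=0,$$ $$(p_\parallel)_t+\nabla\cdot(p_\parallel\mathbf u)+2\,\mathsf p^\parallel:\nabla\mathbf u=0,\qquad (p_\perp)_t+\nabla\cdot(p_\perp\mathbf u)+\mathsf p^\perp:\nabla\mathbf u=0,\tag{1}$$ where $B=|\mathbf B|$, $\boldsymbol\tau=\mathbf B/B$, $\mathsf p^\parallel=p_\parallel\boldsymbol\tau\boldsymbol\tau$, $\mathsf p^\perp=p_\perp(\mathsf I-\boldsymbol\tau\boldsymbol\tau)$, $\mathsf p=\mathsf p^\parallel+\mathsf p^\perp$, $\mathsf M_B=\mu_0^{-1}(\tfrac12B^2\mathsf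 I-\mathbf B\mathbf B)$. The full system consists of (1) together with the transport equation of the entropy $S$, $$S_t+\mathbf u\cdot\nabla S=0.\tag{2}$$ A Lie point symmetry of a first-order system $\Delta=0$ over an open set $U$ of the space of independent and dependent variables is a smooth vector field $X$ on $U$ whose first prolongation satisfies $\mathrm{pr}\,X(\Delta)=0$ at every first-order jet over $U$ at which $\Delta=0$. Consider the 13 vector fields ($i=1,2,3$) $$P_0=\partial_t,\quad P_i=\partial_{x^i},\quad K_i=t\partial_{x^i}+\partial_{u^i},\quad J_i=\epsilon_{ijk}(x^j\partial_{x^k}+u^j\partial_{u^k}+B^j\partial_{B^k}),$$ $$S_1=t\partial_t+x^i\partial_{x^i},\quad S_2=t\partial_t+2\rho\partial_\rho-u^i\partial_{u^i},\quad S_3=2\rho\partial_\rho+2p_\perp\partial_{p_\perp}+2p_\parallel\partial_{p_\parallel}+B^i\partial_{B^i}.$$ (a) For every connected nonempty open set $U$ of the space of $(t,\mathbf x,\rho,\mathbf u,\mathbf B,p_\parallel,p_\perp)$ on which $\rho>0$ and $\mathbf B\neq0$, the 13 vector fields are linearly independent on $U$, and the Lie point symmetries of the CGL system (1) over $U$ are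 exactly their real linear combinations. (b) For every connected nonempty open set $U$ of the space of $(t,\mathbf x,\rho,\mathbf u,\mathbf B,p_\parallel,p_\perp,S)$ on which $\rho>0$ and $\mathbf B\ne0$, the 13 vector fields are linearly independent on $U$, and the Lie point symmetries of the full system (1)–(2) over $U$ are exactly the vector fields $G+\varphi\,\partial_S$, where $G$ is a real linear combination of the 13 vector fields and $\varphi$ is a smooth function on $U$ whose differential is at every point of $U$ a linear combination of $dS$, $d(p_\parallel B^2/\rho^3)$ and $d(p_\perp/(\rho B))$ (that is, locally $\varphi=F(S,\;p_\parallel B^2/\rho^3,\;p_\perp/(\rho B))$). Thus, up to these relabellings of the entropy, the symmetries are exactly those generated by the 10 Galilean generators and the 3 scalings. -/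

import Mathlib

open scoped ContDiff

noncomputable section

namespace CGL

/-! ### Jets, prolongation and point symmetries of first-order systems

`T` is the space of independent variables and `V` the space of dependent variables. A point of the
first jet space over `T × V` is a pair `(z, L)`, where `z = (y, v)` and the linear map `L : T → V`
collects the first-order derivatives of the dependent variables. -/

section Jets

variable {T V W F : Type*} [NormedAddCommGroup T] [NormedSpace ℝ T]
  [NormedAddCommGroup V] [NormedSpace ℝ V] [NormedAddCommGroup W] [NormedSpace ℝ W]
  [NormedAddCommGroup F] [NormedSpace ℝ F]

/-- The total derivative at the jet `(z, L)` of a function `f` of the independent and dependent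
variables: in the direction `e` it is `∂_e f + (L e) · ∂_v f`. -/
def totalDeriv (f : T × V → F) (z : T × V) (L : T →L[ℝ] V) : T →L[ℝ] F :=
  (fderiv ℝ f z).comp ((ContinuousLinearMap.id ℝ T).prod L)

/-- The coefficient of the first-order derivatives in the first prolongation of the vector field
`X = (ξ, η)` on `T × V`. In coordinates it is `η^α_i = D_i η^α - (D_i ξ^j) v^α_j`. -/
def prolongation (X : T × V → T × V) (z : T × V) (L : T →L[ℝ] V) : T →L[ℝ] V :=
  totalDeriv (fun z' => (X z').2) z L - L.comp (totalDeriv (fun z' => (X z').1) z L)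

/-- `X` is (the generator of) a Lie point symmetry over the open set `U` of the first-order system
`Δ = 0`: it is smooth on `U`, and its first prolongation, applied to the equations of the system,
vanishes at every jet over `U` that satisfies the system. -/
def IsLiePointSymmetry (Δ : (T × V) × (T →L[ℝ] V) → W) (U : Set (T × V))
    (X : T × V → T × V) : Prop :=
  ContDiffOn ℝ ∞ X U ∧
    ∀ z ∈ U, ∀ L : T →L[ℝ] V, Δ (z, L) = 0 →
      fderiv ℝ Δ (z, L) (X z, prolongation X z L) = 0

end Jets

/-! ### The variables -/

/-- The independent variables `(t, x)`. -/
abbrev SpaceTime : Type := ℝ × (Fin 3 → ℝ)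

/-- The scalar components of the dependent variables other than the entropy. -/
inductive Field : Type
  | density
  | velocity (i : Fin 3)
  | magnetic (i : Fin 3)
  | pPar
  | pPerp
  deriving DecidableEq, Fintype

/-- The values of the dependent variables `(ρ, u, B, p_∥, p_⊥)`. -/
abbrev State : Type := Field → ℝ

/-- The independent variables with `(ρ, u, B, p_∥, p_⊥)`. -/
abbrev Space : Type := SpaceTime × State

/-- The independent variables with all dependent variables `((ρ, u, B, p_∥, p_⊥), S)`. -/
abbrev FullSpace : Type := SpaceTime × (State × ℝ)

/-- The first-order derivatives of `(ρ, u, B, p_∥, p_⊥)`. -/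
abbrev Jet : Type := SpaceTime →L[ℝ] State

def density (z : Space) : ℝ := z.2 .density
def velocity (z : Space) : Fin 3 → ℝ := fun i => z.2 (.velocity i)
def magnetic (z : Space) : Fin 3 → ℝ := fun i => z.2 (.magnetic i)
def pPar (z : Space) : ℝ := z.2 .pPar
def pPerp (z : Space) : ℝ := z.2 .pPerp

/-- `|B|`. -/
def magneticStrength (z : Space) : ℝ := Real.sqrt (∑ i, magnetic z i ^ 2)

/-- The unit vector `τ = B / |B|`. -/
def tau (z : Space) (i : Fin 3) : ℝ := magnetic z i / magneticStrength z

/-- The tensor `p^∥ = p_∥ ττ`. -/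
def parTensor (z : Space) (i j : Fin 3) : ℝ := pPar z * (tau z i * tau z j)

/-- The tensor `p^⊥ = p_⊥ (I - ττ)`. -/
def perpTensor (z : Space) (i j : Fin 3) : ℝ :=
  pPerp z * ((1 : Matrix (Fin 3) (Fin 3) ℝ) i j - tau z i * tau z j)

/-- The gyrotropic pressure tensor `p = p_⊥ I + (p_∥ - p_⊥) ττ`. -/
def pressureTensor (z : Space) (i j : Fin 3) : ℝ :=
  pPerp z * (1 : Matrix (Fin 3) (Fin 3) ℝ) i j + (pPar z - pPerp z) * (tau z i * tau z j)

/-- The magnetic pressure tensor `M_B = (|B|² / 2 I - BB) / μ₀`. -/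
def magneticTensor (μ₀ : ℝ) (z : Space) (i j : Fin 3) : ℝ :=
  (1 / μ₀) * (magneticStrength z ^ 2 / 2 * (1 : Matrix (Fin 3) (Fin 3) ℝ) i j
    - magnetic z i * magnetic z j)

/-- The region on which the equations make sense: positive density and nonzero magnetic field. -/
def region : Set Space := {z | 0 < density z ∧ magnetic z ≠ 0}

/-! ### The equations, as functions on the first jet space -/

/-- The total time derivative `D_t f`. -/
def Dt (f : Space → ℝ) (J : Space × Jet) : ℝ := totalDeriv f J.1 J.2 (1, 0)

/-- The total space derivative `D_{x^i} f`. -/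
def Dx (i : Fin 3) (f : Space → ℝ) (J : Space × Jet) : ℝ :=
  totalDeriv f J.1 J.2 (0, Pi.single i 1)

/-- The total divergence of a vector-valued function. -/
def totalDiv (f : Space → Fin 3 → ℝ) (J : Space × Jet) : ℝ := ∑ j, Dx j (fun z => f z j) J

/-- The total curl of a vector-valued function. -/
def totalCurl (f : Space → Fin 3 → ℝ) (J : Space × Jet) : Fin 3 → ℝ :=
  ![Dx 1 (fun z => f z 2) J - Dx 2 (fun z => f z 1) J,
    Dx 2 (fun z => f z 0) J - Dx 0 (fun z => f z 2) J,
    Dx 0 (fun z => f z 1) J - Dx 1 (fun z => f z 0) J]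

/-- The double contraction `A : ∇u`. -/
def contractGradU (A : Space → Fin 3 → Fin 3 → ℝ) (J : Space × Jet) : ℝ :=
  ∑ i, ∑ j, A J.1 i j * Dx i (fun z => velocity z j) J

/-- Mass continuity `ρ_t + ∇·(ρu)`. -/
def massEq (J : Space × Jet) : ℝ :=
  Dt density J + totalDiv (fun z j => density z * velocity z j) J

/-- Momentum `(ρu)_t + ∇·(ρuu + p + M_B)`, without external gravity. -/
def momentumEq (μ₀ : ℝ) (J : Space × Jet) (i : Fin 3) : ℝ :=
  Dt (fun z => density z * velocity z i) J
    + totalDiv (fun z j => density z * velocity z i * velocity z j + pressureTensor z i j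
        + magneticTensor μ₀ z i j) J

/-- Faraday's equation `B_t - ∇×(u×B)`. -/
def faradayEq (J : Space × Jet) (i : Fin 3) : ℝ :=
  Dt (fun z => magnetic z i) J
    - totalCurl (fun z => crossProduct (velocity z) (magnetic z)) J i

/-- Gauss's law `∇·B`. -/
def gaussEq (J : Space × Jet) : ℝ := totalDiv magnetic J

/-- Parallel pressure `(p_∥)_t + ∇·(p_∥ u) + 2 p^∥ : ∇u`. -/
def parEq (J : Space × Jet) : ℝ :=
  Dt pPar J + totalDiv (fun z j => pPar z * velocity z j) J + 2 * contractGradU parTensor J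

/-- Perpendicular pressure `(p_⊥)_t + ∇·(p_⊥ u) + p^⊥ : ∇u`. -/
def perpEq (J : Space × Jet) : ℝ :=
  Dt pPerp J + totalDiv (fun z j => pPerp z * velocity z j) J + contractGradU perpTensor J

/-- The CGL system for `(ρ, u, B, p_∥, p_⊥)`. -/
def cglSystem (μ₀ : ℝ) (J : Space × Jet) :
    ℝ × (Fin 3 → ℝ) × (Fin 3 → ℝ) × ℝ × ℝ × ℝ :=
  (massEq J, momentumEq μ₀ J, faradayEq J, gaussEq J, parEq J, perpEq J)

/-- Forgetting the entropy. -/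
def forget (z : FullSpace) : Space := (z.1, z.2.1)

/-- Forgetting the entropy and its derivatives. -/
def forgetJet (J : FullSpace × (SpaceTime →L[ℝ] State × ℝ)) : Space × Jet :=
  (forget J.1, (ContinuousLinearMap.fst ℝ State ℝ).comp J.2)

def entropy (z : FullSpace) : ℝ := z.2.2

/-- Entropy transport `S_t + u·∇S`. -/
def entropyEq (J : FullSpace × (SpaceTime →L[ℝ] State × ℝ)) : ℝ :=
  totalDeriv entropy J.1 J.2 (1, 0)
    + ∑ j, velocity (forget J.1) j * totalDeriv entropy J.1 J.2 (0, Pi.single j 1)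

/-- The CGL system for all the variables, the entropy included. -/
def cglFullSystem (μ₀ : ℝ) (J : FullSpace × (SpaceTime →L[ℝ] State × ℝ)) :
    (ℝ × (Fin 3 → ℝ) × (Fin 3 → ℝ) × ℝ × ℝ × ℝ) × ℝ :=
  (cglSystem μ₀ (forgetJet J), entropyEq J)

/-! ### The generators -/

/-- The vector field (at a point) with the given components along
`∂_t, ∂_x, ∂_ρ, ∂_u, ∂_B, ∂_{p_∥}, ∂_{p_⊥}`. -/
def mkVec (t : ℝ) (x : Fin 3 → ℝ) (ρ : ℝ) (u B : Fin 3 → ℝ) (pl pp : ℝ) : Space :=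
  ((t, x), fun
    | .density => ρ
    | .velocity i => u i
    | .magnetic i => B i
    | .pPar => pl
    | .pPerp => pp)

/-- Names of the 10 Galilean generators and the 3 scalings. -/
inductive Generator : Type
  | P0
  | P (i : Fin 3)
  | K (i : Fin 3)
  | J (i : Fin 3)
  | S1
  | S2
  | S3
  deriving DecidableEq, Fintype

/-- The generators as vector fields. With `e_i` the standard basis vector, the components of
`J_i = ε_{ijk} (x^j ∂_{x^k} + u^j ∂_{u^k} + B^j ∂_{B^k})` are `e_i × x`, `e_i × u`, `e_i × B`. -/
def generator : Generator → Space → Space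
  | .P0, _ => mkVec 1 0 0 0 0 0 0
  | .P i, _ => mkVec 0 (Pi.single i 1) 0 0 0 0 0
  | .K i, z => mkVec 0 (z.1.1 • Pi.single i 1) 0 (Pi.single i 1) 0 0 0
  | .J i, z => mkVec 0 (crossProduct (Pi.single i 1) z.1.2) 0
      (crossProduct (Pi.single i 1) (velocity z)) (crossProduct (Pi.single i 1) (magnetic z)) 0 0
  | .S1, z => mkVec z.1.1 z.1.2 0 0 0 0 0
  | .S2, z => mkVec z.1.1 0 (2 * density z) (-velocity z) 0 0 0
  | .S3, z => mkVec 0 0 (2 * density z) 0 (magnetic z) (2 * pPar z) (2 * pPerp z)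

/-- The generators as vector fields on the full space, with zero component along `∂_S`. -/
def fullGenerator (g : Generator) (z : FullSpace) : FullSpace :=
  ((generator g (forget z)).1, ((generator g (forget z)).2, 0))

/-- The vector field `φ ∂_S`. -/
def entropyField (φ : FullSpace → ℝ) (z : FullSpace) : FullSpace := (0, (0, φ z))

/-- The advected scalar `p_∥ |B|² / ρ³`. -/
def parInvariant (z : FullSpace) : ℝ :=
  pPar (forget z) * magneticStrength (forget z) ^ 2 / density (forget z) ^ 3

/-- The advected scalar `p_⊥ / (ρ |B|)`. -/
def perpInvariant (z : FullSpace) : ℝ :=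
  pPerp (forget z) / (density (forget z) * magneticStrength (forget z))

/-- `φ` is smooth on `U` and locally a function of `S`, `p_∥ |B|² / ρ³` and `p_⊥ / (ρ |B|)` alone
(the differentials of these three functions are linearly independent where `ρ > 0`, `B ≠ 0`). -/
def IsAdvectedFunction (U : Set FullSpace) (φ : FullSpace → ℝ) : Prop :=
  ContDiffOn ℝ ∞ φ U ∧ ∀ z ∈ U, fderiv ℝ φ z ∈
    Submodule.span ℝ {fderiv ℝ entropy z, fderiv ℝ parInvariant z, fderiv ℝ perpInvariant z}

end CGL

end

open scoped ContDiff

noncomputable section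

namespace CGL

/-! ### Total derivatives, their prolongation and their linearization -/

section JetCalculus

variable {T V : Type*} [NormedAddCommGroup T] [NormedSpace ℝ T]
  [NormedAddCommGroup V] [NormedSpace ℝ V]

/-! Necessity. The prolonged field maps a total derivative to a linearized total derivative
(`HasProl.totalDeriv`), so the symmetry condition says that the linearized CGL equations hold at
every solution jet. Two changes of variables make this tractable. The equations are solved for
material derivatives (`ReducedEqs`), and the two pressures are replaced by the isotropic total
pressure and the tension, which is the coefficient of `BB` in the stress. The solution jets over a
point then have explicit free parameters (`JetData`): the material derivative of `u`, the space
gradients of `ρ`, of `u` and of the tension, and a trace-free gradient of `B`. The momentum equation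
is read as a formula for the gradient of the total pressure. The linearized equations are
polynomials in these parameters, so their coefficients vanish.

Quadratic coefficients show that the space-time components `T`, `Z` depend on space-time only.
Linear ones give `T = T(t)`, `∂Z` equal to a skew matrix plus `ψ` times the identity, and the
magnetic component `B·∇Z + λB` (`KinematicEqs`). They also show that the tension is invariant and
that the perpendicular pressure, hence the parallel one, scales at the rate `2(ψ + λ)`
(`DynamicEqs`). The constant terms (`ConstEqs`) kill all second derivatives of `T` and `Z` and all
derivatives of `ψ` and `λ`. Thirteen constants remain, one for each generator.

This argument cancels `p_⊥` and the components of `B`, so it runs on a dense open subset of `U` that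
need not be connected. Derivatives that vanish there vanish on `U` by continuity, and connectedness
of `U` gives global constants (`exists_const`, `exists_combo`).

Conversely, for a combination of the generators every linearized equation is a linear combination of
the equations themselves (`linearizedEqs_combo`). Independence holds because the fields are affine
and therefore determined by their values on any open set.

With entropy, every slice of a symmetry at constant `S` is a symmetry of the smaller system. The
gradient of `S` transverse to the flow is free, and it perturbs the jet by a rank-one term. The
equations annihilate such terms only if the space-time and magnetic components are independent of
`S` (`eq_zero_of_rankOne`, `dEntropy_eq_zero`). These components determine all coefficients
(`eq_zero_of_combo`), so the combination does not depend on `S`. What remains is that the component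
along `S` is constant along the flow for every solution jet. Free accelerations remove its
dependence on `u`, a commutator removes `t` and `x`, and free velocity gradients leave only
functions of the three advected scalars (`forall_mem_span_iff`, `mem_span_of_material`). -/

/-- The derivative of `f` along the vector field `X`. -/
def lieD (X : T × V → T × V) (f : T × V → ℝ) (z : T × V) : ℝ := fderiv ℝ f z (X z)

/-- The linearization of `D_e f` along `X`: `D_e (X f) - D_{D_e ξ} f`. -/
def lin (X : T × V → T × V) (f : T × V → ℝ) (z : T × V) (L : T →L[ℝ] V) (e : T) : ℝ :=
  totalDeriv (lieD X f) z L e - totalDeriv f z L (totalDeriv (fun z' => (X z').1) z L e)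

/-- The function `g` on the jet space is differentiable at `(z, L)` and the first prolongation
of `X` maps it to `a` there. -/
def HasProl (X : T × V → T × V) (z : T × V) (L : T →L[ℝ] V)
    (g : (T × V) × (T →L[ℝ] V) → ℝ) (a : ℝ) : Prop :=
  DifferentiableAt ℝ g (z, L) ∧ fderiv ℝ g (z, L) (X z, prolongation X z L) = a

variable {X : T × V → T × V} {z : T × V} {L : T →L[ℝ] V}
  {g h : (T × V) × (T →L[ℝ] V) → ℝ} {a b : ℝ} {f f₁ f₂ : T × V → ℝ} {e : T}

theorem totalDeriv_apply {F : Type*} [NormedAddCommGroup F] [NormedSpace ℝ F]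
    (f : T × V → F) (z : T × V) (L : T →L[ℝ] V) (e : T) :
    totalDeriv f z L e = fderiv ℝ f z (e, L e) := rfl

theorem HasProl.add (hg : HasProl X z L g a) (hh : HasProl X z L h b) :
    HasProl X z L (fun J => g J + h J) (a + b) := by
  refine ⟨hg.1.add hh.1, ?_⟩
  rw [fderiv_fun_add hg.1 hh.1, ← hg.2, ← hh.2]; rfl

theorem HasProl.sub (hg : HasProl X z L g a) (hh : HasProl X z L h b) :
    HasProl X z L (fun J => g J - h J) (a - b) := by
  refine ⟨hg.1.sub hh.1, ?_⟩
  rw [fderiv_fun_sub hg.1 hh.1, ← hg.2, ← hh.2]; rfl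

theorem HasProl.mul (hg : HasProl X z L g a) (hh : HasProl X z L h b) :
    HasProl X z L (fun J => g J * h J) (g (z, L) * b + h (z, L) * a) := by
  refine ⟨hg.1.mul hh.1, ?_⟩
  rw [fderiv_fun_mul hg.1 hh.1, ← hg.2, ← hh.2]; rfl

theorem HasProl.const_mul (c : ℝ) (hg : HasProl X z L g a) :
    HasProl X z L (fun J => c * g J) (c * a) := by
  refine ⟨hg.1.const_mul c, ?_⟩
  rw [fderiv_const_mul hg.1, ← hg.2]; rfl

theorem HasProl.sum {ι : Type*} {s : Finset ι} {g : ι → (T × V) × (T →L[ℝ] V) → ℝ} {a : ι → ℝ}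
    (hg : ∀ i ∈ s, HasProl X z L (g i) (a i)) :
    HasProl X z L (fun J => ∑ i ∈ s, g i J) (∑ i ∈ s, a i) := by
  refine ⟨DifferentiableAt.fun_sum fun i hi => (hg i hi).1, ?_⟩
  rw [fderiv_fun_sum fun i hi => (hg i hi).1, sum_apply]
  exact Finset.sum_congr rfl fun i hi => (hg i hi).2

theorem HasProl.congr (hg : HasProl X z L g a) (hab : a = b) : HasProl X z L g b := hab ▸ hg

theorem HasProl.of_base (hf : DifferentiableAt ℝ f z) :
    HasProl X z L (fun J => f J.1) (lieD X f z) := by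
  have h : HasFDerivAt (fun J : (T × V) × (T →L[ℝ] V) => f J.1)
      ((fderiv ℝ f z).comp (ContinuousLinearMap.fst ℝ _ _)) (z, L) :=
    HasFDerivAt.comp (z, L) (g := f) hf.hasFDerivAt hasFDerivAt_fst
  exact ⟨h.differentiableAt, by rw [h.fderiv]; rfl⟩

theorem ContDiffAt.differentiableAt_fderiv' (hf : ContDiffAt ℝ 2 f z) :
    DifferentiableAt ℝ (fderiv ℝ f) z :=
  (hf.fderiv_right (m := 1) (by norm_num)).differentiableAt (by norm_num)

theorem fderiv_fderiv_apply {c : T × V → T × V} (hf : ContDiffAt ℝ 2 f z)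
    (hc : DifferentiableAt ℝ c z) (w : T × V) :
    fderiv ℝ (fun z' => fderiv ℝ f z' (c z')) z w
      = fderiv ℝ (fderiv ℝ f) z w (c z) + fderiv ℝ f z (fderiv ℝ c z w) := by
  rw [fderiv_clm_apply (ContDiffAt.differentiableAt_fderiv' hf) hc]
  simp [add_comm]

theorem lieD_differentiableAt (hf : ContDiffAt ℝ 2 f z) (hX : DifferentiableAt ℝ X z) :
    DifferentiableAt ℝ (lieD X f) z :=
  (ContDiffAt.differentiableAt_fderiv' hf).clm_apply hX

/-- Differentiating `df(e, L e)` along the prolonged field gives a Hessian term plus `df` on the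
vertical vector of the prolongation. `D_e (X f)` has the same Hessian term with its arguments
exchanged, so symmetry cancels it. What is left is `df` on the lift of `D_e ξ`, which is the term
subtracted in `lin`. -/
theorem HasProl.totalDeriv (hf : ContDiffAt ℝ 2 f z) (hX : DifferentiableAt ℝ X z) (e : T) :
    HasProl X z L (fun J => CGL.totalDeriv f J.1 J.2 e) (lin X f z L e) := by
  have h1 : HasFDerivAt (fun J : (T × V) × (T →L[ℝ] V) => fderiv ℝ f J.1)
      ((fderiv ℝ (fderiv ℝ f) z).comp (ContinuousLinearMap.fst ℝ _ _)) (z, L) :=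
    HasFDerivAt.comp (z, L) (g := fderiv ℝ f)
      (ContDiffAt.differentiableAt_fderiv' hf).hasFDerivAt hasFDerivAt_fst
  have h2 : HasFDerivAt (fun J : (T × V) × (T →L[ℝ] V) => (e, J.2 e))
      ((0 : (T × V) × (T →L[ℝ] V) →L[ℝ] T).prod
        ((ContinuousLinearMap.apply ℝ V e).comp (ContinuousLinearMap.snd ℝ _ _))) (z, L) := by
    refine (hasFDerivAt_const e _).prodMk ?_
    exact ((ContinuousLinearMap.apply ℝ V e).comp
      (ContinuousLinearMap.snd ℝ (T × V) (T →L[ℝ] V))).hasFDerivAt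
  have h := h1.clm_apply h2
  refine ⟨h.differentiableAt, ?_⟩
  have h' : fderiv ℝ (fun J : (T × V) × (T →L[ℝ] V) => CGL.totalDeriv f J.1 J.2 e) (z, L) = _ :=
    h.fderiv
  rw [h']
  have hsymm : IsSymmSndFDerivAt ℝ f z := hf.isSymmSndFDerivAt (by simp)
  have e1 := fderiv_fderiv_apply hf hX (e, L e)
  have hX1 : fderiv ℝ (fun z' => (X z').1) z (e, L e) = (fderiv ℝ X z (e, L e)).1 := by
    rw [hX.hasFDerivAt.fst.fderiv]; rfl
  have hX2 : fderiv ℝ (fun z' => (X z').2) z (e, L e) = (fderiv ℝ X z (e, L e)).2 := by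
    rw [hX.hasFDerivAt.snd.fderiv]; rfl
  have e2 : prolongation X z L e = (fderiv ℝ X z (e, L e)).2 - L (fderiv ℝ X z (e, L e)).1 := by
    simp only [prolongation, sub_apply, ContinuousLinearMap.comp_apply,
      totalDeriv_apply, hX1, hX2]
  unfold lin
  simp only [totalDeriv_apply, hX1]
  change _ = fderiv ℝ (fun z' => fderiv ℝ f z' (X z')) z (e, L e) - _
  rw [e1]
  simp only [add_apply, ContinuousLinearMap.comp_apply,
    ContinuousLinearMap.flip_apply, ContinuousLinearMap.prod_apply, ContinuousLinearMap.coe_fst',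
    ContinuousLinearMap.coe_snd', zero_apply, ContinuousLinearMap.apply_apply,
    e2]
  rw [hsymm.eq (X z) (e, L e)]
  -- The derivative of `X` along the jet splits into the vertical vector of the prolongation and the
  -- lift of `D_e ξ`.
  have e3 : fderiv ℝ X z (e, L e) = ((0 : T), (fderiv ℝ X z (e, L e)).2
      - L (fderiv ℝ X z (e, L e)).1)
      + ((fderiv ℝ X z (e, L e)).1, L (fderiv ℝ X z (e, L e)).1) := by
    ext <;> simp
  conv_rhs => rw [e3]
  rw [map_add]
  simp only [Prod.mk_add_mk, zero_add, sub_add_cancel]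
  ring

/-! ### Rules for `totalDeriv`, `lieD` and `lin` -/

theorem totalDeriv_add (h₁ : DifferentiableAt ℝ f₁ z) (h₂ : DifferentiableAt ℝ f₂ z) :
    totalDeriv (fun z => f₁ z + f₂ z) z L e = totalDeriv f₁ z L e + totalDeriv f₂ z L e := by
  simp only [totalDeriv_apply]; rw [fderiv_fun_add h₁ h₂]; rfl

theorem totalDeriv_mul (h₁ : DifferentiableAt ℝ f₁ z) (h₂ : DifferentiableAt ℝ f₂ z) :
    totalDeriv (fun z => f₁ z * f₂ z) z L e
      = f₁ z * totalDeriv f₂ z L e + f₂ z * totalDeriv f₁ z L e := by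
  simp only [totalDeriv_apply]; rw [fderiv_fun_mul h₁ h₂]; rfl

theorem totalDeriv_congr (h : f₁ =ᶠ[nhds z] f₂) : totalDeriv f₁ z L e = totalDeriv f₂ z L e := by
  simp only [totalDeriv_apply, h.fderiv_eq]

theorem lieD_add (h₁ : DifferentiableAt ℝ f₁ z) (h₂ : DifferentiableAt ℝ f₂ z) :
    lieD X (fun z => f₁ z + f₂ z) z = lieD X f₁ z + lieD X f₂ z := by
  unfold lieD; rw [fderiv_fun_add h₁ h₂]; rfl

theorem lieD_mul (h₁ : DifferentiableAt ℝ f₁ z) (h₂ : DifferentiableAt ℝ f₂ z) :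
    lieD X (fun z => f₁ z * f₂ z) z = f₁ z * lieD X f₂ z + f₂ z * lieD X f₁ z := by
  unfold lieD; rw [fderiv_fun_mul h₁ h₂]; rfl

theorem ContDiffAt.eventually_differentiableAt (hf : ContDiffAt ℝ 2 f z) :
    ∀ᶠ y in nhds z, DifferentiableAt ℝ f y := by
  filter_upwards [hf.eventually (by simp)] with y hy
  exact hy.differentiableAt (by norm_num)

theorem lin_add (h₁ : ContDiffAt ℝ 2 f₁ z) (h₂ : ContDiffAt ℝ 2 f₂ z)
    (hX : DifferentiableAt ℝ X z) :
    lin X (fun z => f₁ z + f₂ z) z L e = lin X f₁ z L e + lin X f₂ z L e := by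
  have d₁ := h₁.differentiableAt (by norm_num)
  have d₂ := h₂.differentiableAt (by norm_num)
  unfold lin
  have : lieD X (fun z => f₁ z + f₂ z) =ᶠ[nhds z] fun z => lieD X f₁ z + lieD X f₂ z := by
    filter_upwards [ContDiffAt.eventually_differentiableAt h₁,
      ContDiffAt.eventually_differentiableAt h₂] with y h1 h2 using lieD_add h1 h2
  rw [totalDeriv_congr this, totalDeriv_add d₁ d₂, totalDeriv_add
    (lieD_differentiableAt h₁ hX) (lieD_differentiableAt h₂ hX)]
  ring

theorem lin_mul (h₁ : ContDiffAt ℝ 2 f₁ z) (h₂ : ContDiffAt ℝ 2 f₂ z)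
    (hX : DifferentiableAt ℝ X z) :
    lin X (fun z => f₁ z * f₂ z) z L e = f₁ z * lin X f₂ z L e + f₂ z * lin X f₁ z L e
      + lieD X f₁ z * totalDeriv f₂ z L e + lieD X f₂ z * totalDeriv f₁ z L e := by
  have d₁ := h₁.differentiableAt (by norm_num)
  have d₂ := h₂.differentiableAt (by norm_num)
  have e₁ := lieD_differentiableAt h₁ hX
  have e₂ := lieD_differentiableAt h₂ hX
  unfold lin
  have : lieD X (fun z => f₁ z * f₂ z)
      =ᶠ[nhds z] fun z => f₁ z * lieD X f₂ z + f₂ z * lieD X f₁ z := by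
    filter_upwards [ContDiffAt.eventually_differentiableAt h₁,
      ContDiffAt.eventually_differentiableAt h₂] with y h1 h2 using lieD_mul h1 h2
  rw [totalDeriv_congr this, totalDeriv_mul d₁ d₂, totalDeriv_add (d₁.fun_mul e₂) (d₂.fun_mul e₁),
    totalDeriv_mul d₁ e₂, totalDeriv_mul d₂ e₁]
  ring

theorem totalDeriv_const (c : ℝ) : totalDeriv (fun _ => c) z L e = 0 := by
  simp [totalDeriv_apply]

theorem lieD_const (c : ℝ) : lieD X (fun _ => c) z = 0 := by
  simp [lieD]

theorem lin_const (c : ℝ) : lin X (fun _ => c) z L e = 0 := by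
  have : lieD X (fun _ => c) = fun _ => 0 := by ext; exact lieD_const c
  unfold lin; rw [this, totalDeriv_const, totalDeriv_const, sub_zero]

end JetCalculus

end CGL

end
open scoped ContDiff

noncomputable section

namespace CGL

/-! ### The linearization of the CGL system -/

section Linearization

variable {μ₀ : ℝ} {X : Space → Space} {z : Space} {L : Jet}

/-- `|B|²`. -/
def sqB (z : Space) : ℝ := ∑ i, magnetic z i * magnetic z i

/-- `1 / |B|²`. -/
def invSqB (z : Space) : ℝ := (sqB z)⁻¹

/-- The total isotropic pressure `p_⊥ + |B|² / (2 μ₀)`. -/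
def totalPressure (μ₀ : ℝ) (z : Space) : ℝ := pPerp z + 1 / (2 * μ₀) * sqB z

/-- The coefficient `(p_∥ - p_⊥) / |B|² - 1 / μ₀` of `BB` in the total stress. -/
def tension (μ₀ : ℝ) (z : Space) : ℝ := (pPar z - pPerp z) * invSqB z - 1 / μ₀

theorem sqB_pos (hz : z ∈ region) : 0 < sqB z := by
  obtain ⟨i, hi⟩ := Function.ne_iff.1 hz.2
  refine Finset.sum_pos' (fun j _ => mul_self_nonneg _) ⟨i, Finset.mem_univ i, ?_⟩
  exact mul_self_pos.2 hi

theorem contDiff_density {n : ℕ∞ω} : ContDiff ℝ n density := by unfold density; fun_prop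
theorem contDiff_velocity {n : ℕ∞ω} (i : Fin 3) : ContDiff ℝ n (fun z => velocity z i) := by
  unfold velocity; fun_prop
theorem contDiff_magnetic {n : ℕ∞ω} (i : Fin 3) : ContDiff ℝ n (fun z => magnetic z i) := by
  unfold magnetic; fun_prop
theorem contDiff_pPar {n : ℕ∞ω} : ContDiff ℝ n pPar := by unfold pPar; fun_prop
theorem contDiff_pPerp {n : ℕ∞ω} : ContDiff ℝ n pPerp := by unfold pPerp; fun_prop
theorem contDiff_sqB {n : ℕ∞ω} : ContDiff ℝ n sqB := by unfold sqB magnetic; fun_prop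
theorem isOpen_region : IsOpen region :=
  (isOpen_lt continuous_const (contDiff_density (n := 0)).continuous).inter
    (isOpen_ne.preimage (continuous_pi fun i => (contDiff_magnetic (n := 0) i).continuous))

theorem contDiffAt_invSqB {n : ℕ∞ω} (hz : z ∈ region) : ContDiffAt ℝ n invSqB z :=
  contDiff_sqB.contDiffAt.inv (sqB_pos hz).ne'
theorem contDiff_totalPressure {n : ℕ∞ω} : ContDiff ℝ n (totalPressure μ₀) :=
  contDiff_pPerp.add (contDiff_const.mul contDiff_sqB)
theorem contDiffAt_tension {n : ℕ∞ω} (hz : z ∈ region) : ContDiffAt ℝ n (tension μ₀) z :=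
  ((contDiff_pPar.contDiffAt.sub contDiff_pPerp.contDiffAt).mul (contDiffAt_invSqB hz)).sub
    contDiffAt_const

theorem magneticStrength_sq (z : Space) : magneticStrength z ^ 2 = sqB z := by
  unfold magneticStrength sqB
  rw [Real.sq_sqrt (Finset.sum_nonneg fun i _ => sq_nonneg _)]
  simp [sq]

theorem tau_mul_tau (z : Space) (i j : Fin 3) :
    tau z i * tau z j = magnetic z i * magnetic z j * invSqB z := by
  unfold tau invSqB
  rw [← magneticStrength_sq]
  ring

/-- Since `ττ = BB / |B|²`, pressure and magnetic stress are built from the same two tensors `I` and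
`BB`. The square root disappears, and only `|B|²` remains. -/
theorem stress_eq (z : Space) (i j : Fin 3) :
    pressureTensor z i j + magneticTensor μ₀ z i j =
      totalPressure μ₀ z * (1 : Matrix (Fin 3) (Fin 3) ℝ) i j
        + tension μ₀ z * (magnetic z i * magnetic z j) := by
  unfold pressureTensor magneticTensor totalPressure tension
  rw [tau_mul_tau, magneticStrength_sq]
  -- With the convention `1 / 0 = 0` the identity also holds at `μ₀ = 0`.
  by_cases h : μ₀ = 0
  · subst h; simp; ring
  · field_simp; ring

theorem momentum_flux_eq (i j : Fin 3) :
    (fun z => density z * velocity z i * velocity z j + pressureTensor z i j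
        + magneticTensor μ₀ z i j) =
    fun z => density z * (velocity z i * velocity z j)
        + (totalPressure μ₀ z * (1 : Matrix (Fin 3) (Fin 3) ℝ) i j
        + tension μ₀ z * (magnetic z i * magnetic z j)) := by
  ext y
  rw [add_assoc, stress_eq y, mul_assoc]

/-- The unit vector along the time axis. -/
abbrev eT : SpaceTime := (1, 0)

/-- The unit vectors along the space axes. -/
abbrev eX (j : Fin 3) : SpaceTime := (0, Pi.single j 1)

/-- The material derivative `f_t + u · ∇f`. -/
def matD (f : Space → ℝ) (z : Space) (L : Jet) : ℝ :=
  totalDeriv f z L eT + ∑ j, velocity z j * totalDeriv f z L (eX j)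

/-- The linearization of the material derivative. -/
def linMat (X : Space → Space) (f : Space → ℝ) (z : Space) (L : Jet) : ℝ :=
  lin X f z L eT + ∑ j, (velocity z j * lin X f z L (eX j)
    + lieD X (fun z => velocity z j) z * totalDeriv f z L (eX j))

/-- The divergence of the velocity. -/
def divU (z : Space) (L : Jet) : ℝ := ∑ j, totalDeriv (fun z => velocity z j) z L (eX j)

/-- The linearization of the divergence of the velocity. -/
def linDivU (X : Space → Space) (z : Space) (L : Jet) : ℝ :=
  ∑ j, lin X (fun z => velocity z j) z L (eX j)

/-- The rate of strain `ττ : ∇u` along the magnetic field. -/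
def strain (z : Space) (L : Jet) : ℝ :=
  ∑ i, ∑ j, invSqB z * (magnetic z i * magnetic z j)
    * totalDeriv (fun z => velocity z j) z L (eX i)

/-- The linearization of `ττ : ∇u`. -/
def linStrain (X : Space → Space) (z : Space) (L : Jet) : ℝ :=
  ∑ i, ∑ j, (invSqB z * (magnetic z i * magnetic z j)
      * lin X (fun z => velocity z j) z L (eX i)
    + (lieD X invSqB z * (magnetic z i * magnetic z j)
      + invSqB z * (magnetic z i * lieD X (fun z => magnetic z j) z
        + magnetic z j * lieD X (fun z => magnetic z i) z))
      * totalDeriv (fun z => velocity z j) z L (eX i))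

/-- The CGL equations solved for the material derivatives. -/
structure ReducedEqs (μ₀ : ℝ) (z : Space) (L : Jet) : Prop where
  mass : matD density z L + density z * divU z L = 0
  momentum (i : Fin 3) : density z * matD (fun z => velocity z i) z L
    + totalDeriv (totalPressure μ₀) z L (eX i)
    + ∑ j, (magnetic z i * magnetic z j * totalDeriv (tension μ₀) z L (eX j)
      + tension μ₀ z * magnetic z j * totalDeriv (fun z => magnetic z i) z L (eX j)) = 0
  faraday (i : Fin 3) : matD (fun z => magnetic z i) z L
    - ∑ j, magnetic z j * totalDeriv (fun z => velocity z i) z L (eX j)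
    + magnetic z i * divU z L = 0
  gauss : ∑ j, totalDeriv (fun z => magnetic z j) z L (eX j) = 0
  par : matD pPar z L + pPar z * divU z L + 2 * pPar z * strain z L = 0
  perp : matD pPerp z L + 2 * pPerp z * divU z L - pPerp z * strain z L = 0

/-- The linearization of the CGL equations solved for the material derivatives. -/
structure LinearizedEqs (μ₀ : ℝ) (X : Space → Space) (z : Space) (L : Jet) : Prop where
  mass : linMat X density z L + lieD X density z * divU z L + density z * linDivU X z L = 0
  momentum (i : Fin 3) : density z * linMat X (fun z => velocity z i) z L
    + lieD X density z * matD (fun z => velocity z i) z L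
    + lin X (totalPressure μ₀) z L (eX i)
    + ∑ j, (magnetic z i * magnetic z j * lin X (tension μ₀) z L (eX j)
      + (lieD X (fun z => magnetic z i) z * magnetic z j
        + magnetic z i * lieD X (fun z => magnetic z j) z) * totalDeriv (tension μ₀) z L (eX j)
      + tension μ₀ z * magnetic z j * lin X (fun z => magnetic z i) z L (eX j)
      + (lieD X (tension μ₀) z * magnetic z j + tension μ₀ z * lieD X (fun z => magnetic z j) z)
        * totalDeriv (fun z => magnetic z i) z L (eX j)) = 0
  faraday (i : Fin 3) : linMat X (fun z => magnetic z i) z L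
    - ∑ j, (magnetic z j * lin X (fun z => velocity z i) z L (eX j)
      + lieD X (fun z => magnetic z j) z * totalDeriv (fun z => velocity z i) z L (eX j))
    + magnetic z i * linDivU X z L + lieD X (fun z => magnetic z i) z * divU z L = 0
  gauss : ∑ j, lin X (fun z => magnetic z j) z L (eX j) = 0
  par : linMat X pPar z L + pPar z * linDivU X z L + lieD X pPar z * divU z L
    + 2 * pPar z * linStrain X z L + 2 * lieD X pPar z * strain z L = 0
  perp : linMat X pPerp z L + 2 * pPerp z * linDivU X z L + 2 * lieD X pPerp z * divU z L
    - pPerp z * linStrain X z L - lieD X pPerp z * strain z L = 0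

/-! ### The system solved for material derivatives -/

theorem cd_density : ContDiffAt ℝ 2 density z := contDiff_density.contDiffAt
theorem cd_velocity (i : Fin 3) : ContDiffAt ℝ 2 (fun z => velocity z i) z :=
  (contDiff_velocity i).contDiffAt
theorem cd_magnetic (i : Fin 3) : ContDiffAt ℝ 2 (fun z => magnetic z i) z :=
  (contDiff_magnetic i).contDiffAt

theorem df {f : Space → ℝ} (h : ContDiffAt ℝ 2 f z) : DifferentiableAt ℝ f z :=
  h.differentiableAt (by norm_num)

theorem massEq_eq : massEq (z, L) = totalDeriv density z L eT
    + ∑ j, (density z * totalDeriv (fun z => velocity z j) z L (eX j)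
      + velocity z j * totalDeriv density z L (eX j)) := by
  unfold massEq totalDiv Dt Dx
  congr 1
  exact Finset.sum_congr rfl fun j _ => totalDeriv_mul (df cd_density) (df (cd_velocity j))

theorem momentumEq_eq (hz : z ∈ region) (i : Fin 3) : momentumEq μ₀ (z, L) i =
    density z * totalDeriv (fun z => velocity z i) z L eT
      + velocity z i * totalDeriv density z L eT
    + ∑ j, (density z * (velocity z i * totalDeriv (fun z => velocity z j) z L (eX j)
        + velocity z j * totalDeriv (fun z => velocity z i) z L (eX j))
      + velocity z i * velocity z j * totalDeriv density z L (eX j)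
      + ((1 : Matrix (Fin 3) (Fin 3) ℝ) i j * totalDeriv (totalPressure μ₀) z L (eX j)
      + (tension μ₀ z * (magnetic z i * totalDeriv (fun z => magnetic z j) z L (eX j)
        + magnetic z j * totalDeriv (fun z => magnetic z i) z L (eX j))
        + magnetic z i * magnetic z j * totalDeriv (tension μ₀) z L (eX j)))) := by
  unfold momentumEq totalDiv Dt Dx
  have hu := fun i => df (cd_velocity (z := z) i)
  have hB := fun i => df (cd_magnetic (z := z) i)
  congr 1
  · exact totalDeriv_mul (df cd_density) (hu i)
  · refine Finset.sum_congr rfl fun j _ => ?_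
    have hP : DifferentiableAt ℝ (totalPressure μ₀) z := df contDiff_totalPressure.contDiffAt
    have hS : DifferentiableAt ℝ (tension μ₀) z := df (contDiffAt_tension hz)
    rw [momentum_flux_eq i j,
      totalDeriv_add (cd_density.differentiableAt (by norm_num) |>.fun_mul ((hu i).fun_mul (hu j)))
        ((hP.fun_mul (differentiableAt_const _)).fun_add (hS.fun_mul ((hB i).fun_mul (hB j)))),
      totalDeriv_mul (df cd_density) ((hu i).fun_mul (hu j)), totalDeriv_mul (hu i) (hu j),
      totalDeriv_add (hP.fun_mul (differentiableAt_const _)) (hS.fun_mul ((hB i).fun_mul (hB j))),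
      totalDeriv_mul hP (differentiableAt_const _), totalDeriv_const,
      totalDeriv_mul hS ((hB i).fun_mul (hB j)), totalDeriv_mul (hB i) (hB j)]
    ring

theorem parEq_eq : parEq (z, L) = totalDeriv pPar z L eT
    + ∑ j, (pPar z * totalDeriv (fun z => velocity z j) z L (eX j)
      + velocity z j * totalDeriv pPar z L (eX j)) + 2 * pPar z * strain z L := by
  unfold parEq totalDiv Dt Dx contractGradU strain parTensor
  congr 1
  · congr 1
    exact Finset.sum_congr rfl fun j _ =>
      totalDeriv_mul (df contDiff_pPar.contDiffAt) (df (cd_velocity j))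
  · simp only [tau_mul_tau, Finset.mul_sum, Dx]
    refine Finset.sum_congr rfl fun i _ => Finset.sum_congr rfl fun j _ => ?_
    ring

theorem perpEq_eq : perpEq (z, L) = totalDeriv pPerp z L eT
    + ∑ j, (pPerp z * totalDeriv (fun z => velocity z j) z L (eX j)
      + velocity z j * totalDeriv pPerp z L (eX j))
    + pPerp z * divU z L - pPerp z * strain z L := by
  unfold perpEq totalDiv Dt Dx contractGradU strain perpTensor divU
  rw [add_sub_assoc]
  congr 1
  · congr 1
    exact Finset.sum_congr rfl fun j _ =>
      totalDeriv_mul (df contDiff_pPerp.contDiffAt) (df (cd_velocity j))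
  · simp only [tau_mul_tau, Fin.sum_univ_three, Matrix.one_apply, Dx]
    simp
    ring

/-- The electromotive component `u_i B_j - u_j B_i`. -/
def emf (i j : Fin 3) (z : Space) : ℝ :=
  velocity z i * magnetic z j + (-1) * (velocity z j * magnetic z i)

theorem contDiff_emf (i j : Fin 3) : ContDiff ℝ 2 (emf i j) :=
  ((contDiff_velocity i).mul (contDiff_magnetic j)).add
    (contDiff_const.mul ((contDiff_velocity j).mul (contDiff_magnetic i)))

theorem totalDeriv_emf (i j : Fin 3) (e : SpaceTime) : totalDeriv (emf i j) z L e =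
    velocity z i * totalDeriv (fun z => magnetic z j) z L e
      + magnetic z j * totalDeriv (fun z => velocity z i) z L e
      - (velocity z j * totalDeriv (fun z => magnetic z i) z L e
      + magnetic z i * totalDeriv (fun z => velocity z j) z L e) := by
  have hu := fun i => df (cd_velocity (z := z) i)
  have hB := fun i => df (cd_magnetic (z := z) i)
  unfold emf
  rw [totalDeriv_add ((hu i).fun_mul (hB j)) (((hu j).fun_mul (hB i)).const_mul _),
    totalDeriv_mul (differentiableAt_const _) ((hu j).fun_mul (hB i)), totalDeriv_const,
    totalDeriv_mul (hu i) (hB j), totalDeriv_mul (hu j) (hB i)]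
  ring

theorem totalCurl_emf (J : Space × Jet) :
    totalCurl (fun z => crossProduct (velocity z) (magnetic z)) J =
      ![Dx 1 (emf 0 1) J - Dx 2 (emf 2 0) J, Dx 2 (emf 1 2) J - Dx 0 (emf 0 1) J,
        Dx 0 (emf 2 0) J - Dx 1 (emf 1 2) J] := by
  have h : ∀ z, crossProduct (velocity z) (magnetic z) = ![emf 1 2 z, emf 2 0 z, emf 0 1 z] := by
    intro z
    rw [cross_apply]
    unfold emf
    simp only [neg_mul, one_mul, ← sub_eq_add_neg]
  simp only [totalCurl, h]
  rfl

/-- The two systems differ by a triangular substitution: conservative momentum contains `u` times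
mass and tension times `B` times Gauss, and Faraday's equation contains `-u` times Gauss. Mass and
Gauss belong to both systems, so these multiples can be removed and restored. -/
theorem cglSystem_eq_zero_iff (hz : z ∈ region) :
    cglSystem μ₀ (z, L) = 0 ↔ ReducedEqs μ₀ z L := by
  have key : cglSystem μ₀ (z, L) = 0 ↔ massEq (z, L) = 0 ∧ (∀ i, momentumEq μ₀ (z, L) i = 0) ∧
      (∀ i, faradayEq (z, L) i = 0) ∧ gaussEq (z, L) = 0 ∧ parEq (z, L) = 0 ∧
      perpEq (z, L) = 0 := by
    simp only [cglSystem, Prod.ext_iff, Prod.fst_zero, Prod.snd_zero, funext_iff, Pi.zero_apply]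
  have hm : massEq (z, L) = matD density z L + density z * divU z L := by
    rw [massEq_eq, matD, divU]; simp only [Fin.sum_univ_three]; ring
  have hg : gaussEq (z, L) = ∑ j, totalDeriv (fun z => magnetic z j) z L (eX j) := rfl
  have hpar : parEq (z, L) = matD pPar z L + pPar z * divU z L + 2 * pPar z * strain z L := by
    rw [parEq_eq, matD, divU]; simp only [Fin.sum_univ_three]; ring
  have hperp : perpEq (z, L)
      = matD pPerp z L + 2 * pPerp z * divU z L - pPerp z * strain z L := by
    rw [perpEq_eq, matD, divU]; simp only [Fin.sum_univ_three]; ring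
  have hmom : ∀ i, momentumEq μ₀ (z, L) i = (density z * matD (fun z => velocity z i) z L
    + totalDeriv (totalPressure μ₀) z L (eX i)
    + ∑ j, (magnetic z i * magnetic z j * totalDeriv (tension μ₀) z L (eX j)
      + tension μ₀ z * magnetic z j * totalDeriv (fun z => magnetic z i) z L (eX j)))
      + velocity z i * massEq (z, L) + tension μ₀ z * magnetic z i * gaussEq (z, L) := by
    intro i
    rw [momentumEq_eq hz, massEq_eq, hg, matD]
    fin_cases i <;> simp [Fin.sum_univ_three, Matrix.one_apply] <;> ring
  have hfar : ∀ i, faradayEq (z, L) i = (matD (fun z => magnetic z i) z L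
    - ∑ j, magnetic z j * totalDeriv (fun z => velocity z i) z L (eX j)
    + magnetic z i * divU z L) - velocity z i * gaussEq (z, L) := by
    intro i
    rw [faradayEq, totalCurl_emf, hg, matD, divU]
    fin_cases i <;> simp only [Fin.sum_univ_three, Dx, totalDeriv_emf, Dt] <;> simp <;> ring
  rw [key]
  constructor
  · rintro ⟨h1, h2, h3, h4, h5, h6⟩
    refine ⟨hm ▸ h1, fun i => ?_, fun i => ?_, hg ▸ h4, hpar ▸ h5, hperp ▸ h6⟩
    · linear_combination h2 i - hmom i - velocity z i * h1 - tension μ₀ z * magnetic z i * h4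
    · linear_combination h3 i - hfar i + velocity z i * h4
  · rintro ⟨h1, h2, h3, h4, h5, h6⟩
    rw [← hm] at h1
    rw [← hg] at h4
    refine ⟨h1, fun i => ?_, fun i => ?_, h4, hpar ▸ h5, hperp ▸ h6⟩
    · rw [hmom, h2, h1, h4]; ring
    · rw [hfar, h3, h4]; ring

/-! #### Prolongation of the equations -/

theorem massEq_hasProl (hX : DifferentiableAt ℝ X z) : HasProl X z L massEq
    (lin X density z L eT + ∑ j, (density z * lin X (fun z => velocity z j) z L (eX j)
      + velocity z j * lin X density z L (eX j)
      + lieD X density z * totalDeriv (fun z => velocity z j) z L (eX j)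
      + lieD X (fun z => velocity z j) z * totalDeriv density z L (eX j))) :=
  ((HasProl.totalDeriv cd_density hX _).add (HasProl.sum fun j _ =>
    HasProl.totalDeriv (cd_density.mul (cd_velocity j)) hX (eX j))).congr <| by
    congr 1
    exact Finset.sum_congr rfl fun j _ => lin_mul cd_density (cd_velocity j) hX

theorem momentumEq_hasProl (hz : z ∈ region) (hX : DifferentiableAt ℝ X z) (i : Fin 3) :
    HasProl X z L (fun J => momentumEq μ₀ J i)
    (lin X (fun z => density z * velocity z i) z L eT + ∑ j,
      lin X (fun z => density z * (velocity z i * velocity z j)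
        + (totalPressure μ₀ z * (1 : Matrix (Fin 3) (Fin 3) ℝ) i j
        + tension μ₀ z * (magnetic z i * magnetic z j))) z L (eX j)) := by
  refine (HasProl.totalDeriv (cd_density.mul (cd_velocity i)) hX _).add
    (HasProl.sum fun j _ => ?_)
  unfold Dx
  simp only [momentum_flux_eq]
  exact HasProl.totalDeriv ((cd_density.mul ((cd_velocity i).mul (cd_velocity j))).add
    ((contDiff_totalPressure.contDiffAt.mul contDiffAt_const).add
      ((contDiffAt_tension hz).mul ((cd_magnetic i).mul (cd_magnetic j))))) hX (eX j)

theorem faradayEq_hasProl (hX : DifferentiableAt ℝ X z) (i : Fin 3) :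
    HasProl X z L (fun J => faradayEq J i)
    (lin X (fun z => magnetic z i) z L eT -
      ![lin X (emf 0 1) z L (eX 1) - lin X (emf 2 0) z L (eX 2),
        lin X (emf 1 2) z L (eX 2) - lin X (emf 0 1) z L (eX 0),
        lin X (emf 2 0) z L (eX 0) - lin X (emf 1 2) z L (eX 1)] i) := by
  unfold faradayEq
  refine (HasProl.totalDeriv (cd_magnetic i) hX _).sub ?_
  simp only [totalCurl_emf]
  have h : ∀ i j (k : Fin 3), HasProl X z L (Dx k (emf i j)) (lin X (emf i j) z L (eX k)) :=
    fun i j k => HasProl.totalDeriv (contDiff_emf i j).contDiffAt hX (eX k)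
  fin_cases i
  · exact (h _ _ _).sub (h _ _ _)
  · exact (h _ _ _).sub (h _ _ _)
  · exact (h _ _ _).sub (h _ _ _)

theorem gaussEq_hasProl (hX : DifferentiableAt ℝ X z) : HasProl X z L gaussEq
    (∑ j, lin X (fun z => magnetic z j) z L (eX j)) := by
  unfold gaussEq totalDiv Dx
  exact HasProl.sum fun j _ => HasProl.totalDeriv (cd_magnetic j) hX (eX j)

theorem contractGradU_hasProl (hX : DifferentiableAt ℝ X z) {A : Space → Fin 3 → Fin 3 → ℝ}
    (hA : ∀ i j, DifferentiableAt ℝ (fun z => A z i j) z) :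
    HasProl X z L (contractGradU A) (∑ i, ∑ j, (A z i j * lin X (fun z => velocity z j) z L (eX i)
      + totalDeriv (fun z => velocity z j) z L (eX i) * lieD X (fun z => A z i j) z)) :=
  HasProl.sum fun i _ => HasProl.sum fun j _ =>
    (HasProl.of_base (hA i j)).mul (HasProl.totalDeriv (cd_velocity j) hX (eX i))

theorem parTensor_eq (i j : Fin 3) : (fun z => parTensor z i j) =
    fun z => pPar z * (invSqB z * (magnetic z i * magnetic z j)) := by
  ext z; rw [parTensor, tau_mul_tau]; ring

/-- The factor `-1` keeps the tensor within sums and products, to which `lieD_add` and `lieD_mul`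
apply. -/
theorem perpTensor_eq (i j : Fin 3) : (fun z => perpTensor z i j) =
    fun z => pPerp z * ((1 : Matrix (Fin 3) (Fin 3) ℝ) i j
      + (-1) * (invSqB z * (magnetic z i * magnetic z j))) := by
  ext z; rw [perpTensor, tau_mul_tau]; ring

theorem parEq_hasProl (hz : z ∈ region) (hX : DifferentiableAt ℝ X z) : HasProl X z L parEq
    (linMat X pPar z L + pPar z * linDivU X z L + lieD X pPar z * divU z L
    + 2 * pPar z * linStrain X z L + 2 * lieD X pPar z * strain z L) := by
  have hp : ContDiffAt ℝ 2 pPar z := contDiff_pPar.contDiffAt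
  have hw : ContDiffAt ℝ 2 invSqB z := contDiffAt_invSqB hz
  have hB := fun i j => (cd_magnetic (z := z) i).mul (cd_magnetic j)
  refine (((HasProl.totalDeriv hp hX _).add (HasProl.sum fun j _ =>
    HasProl.totalDeriv (hp.mul (cd_velocity j)) hX (eX j))).add
    ((contractGradU_hasProl hX (A := parTensor) ?_).const_mul 2)).congr ?_
  · intro i j
    rw [parTensor_eq]
    exact df (hp.mul (hw.mul (hB i j)))
  · have h1 : ∀ j e, lin X (fun z => pPar z * velocity z j) z L e = _ :=
      fun j e => lin_mul hp (cd_velocity j) hX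
    have h2 : ∀ i j, lieD X (fun z => parTensor z i j) z = _ := fun i j => by
      rw [parTensor_eq, lieD_mul (df hp) (df (hw.mul (hB i j))), lieD_mul (df hw) (df (hB i j)),
        lieD_mul (df (cd_magnetic i)) (df (cd_magnetic j))]
    simp only [h1, h2, fun i j => congrFun (parTensor_eq i j) z, linMat, linDivU, linStrain,
      divU, strain, Fin.sum_univ_three]
    ring

theorem perpEq_hasProl (hz : z ∈ region) (hX : DifferentiableAt ℝ X z) : HasProl X z L perpEq
    (linMat X pPerp z L + 2 * pPerp z * linDivU X z L + 2 * lieD X pPerp z * divU z L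
    - pPerp z * linStrain X z L - lieD X pPerp z * strain z L) := by
  have hp : ContDiffAt ℝ 2 pPerp z := contDiff_pPerp.contDiffAt
  have hw : ContDiffAt ℝ 2 invSqB z := contDiffAt_invSqB hz
  have hB := fun i j => (cd_magnetic (z := z) i).mul (cd_magnetic j)
  have hc : ∀ i j, ContDiffAt ℝ 2 (fun _ : Space => (1 : Matrix (Fin 3) (Fin 3) ℝ) i j) z :=
    fun i j => contDiffAt_const
  have hm : ContDiffAt ℝ 2 (fun _ : Space => (-1 : ℝ)) z := contDiffAt_const
  refine (((HasProl.totalDeriv hp hX _).add (HasProl.sum fun j _ =>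
    HasProl.totalDeriv (hp.mul (cd_velocity j)) hX (eX j))).add
    (contractGradU_hasProl hX (A := perpTensor) ?_)).congr ?_
  · intro i j
    rw [perpTensor_eq]
    exact df (hp.mul ((hc i j).add (hm.mul (hw.mul (hB i j)))))
  · have h1 : ∀ j e, lin X (fun z => pPerp z * velocity z j) z L e = _ :=
      fun j e => lin_mul hp (cd_velocity j) hX
    have h2 : ∀ i j, lieD X (fun z => perpTensor z i j) z = _ := fun i j => by
      rw [perpTensor_eq, lieD_mul (df hp) (df ((hc i j).add (hm.mul (hw.mul (hB i j))))),
        lieD_add (df (hc i j)) (df (hm.mul (hw.mul (hB i j)))), lieD_const,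
        lieD_mul (df hm) (df (hw.mul (hB i j))), lieD_const, lieD_mul (df hw) (df (hB i j)),
        lieD_mul (df (cd_magnetic i)) (df (cd_magnetic j))]
    simp only [h1, h2, fun i j => congrFun (perpTensor_eq i j) z, linMat, linDivU, linStrain,
      divU, strain, Fin.sum_univ_three, Matrix.one_apply]
    simp
    ring

theorem hasProl_pi {f : Fin 3 → Space × Jet → ℝ} {a : Fin 3 → ℝ}
    (h : ∀ i, HasProl X z L (f i) (a i)) :
    DifferentiableAt ℝ (fun J i => f i J) (z, L) ∧
      fderiv ℝ (fun J i => f i J) (z, L) (X z, prolongation X z L) = a := by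
  refine ⟨differentiableAt_pi.2 fun i => (h i).1, ?_⟩
  rw [fderiv_pi fun i => (h i).1]
  ext i
  exact (h i).2

/-- Linearizing the triangular substitution also differentiates its multipliers. The resulting terms
carry the mass and Gauss equations themselves as factors, and these vanish because the jet is a
solution. -/
theorem fderiv_cglSystem_eq_zero_iff (hz : z ∈ region) (hX : DifferentiableAt ℝ X z)
    (hL : ReducedEqs μ₀ z L) :
    fderiv ℝ (cglSystem μ₀) (z, L) (X z, prolongation X z L) = 0 ↔
      LinearizedEqs μ₀ X z L := by
  have h1 := massEq_hasProl (L := L) hX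
  have h2 := hasProl_pi (momentumEq_hasProl (μ₀ := μ₀) (L := L) hz hX)
  have h3 := hasProl_pi (faradayEq_hasProl (L := L) hX)
  have h4 := gaussEq_hasProl (L := L) hX
  have h5 := parEq_hasProl (L := L) hz hX
  have h6 := perpEq_hasProl (L := L) hz hX
  unfold cglSystem
  rw [DifferentiableAt.fderiv_prodMk h1.1 (h2.1.prodMk (h3.1.prodMk (h4.1.prodMk
      (h5.1.prodMk h6.1)))), DifferentiableAt.fderiv_prodMk h2.1 (h3.1.prodMk (h4.1.prodMk
      (h5.1.prodMk h6.1))), DifferentiableAt.fderiv_prodMk h3.1 (h4.1.prodMk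
      (h5.1.prodMk h6.1)), DifferentiableAt.fderiv_prodMk h4.1 (h5.1.prodMk h6.1),
      DifferentiableAt.fderiv_prodMk h5.1 h6.1]
  simp only [ContinuousLinearMap.prod_apply]
  rw [h1.2, h2.2, h3.2, h4.2, h5.2, h6.2]
  simp only [Prod.ext_iff, Prod.fst_zero, Prod.snd_zero, funext_iff, Pi.zero_apply]
  have hu := fun i => cd_velocity (z := z) i
  have hB := fun i => cd_magnetic (z := z) i
  have hP : ContDiffAt ℝ 2 (totalPressure μ₀) z := contDiff_totalPressure.contDiffAt
  have hS : ContDiffAt ℝ 2 (tension μ₀) z := contDiffAt_tension hz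
  have hc : ∀ i j, ContDiffAt ℝ 2 (fun _ : Space => (1 : Matrix (Fin 3) (Fin 3) ℝ) i j) z :=
    fun i j => contDiffAt_const
  have hm : ContDiffAt ℝ 2 (fun _ : Space => (-1 : ℝ)) z := contDiffAt_const
  have l1 : ∀ i e, lin X (fun z => density z * velocity z i) z L e = _ :=
    fun i e => lin_mul cd_density (hu i) hX
  have l2 : ∀ i j e, lin X (fun z => density z * (velocity z i * velocity z j)
        + (totalPressure μ₀ z * (1 : Matrix (Fin 3) (Fin 3) ℝ) i j
        + tension μ₀ z * (magnetic z i * magnetic z j))) z L e = _ := fun i j e => by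
    rw [lin_add (cd_density.mul ((hu i).mul (hu j))) ((hP.mul (hc i j)).add
        (hS.mul ((hB i).mul (hB j)))) hX, lin_add (hP.mul (hc i j))
        (hS.mul ((hB i).mul (hB j))) hX, lin_mul cd_density ((hu i).mul (hu j)) hX,
        lin_mul (hu i) (hu j) hX, lin_mul hP (hc i j) hX, lin_mul hS ((hB i).mul (hB j)) hX,
        lin_mul (hB i) (hB j) hX, lin_const, lieD_const, totalDeriv_const,
        totalDeriv_mul (df (hu i)) (df (hu j)), totalDeriv_mul (df (hB i)) (df (hB j)),
        lieD_mul (df (hu i)) (df (hu j)), lieD_mul (df (hB i)) (df (hB j))]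
  have l3 : ∀ i j e, lin X (emf i j) z L e = _ := fun i j e => by
    unfold emf
    rw [lin_add ((hu i).mul (hB j)) (hm.mul ((hu j).mul (hB i))) hX,
      lin_mul hm ((hu j).mul (hB i)) hX, lin_const, lieD_const, totalDeriv_const,
      lin_mul (hu i) (hB j) hX, lin_mul (hu j) (hB i) hX]
  simp only [l1, l2, l3]
  have e1 := hL.mass
  have e4 := hL.gauss
  simp only [matD, divU, Fin.sum_univ_three] at e1 e4
  have hmass : (lin X density z L eT + ∑ j, (density z * lin X (fun z => velocity z j) z L (eX j)
      + velocity z j * lin X density z L (eX j)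
      + lieD X density z * totalDeriv (fun z => velocity z j) z L (eX j)
      + lieD X (fun z => velocity z j) z * totalDeriv density z L (eX j))) =
      linMat X density z L + lieD X density z * divU z L + density z * linDivU X z L := by
    simp only [linMat, linDivU, divU, Fin.sum_univ_three]; ring
  rw [hmass]
  constructor
  · rintro ⟨a1, a2, a3, a4, a5, a6⟩
    refine ⟨a1, fun i => ?_, fun i => ?_, a4, a5, a6⟩
    · have b := a2 i
      simp only [matD, linMat, linDivU, divU, Fin.sum_univ_three] at a1 a4 b ⊢
      fin_cases i <;> simp [Matrix.one_apply] at b ⊢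
      · linear_combination b - velocity z 0 * a1 - lieD X (fun z => velocity z 0) z * e1
          - tension μ₀ z * magnetic z 0 * a4 - (lieD X (tension μ₀) z * magnetic z 0
            + tension μ₀ z * lieD X (fun z => magnetic z 0) z) * e4
      · linear_combination b - velocity z 1 * a1 - lieD X (fun z => velocity z 1) z * e1
          - tension μ₀ z * magnetic z 1 * a4 - (lieD X (tension μ₀) z * magnetic z 1
            + tension μ₀ z * lieD X (fun z => magnetic z 1) z) * e4
      · linear_combination b - velocity z 2 * a1 - lieD X (fun z => velocity z 2) z * e1
          - tension μ₀ z * magnetic z 2 * a4 - (lieD X (tension μ₀) z * magnetic z 2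
            + tension μ₀ z * lieD X (fun z => magnetic z 2) z) * e4
    · have b := a3 i
      simp only [linMat, linDivU, divU, Fin.sum_univ_three] at a4 b ⊢
      fin_cases i <;> simp at b ⊢
      · linear_combination b + velocity z 0 * a4 + lieD X (fun z => velocity z 0) z * e4
      · linear_combination b + velocity z 1 * a4 + lieD X (fun z => velocity z 1) z * e4
      · linear_combination b + velocity z 2 * a4 + lieD X (fun z => velocity z 2) z * e4
  · rintro ⟨a1, a2, a3, a4, a5, a6⟩
    refine ⟨a1, fun i => ?_, fun i => ?_, a4, a5, a6⟩
    · have b := a2 i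
      simp only [matD, linMat, linDivU, divU, Fin.sum_univ_three] at a1 a4 b ⊢
      fin_cases i <;> simp [Matrix.one_apply] at b ⊢
      · linear_combination b + velocity z 0 * a1 + lieD X (fun z => velocity z 0) z * e1
          + tension μ₀ z * magnetic z 0 * a4 + (lieD X (tension μ₀) z * magnetic z 0
            + tension μ₀ z * lieD X (fun z => magnetic z 0) z) * e4
      · linear_combination b + velocity z 1 * a1 + lieD X (fun z => velocity z 1) z * e1
          + tension μ₀ z * magnetic z 1 * a4 + (lieD X (tension μ₀) z * magnetic z 1
            + tension μ₀ z * lieD X (fun z => magnetic z 1) z) * e4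
      · linear_combination b + velocity z 2 * a1 + lieD X (fun z => velocity z 2) z * e1
          + tension μ₀ z * magnetic z 2 * a4 + (lieD X (tension μ₀) z * magnetic z 2
            + tension μ₀ z * lieD X (fun z => magnetic z 2) z) * e4
    · have b := a3 i
      simp only [linMat, linDivU, divU, Fin.sum_univ_three] at a4 b ⊢
      fin_cases i <;> simp at b ⊢
      · linear_combination b - velocity z 0 * a4 - lieD X (fun z => velocity z 0) z * e4
      · linear_combination b - velocity z 1 * a4 - lieD X (fun z => velocity z 1) z * e4
      · linear_combination b - velocity z 2 * a4 - lieD X (fun z => velocity z 2) z * e4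

end Linearization

end CGL

end

noncomputable section

namespace CGL

/-! ### The determining equations at one point -/

/-- The state at a point: `q = p_⊥`, `w = 1 / |B|²`, `s` is the tension, `m = 1 / μ₀`; the tension
has material derivative `γ ∇·u + δ ττ:∇u`. -/
structure PointData where
  (rho q w s m γ δ : ℝ)
  (u B : Fin 3 → ℝ)

/-- Space derivatives `r`, `s` of `ρ` and of the tension, `g k i = ∂_k u_i`, `b k i = ∂_k B_i`, and
the material derivative `y` of `u`. -/
structure JetData where
  (r y s : Fin 3 → ℝ)
  (g b : Fin 3 → Fin 3 → ℝ)

/-- The derivatives of a function along the material direction, the space directions, and the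
coordinates density, total pressure, tension, `u`, `B` on the states. -/
structure GradData where
  (D rho P s : ℝ)
  (x u B : Fin 3 → ℝ)

namespace PointData

variable (p : PointData) (j : JetData)

def div (j : JetData) : ℝ := ∑ k, j.g k k
def strain : ℝ := ∑ k, ∑ i, p.w * (p.B k * p.B i) * j.g k i
def Drho : ℝ := -(p.rho * div j)
def dP (k : Fin 3) : ℝ :=
  -(p.rho * j.y k) - ∑ l, (p.B k * p.B l * j.s l + p.s * p.B l * j.b l k)
def DB (i : Fin 3) : ℝ := ∑ k, p.B k * j.g k i - p.B i * div j
def DP : ℝ := -(2 * p.q + p.m / p.w) * div j + (p.q + p.m / p.w) * p.strain j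
def Ds : ℝ := p.γ * div j + p.δ * p.strain j
def Dq : ℝ := -(2 * p.q * div j) + p.q * p.strain j
def dq (k : Fin 3) : ℝ := p.dP j k - p.m * ∑ i, p.B i * j.b k i

end PointData

namespace GradData

variable (F : GradData) (p : PointData) (j : JetData)

/-- The material derivative at a jet. -/
def mat : ℝ := F.D + F.rho * p.Drho j + F.P * p.DP j + F.s * p.Ds j
  + ∑ i, F.u i * j.y i + ∑ i, F.B i * p.DB j i

/-- The space derivative at a jet. -/
def space (k : Fin 3) : ℝ := F.x k + F.rho * j.r k + F.P * p.dP j k + F.s * j.s k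
  + ∑ i, F.u i * j.g k i + ∑ i, F.B i * j.b k i

end GradData

/-- The values and derivatives at a point of the components of a vector field: along time and
space, and along `ρ`, the total pressure, the tension, `p_⊥`, `u`, `B`. -/
structure FieldData where
  (vR vS vQ : ℝ)
  (vU vB : Fin 3 → ℝ)
  (T R P S Q : GradData)
  (Z U B : Fin 3 → GradData)

set_option linter.unusedSimpArgs false

namespace FieldData

variable (f : FieldData) (p : PointData) (j : JetData)

def n0 : ℝ := f.T.mat p j
def n (k : Fin 3) : ℝ := f.T.space p j k
def m (k l : Fin 3) : ℝ := (f.Z l).space p j k - p.u l * f.n p j k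
def c (k : Fin 3) : ℝ := f.vU k - (f.Z k).mat p j + p.u k * f.n0 p j

/-- The linearization of the material derivative of a function with component `F`, material
derivative `Df` and space derivatives `fx`. -/
def linM (F : GradData) (Df : ℝ) (fx : Fin 3 → ℝ) : ℝ :=
  F.mat p j - f.n0 p j * Df + ∑ k, f.c p j k * fx k

/-- The linearization of a space derivative. -/
def linX (F : GradData) (Df : ℝ) (fx : Fin 3 → ℝ) (k : Fin 3) : ℝ :=
  F.space p j k - f.n p j k * Df - ∑ l, f.m p j k l * fx l

def linU (i k : Fin 3) : ℝ := f.linX p j (f.U i) (j.y i) (fun l => j.g l i) k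
def linB (i k : Fin 3) : ℝ := f.linX p j (f.B i) (p.DB j i) (fun l => j.b l i) k

def mass : ℝ := f.linM p j f.R (p.Drho j) j.r + f.vR * PointData.div j + p.rho * ∑ i, f.linU p j i i

def gauss : ℝ := ∑ i, f.linB p j i i

def faraday (i : Fin 3) : ℝ := f.linM p j (f.B i) (p.DB j i) (fun l => j.b l i)
  - ∑ k, (p.B k * f.linU p j i k + f.vB k * j.g k i)
  + p.B i * ∑ k, f.linU p j k k + f.vB i * PointData.div j

def momentum (i : Fin 3) : ℝ := p.rho * f.linM p j (f.U i) (j.y i) (fun l => j.g l i)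
  + f.vR * j.y i + f.linX p j f.P (p.DP j) (p.dP j) i
  + ∑ k, (p.B i * p.B k * f.linX p j f.S (p.Ds j) j.s k
    + (f.vB i * p.B k + p.B i * f.vB k) * j.s k
    + p.s * p.B k * f.linB p j i k + (f.vS * p.B k + p.s * f.vB k) * j.b k i)

def perp : ℝ := f.linM p j f.Q (p.Dq j) (p.dq j) + 2 * p.q * ∑ i, f.linU p j i i
  + 2 * f.vQ * PointData.div j
  - p.q * ∑ k, ∑ i, (p.w * (p.B k * p.B i) * f.linU p j i k
    + (-(2 * p.w ^ 2 * ∑ l, p.B l * f.vB l) * (p.B k * p.B i)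
      + p.w * (p.B k * f.vB i + p.B i * f.vB k)) * j.g k i)
  - f.vQ * p.strain j

/-- The linearized equations hold at all jets over the point. -/
structure Determining : Prop where
  mass (j : JetData) (hj : ∑ k, j.b k k = 0) : f.mass p j = 0
  gauss (j : JetData) (hj : ∑ k, j.b k k = 0) : f.gauss p j = 0
  faraday (j : JetData) (hj : ∑ k, j.b k k = 0) (i : Fin 3) : f.faraday p j i = 0
  momentum (j : JetData) (hj : ∑ k, j.b k k = 0) (i : Fin 3) : f.momentum p j i = 0
  perp (j : JetData) (hj : ∑ k, j.b k k = 0) : f.perp p j = 0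

variable {f p}

/-- A gradient vanishes along the states. -/
structure _root_.CGL.GradData.Horizontal (F : GradData) : Prop where
  rho : F.rho = 0
  P : F.P = 0
  s : F.s = 0
  u (i : Fin 3) : F.u i = 0
  B (i : Fin 3) : F.B i = 0

def eJ (k i : Fin 3) : Fin 3 → Fin 3 → ℝ := fun k' i' => if k' = k ∧ i' = i then 1 else 0

/-- The jet with the given first derivatives along one coordinate. -/
abbrev jr (k : Fin 3) : Fin 3 → ℝ := fun l => if l = k then 1 else 0

/-- The point is generic. -/
structure _root_.CGL.PointData.Generic (p : PointData) : Prop where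
  rho : p.rho ≠ 0
  q : p.q ≠ 0
  s : p.s ≠ 0
  B (i : Fin 3) : p.B i ≠ 0

/-! ### Terms quadratic in the jet: the space-time components do not depend on the states -/

/-- A gradient vanishes along density, total pressure and tension. -/
structure _root_.CGL.GradData.ScalarFree (F : GradData) : Prop where
  rho : F.rho = 0
  P : F.P = 0
  s : F.s = 0

/-- The mixed second difference of the four jets keeps the terms of Gauss's law bilinear in `∂_k
B_i` and in the data along `x_i`; there `∂_k B_i` is multiplied by the derivative of `Z k` along
`x_i`. The index pair is off-diagonal, so the jets stay divergence-free. -/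
theorem gauss_quadratic (h : f.Determining p) (k i : Fin 3) (hki : k ≠ i) (r y s : ℝ) :
    r * ((f.Z k).rho - p.u k * f.T.rho) + s * ((f.Z k).s - p.u k * f.T.s)
      - (p.rho * y + p.B i * p.B i * s) * ((f.Z k).P - p.u k * f.T.P) = 0 := by
  have h1 := h.gauss ⟨fun l => if l = i then r else 0, fun l => if l = i then y else 0,
    fun l => if l = i then s else 0, 0, eJ k i⟩ (by fin_cases k <;> fin_cases i <;> simp_all [eJ])
  have h2 := h.gauss ⟨fun l => if l = i then r else 0, fun l => if l = i then y else 0,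
    fun l => if l = i then s else 0, 0, 0⟩ (by simp)
  have h3 := h.gauss ⟨0, 0, 0, 0, eJ k i⟩ (by fin_cases k <;> fin_cases i <;> simp_all [eJ])
  have h4 := h.gauss ⟨0, 0, 0, 0, 0⟩ (by simp)
  simp only [FieldData.gauss, linM, linU, linB, linX, GradData.mat, GradData.space, n, n0, c, FieldData.m,
    PointData.DB, PointData.dP, PointData.Drho, PointData.DP, PointData.Ds, PointData.Dq,
    PointData.dq, PointData.strain, PointData.div, Fin.sum_univ_three] at h1 h2 h3 h4
  fin_cases k <;> fin_cases i <;> simp [eJ, jr, -mul_eq_zero, -mul_eq_left₀, -mul_eq_right₀, -neg_eq_zero] at h1 h2 h3 h4 hki ⊢ <;>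
    linear_combination -h1 + h2 + h3 - h4

/-- The velocity gradient enters through the material derivative `B_k ∂_k u_i` of `B_i`, which
Gauss's law multiplies by the derivative of `T` along `x_i`. -/
theorem gauss_quadratic_time (h : f.Determining p) (k i : Fin 3) (hki : k ≠ i) (r y s : ℝ) :
    p.B k * (r * f.T.rho + s * f.T.s - (p.rho * y + p.B i * p.B i * s) * f.T.P) = 0 := by
  have h1 := h.gauss ⟨fun l => if l = i then r else 0, fun l => if l = i then y else 0,
    fun l => if l = i then s else 0, eJ k i, 0⟩ (by simp)
  have h2 := h.gauss ⟨fun l => if l = i then r else 0, fun l => if l = i then y else 0,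
    fun l => if l = i then s else 0, 0, 0⟩ (by simp)
  have h3 := h.gauss ⟨0, 0, 0, eJ k i, 0⟩ (by simp)
  have h4 := h.gauss ⟨0, 0, 0, 0, 0⟩ (by simp)
  simp only [FieldData.gauss, linM, linU, linB, linX, GradData.mat, GradData.space, n, n0, c, FieldData.m,
    PointData.DB, PointData.dP, PointData.Drho, PointData.DP, PointData.Ds, PointData.Dq,
    PointData.dq, PointData.strain, PointData.div, Fin.sum_univ_three] at h1 h2 h3 h4
  fin_cases k <;> fin_cases i <;> simp [eJ, jr, -mul_eq_zero, -mul_eq_left₀, -mul_eq_right₀, -neg_eq_zero] at h1 h2 h3 h4 hki ⊢ <;>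
    linear_combination -h1 + h2 + h3 - h4

theorem scalarFree_T (h : f.Determining p) (hp : p.Generic) : f.T.ScalarFree := by
  have h1 := fun r y s =>
    (mul_eq_zero.1 (gauss_quadratic_time h 0 1 (by decide) r y s)).resolve_left (hp.B 0)
  have hP : f.T.P = 0 := by simpa [hp.rho] using h1 0 1 0
  exact ⟨by simpa using h1 1 0 0, hP, by simpa [hP] using h1 0 0 1⟩

theorem scalarFree_Z (h : f.Determining p) (hp : p.Generic) (k : Fin 3) :
    (f.Z k).ScalarFree := by
  have hT := scalarFree_T h hp
  obtain ⟨i, hi⟩ : ∃ i, k ≠ i := ⟨k + 1, by fin_cases k <;> decide⟩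
  have h1 := gauss_quadratic h k i hi
  simp only [hT.rho, hT.P, hT.s, mul_zero, sub_zero] at h1
  have hP : (f.Z k).P = 0 := by simpa [hp.rho] using h1 0 1 0
  exact ⟨by simpa using h1 1 0 0, hP, by simpa [hP] using h1 0 0 1⟩

/-- The linearized divergence of `u` contains minus the acceleration `y_i` times the derivative of
`T` along `x_i`. Pairing `y_i` with `∂_i u_j` isolates `∂T/∂u_j`, and `i ≠ j` keeps the divergence
zero. -/
theorem mul_T_u (h : f.Determining p) (hp : p.Generic) (i j : Fin 3) (hij : i ≠ j) :
    p.rho * f.T.u j = 0 := by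
  have hT := scalarFree_T h hp
  have hZ := scalarFree_Z h hp
  have h1 := h.mass ⟨0, jr i, 0, eJ i j, 0⟩ (by simp)
  have h2 := h.mass ⟨0, jr i, 0, 0, 0⟩ (by simp)
  have h3 := h.mass ⟨0, 0, 0, eJ i j, 0⟩ (by simp)
  have h4 := h.mass ⟨0, 0, 0, 0, 0⟩ (by simp)
  simp only [FieldData.mass, linM, linU, linB, linX, GradData.mat, GradData.space, n, n0, c, FieldData.m,
    PointData.DB, PointData.dP, PointData.Drho, PointData.DP, PointData.Ds, PointData.Dq,
    PointData.dq, PointData.strain, PointData.div, Fin.sum_univ_three,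
    hT.rho, hT.P, hT.s, (hZ _).rho, (hZ _).P, (hZ _).s] at h1 h2 h3 h4
  fin_cases i <;> fin_cases j <;> simp [eJ, jr, -mul_eq_zero, -mul_eq_left₀, -mul_eq_right₀, -neg_eq_zero] at h1 h2 h3 h4 hij ⊢ <;>
    linear_combination -h1 + h2 + h3 - h4

theorem T_u (h : f.Determining p) (hp : p.Generic) (j : Fin 3) : f.T.u j = 0 :=
  (mul_eq_zero.1 (mul_T_u h hp (j + 1) j (by fin_cases j <;> decide))).resolve_left hp.rho

theorem mul_T_B (h : f.Determining p) (hp : p.Generic) (i j : Fin 3) (hij : i ≠ j) :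
    p.rho * f.T.B j = 0 := by
  have hT := scalarFree_T h hp
  have hZ := scalarFree_Z h hp
  have h1 := h.mass ⟨0, jr i, 0, 0, eJ i j⟩ (by fin_cases i <;> fin_cases j <;> simp_all [eJ])
  have h2 := h.mass ⟨0, jr i, 0, 0, 0⟩ (by simp)
  have h3 := h.mass ⟨0, 0, 0, 0, eJ i j⟩ (by fin_cases i <;> fin_cases j <;> simp_all [eJ])
  have h4 := h.mass ⟨0, 0, 0, 0, 0⟩ (by simp)
  simp only [FieldData.mass, linM, linU, linB, linX, GradData.mat, GradData.space, n, n0, c, FieldData.m,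
    PointData.DB, PointData.dP, PointData.Drho, PointData.DP, PointData.Ds, PointData.Dq,
    PointData.dq, PointData.strain, PointData.div, Fin.sum_univ_three,
    hT.rho, hT.P, hT.s, (hZ _).rho, (hZ _).P, (hZ _).s, T_u h hp] at h1 h2 h3 h4
  fin_cases i <;> fin_cases j <;> simp [eJ, jr, -mul_eq_zero, -mul_eq_left₀, -mul_eq_right₀, -neg_eq_zero] at h1 h2 h3 h4 hij ⊢ <;>
    linear_combination -h1 + h2 + h3 - h4

theorem horizontal_T (h : f.Determining p) (hp : p.Generic) : f.T.Horizontal :=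
  have hT := scalarFree_T h hp
  ⟨hT.rho, hT.P, hT.s, T_u h hp, fun j =>
    (mul_eq_zero.1 (mul_T_B h hp (j + 1) j (by fin_cases j <;> decide))).resolve_left hp.rho⟩

theorem Z_u (h : f.Determining p) (hp : p.Generic) (k j : Fin 3) : (f.Z k).u j = 0 := by
  have hT := horizontal_T h hp
  have hZ := scalarFree_Z h hp
  have h1 := h.mass ⟨jr k, jr j, 0, 0, 0⟩ (by simp)
  have h2 := h.mass ⟨0, jr j, 0, 0, 0⟩ (by simp)
  have h3 := h.mass ⟨jr k, 0, 0, 0, 0⟩ (by simp)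
  have h4 := h.mass ⟨0, 0, 0, 0, 0⟩ (by simp)
  simp only [FieldData.mass, linM, linU, linB, linX, GradData.mat, GradData.space, n, n0, c, FieldData.m,
    PointData.DB, PointData.dP, PointData.Drho, PointData.DP, PointData.Ds, PointData.Dq,
    PointData.dq, PointData.strain, PointData.div, Fin.sum_univ_three,
    hT.rho, hT.P, hT.s, hT.u, hT.B, (hZ _).rho, (hZ _).P, (hZ _).s] at h1 h2 h3 h4
  fin_cases k <;> fin_cases j <;> simp [eJ, jr, -mul_eq_zero, -mul_eq_left₀, -mul_eq_right₀, -neg_eq_zero] at h1 h2 h3 h4 ⊢ <;>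
    linear_combination -h1 + h2 + h3 - h4

-- The linearized divergence of `u` contains `∂_k u_i` times the derivative of `Z k` along `x_i`.
-- With the intermediate index `i = j + 1` the entry `∂_i B_j` is off-diagonal, hence compatible
-- with Gauss's law.
set_option maxHeartbeats 1000000 in
theorem mul_Z_B (h : f.Determining p) (hp : p.Generic) (k j : Fin 3) :
    p.rho * (f.Z k).B j = 0 := by
  have hT := horizontal_T h hp
  have hZ := scalarFree_Z h hp
  have h1 := h.mass ⟨0, 0, 0, eJ k (j + 1), eJ (j + 1) j⟩ (by fin_cases j <;> simp_all [eJ])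
  have h2 := h.mass ⟨0, 0, 0, eJ k (j + 1), 0⟩ (by simp)
  have h3 := h.mass ⟨0, 0, 0, 0, eJ (j + 1) j⟩ (by fin_cases j <;> simp_all [eJ])
  have h4 := h.mass ⟨0, 0, 0, 0, 0⟩ (by simp)
  simp only [FieldData.mass, linM, linU, linB, linX, GradData.mat, GradData.space, n, n0, c, FieldData.m,
    PointData.DB, PointData.dP, PointData.Drho, PointData.DP, PointData.Ds, PointData.Dq,
    PointData.dq, PointData.strain, PointData.div, Fin.sum_univ_three,
    hT.rho, hT.P, hT.s, hT.u, hT.B, (hZ _).rho, (hZ _).P, (hZ _).s, Z_u h hp] at h1 h2 h3 h4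
  fin_cases j <;> fin_cases k <;> simp [eJ, jr, -mul_eq_zero, -mul_eq_left₀, -mul_eq_right₀, -neg_eq_zero] at h1 h2 h3 h4 ⊢ <;>
    linear_combination -h1 + h2 + h3 - h4

theorem horizontal_Z (h : f.Determining p) (hp : p.Generic) (k : Fin 3) : (f.Z k).Horizontal :=
  have hZ := scalarFree_Z h hp k
  ⟨hZ.rho, hZ.P, hZ.s, Z_u h hp k, fun j =>
    (mul_eq_zero.1 (mul_Z_B h hp k j)).resolve_left hp.rho⟩

end FieldData

end CGL

end

noncomputable section

namespace CGL

set_option linter.unusedSimpArgs false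

/-! ### Constant and linear coefficients of the determining equations -/

namespace FieldData

variable {f : FieldData} {p : PointData}

/-- The zero jet isolates the term of degree zero. Subtracting it from the value at a unit jet gives
the linear coefficients below; quadratic terms no longer survive, since `T` and `Z` have no
derivatives along the states. -/
theorem mass_const (h : f.Determining p)
    (hT : f.T.Horizontal) (hZ : ∀ k, (f.Z k).Horizontal) :
    f.R.D + p.rho * ∑ i, (f.U i).x i = 0 := by
  have h1 := h.mass ⟨0, 0, 0, 0, 0⟩ (by simp)
  simp only [FieldData.mass, linM, linU, linB, linX, GradData.mat, GradData.space, n, n0, c, FieldData.m,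
    PointData.DB, PointData.dP, PointData.Drho, PointData.DP, PointData.Ds, PointData.Dq,
    PointData.dq, PointData.strain, PointData.div, Fin.sum_univ_three,
    hT.rho, hT.P, hT.s, hT.u, hT.B, (hZ _).rho, (hZ _).P, (hZ _).s,
    (hZ _).u, (hZ _).B, zero_mul, add_zero] at h1
  simp [eJ, jr, Fin.sum_univ_three, -mul_eq_zero, -mul_eq_left₀, -mul_eq_right₀, -neg_eq_zero] at h1 ⊢ <;>
    linear_combination h1

theorem mass_r (h : f.Determining p)
    (hT : f.T.Horizontal) (hZ : ∀ k, (f.Z k).Horizontal) (k : Fin 3) :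
    f.vU k - (f.Z k).D + p.u k * f.T.D + p.rho * (f.U k).rho = 0 := by
  have h1 := h.mass ⟨jr k, 0, 0, 0, 0⟩ (by simp)
  have h2 := h.mass ⟨0, 0, 0, 0, 0⟩ (by simp)
  simp only [FieldData.mass, linM, linU, linB, linX, GradData.mat, GradData.space, n, n0, c, FieldData.m,
    PointData.DB, PointData.dP, PointData.Drho, PointData.DP, PointData.Ds, PointData.Dq,
    PointData.dq, PointData.strain, PointData.div, Fin.sum_univ_three,
    hT.rho, hT.P, hT.s, hT.u, hT.B, (hZ _).rho, (hZ _).P, (hZ _).s,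
    (hZ _).u, (hZ _).B, zero_mul, add_zero] at h1 h2
  fin_cases k <;> simp [eJ, jr, Fin.sum_univ_three, -mul_eq_zero, -mul_eq_left₀, -mul_eq_right₀, -neg_eq_zero] at h1 h2 ⊢ <;>
    linear_combination h1 - h2

theorem gauss_const (h : f.Determining p)
    (hT : f.T.Horizontal) (hZ : ∀ k, (f.Z k).Horizontal) :
    ∑ i, (f.B i).x i = 0 := by
  have h1 := h.gauss ⟨0, 0, 0, 0, 0⟩ (by simp)
  simp only [FieldData.gauss, linM, linU, linB, linX, GradData.mat, GradData.space, n, n0, c, FieldData.m,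
    PointData.DB, PointData.dP, PointData.Drho, PointData.DP, PointData.Ds, PointData.Dq,
    PointData.dq, PointData.strain, PointData.div, Fin.sum_univ_three,
    hT.rho, hT.P, hT.s, hT.u, hT.B, (hZ _).rho, (hZ _).P, (hZ _).s,
    (hZ _).u, (hZ _).B, zero_mul, add_zero] at h1
  simp [eJ, jr, Fin.sum_univ_three, -mul_eq_zero, -mul_eq_left₀, -mul_eq_right₀, -neg_eq_zero] at h1 ⊢ <;>
    linear_combination h1

theorem gauss_r (h : f.Determining p)
    (hT : f.T.Horizontal) (hZ : ∀ k, (f.Z k).Horizontal) (k : Fin 3) :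
    (f.B k).rho = 0 := by
  have h1 := h.gauss ⟨jr k, 0, 0, 0, 0⟩ (by simp)
  have h2 := h.gauss ⟨0, 0, 0, 0, 0⟩ (by simp)
  simp only [FieldData.gauss, linM, linU, linB, linX, GradData.mat, GradData.space, n, n0, c, FieldData.m,
    PointData.DB, PointData.dP, PointData.Drho, PointData.DP, PointData.Ds, PointData.Dq,
    PointData.dq, PointData.strain, PointData.div, Fin.sum_univ_three,
    hT.rho, hT.P, hT.s, hT.u, hT.B, (hZ _).rho, (hZ _).P, (hZ _).s,
    (hZ _).u, (hZ _).B, zero_mul, add_zero] at h1 h2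
  fin_cases k <;> simp [eJ, jr, Fin.sum_univ_three, -mul_eq_zero, -mul_eq_left₀, -mul_eq_right₀, -neg_eq_zero] at h1 h2 ⊢ <;>
    linear_combination h1 - h2

theorem gauss_y (h : f.Determining p)
    (hT : f.T.Horizontal) (hZ : ∀ k, (f.Z k).Horizontal) (k : Fin 3) :
    p.rho * (f.B k).P = 0 := by
  have h1 := h.gauss ⟨0, jr k, 0, 0, 0⟩ (by simp)
  have h2 := h.gauss ⟨0, 0, 0, 0, 0⟩ (by simp)
  simp only [FieldData.gauss, linM, linU, linB, linX, GradData.mat, GradData.space, n, n0, c, FieldData.m,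
    PointData.DB, PointData.dP, PointData.Drho, PointData.DP, PointData.Ds, PointData.Dq,
    PointData.dq, PointData.strain, PointData.div, Fin.sum_univ_three,
    hT.rho, hT.P, hT.s, hT.u, hT.B, (hZ _).rho, (hZ _).P, (hZ _).s,
    (hZ _).u, (hZ _).B, zero_mul, add_zero] at h1 h2
  fin_cases k <;> simp [eJ, jr, Fin.sum_univ_three, -mul_eq_zero, -mul_eq_left₀, -mul_eq_right₀, -neg_eq_zero] at h1 h2 ⊢ <;>
    linear_combination h2 - h1

theorem gauss_s (h : f.Determining p)
    (hT : f.T.Horizontal) (hZ : ∀ k, (f.Z k).Horizontal)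
    (hP : ∀ k, (f.B k).P = 0) (k : Fin 3) : (f.B k).s = 0 := by
  have h1 := h.gauss ⟨0, 0, jr k, 0, 0⟩ (by simp)
  have h2 := h.gauss ⟨0, 0, 0, 0, 0⟩ (by simp)
  simp only [FieldData.gauss, linM, linU, linB, linX, GradData.mat, GradData.space, n, n0, c, FieldData.m,
    PointData.DB, PointData.dP, PointData.Drho, PointData.DP, PointData.Ds, PointData.Dq,
    PointData.dq, PointData.strain, PointData.div, Fin.sum_univ_three,
    hT.rho, hT.P, hT.s, hT.u, hT.B, (hZ _).rho, (hZ _).P, (hZ _).s,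
    (hZ _).u, (hZ _).B, zero_mul, add_zero, hP] at h1 h2
  fin_cases k <;> simp [eJ, jr, Fin.sum_univ_three, -mul_eq_zero, -mul_eq_left₀, -mul_eq_right₀, -neg_eq_zero] at h1 h2 ⊢ <;>
    linear_combination h1 - h2

theorem gauss_g (h : f.Determining p)
    (hT : f.T.Horizontal) (hZ : ∀ k, (f.Z k).Horizontal)
    (hP : ∀ k, (f.B k).P = 0) (k i : Fin 3) :
    (f.B k).u i - f.T.x i * p.B k + (if k = i then ∑ l, f.T.x l * p.B l else 0) = 0 := by
  have h1 := h.gauss ⟨0, 0, 0, eJ k i, 0⟩ (by simp)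
  have h2 := h.gauss ⟨0, 0, 0, 0, 0⟩ (by simp)
  simp only [FieldData.gauss, linM, linU, linB, linX, GradData.mat, GradData.space, n, n0, c, FieldData.m,
    PointData.DB, PointData.dP, PointData.Drho, PointData.DP, PointData.Ds, PointData.Dq,
    PointData.dq, PointData.strain, PointData.div, Fin.sum_univ_three,
    hT.rho, hT.P, hT.s, hT.u, hT.B, (hZ _).rho, (hZ _).P, (hZ _).s,
    (hZ _).u, (hZ _).B, zero_mul, add_zero, hP] at h1 h2
  fin_cases k <;> fin_cases i <;> simp [eJ, jr, Fin.sum_univ_three, -mul_eq_zero, -mul_eq_left₀, -mul_eq_right₀, -neg_eq_zero] at h1 h2 ⊢ <;>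
    linear_combination h1 - h2

theorem gauss_b (h : f.Determining p)
    (hT : f.T.Horizontal) (hZ : ∀ k, (f.Z k).Horizontal)
    (hP : ∀ k, (f.B k).P = 0) (k i : Fin 3) (hki : k ≠ i) :
    (f.B k).B i - ((f.Z k).x i - p.u k * f.T.x i) = 0 := by
  have h1 := h.gauss ⟨0, 0, 0, 0, eJ k i⟩ (by fin_cases k <;> fin_cases i <;> simp_all [eJ])
  have h2 := h.gauss ⟨0, 0, 0, 0, 0⟩ (by simp)
  simp only [FieldData.gauss, linM, linU, linB, linX, GradData.mat, GradData.space, n, n0, c, FieldData.m,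
    PointData.DB, PointData.dP, PointData.Drho, PointData.DP, PointData.Ds, PointData.Dq,
    PointData.dq, PointData.strain, PointData.div, Fin.sum_univ_three,
    hT.rho, hT.P, hT.s, hT.u, hT.B, (hZ _).rho, (hZ _).P, (hZ _).s,
    (hZ _).u, (hZ _).B, zero_mul, add_zero, hP] at h1 h2
  fin_cases k <;> fin_cases i <;> simp [eJ, jr, Fin.sum_univ_three, -mul_eq_zero, -mul_eq_left₀, -mul_eq_right₀, -neg_eq_zero] at h1 h2 hki ⊢ <;>
    linear_combination h1 - h2

/-- Diagonal entries of the gradient of `B` are admissible only with zero trace, so Gauss's law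
determines only the differences of their coefficients. -/
theorem gauss_b_diag (h : f.Determining p)
    (hT : f.T.Horizontal) (hZ : ∀ k, (f.Z k).Horizontal)
    (hP : ∀ k, (f.B k).P = 0) (k : Fin 3) :
    (f.B k).B k - ((f.Z k).x k - p.u k * f.T.x k)
      - ((f.B 0).B 0 - ((f.Z 0).x 0 - p.u 0 * f.T.x 0)) = 0 := by
  have h1 := h.gauss ⟨0, 0, 0, 0, fun a b => eJ k k a b - eJ 0 0 a b⟩ (by fin_cases k <;> simp_all [eJ])
  have h2 := h.gauss ⟨0, 0, 0, 0, 0⟩ (by simp)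
  simp only [FieldData.gauss, linM, linU, linB, linX, GradData.mat, GradData.space, n, n0, c, FieldData.m,
    PointData.DB, PointData.dP, PointData.Drho, PointData.DP, PointData.Ds, PointData.Dq,
    PointData.dq, PointData.strain, PointData.div, Fin.sum_univ_three,
    hT.rho, hT.P, hT.s, hT.u, hT.B, (hZ _).rho, (hZ _).P, (hZ _).s,
    (hZ _).u, (hZ _).B, zero_mul, add_zero, hP] at h1 h2
  fin_cases k <;> simp [eJ, jr, Fin.sum_univ_three, -mul_eq_zero, -mul_eq_left₀, -mul_eq_right₀, -neg_eq_zero] at h1 h2 ⊢ <;>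
    linear_combination h1 - h2

theorem faraday_const (h : f.Determining p)
    (hT : f.T.Horizontal) (hZ : ∀ k, (f.Z k).Horizontal) (i : Fin 3) :
    (f.B i).D - ∑ k, p.B k * (f.U i).x k + p.B i * ∑ k, (f.U k).x k = 0 := by
  have h1 := h.faraday ⟨0, 0, 0, 0, 0⟩ (by simp) i
  simp only [FieldData.faraday, linM, linU, linB, linX, GradData.mat, GradData.space, n, n0, c, FieldData.m,
    PointData.DB, PointData.dP, PointData.Drho, PointData.DP, PointData.Ds, PointData.Dq,
    PointData.dq, PointData.strain, PointData.div, Fin.sum_univ_three,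
    hT.rho, hT.P, hT.s, hT.u, hT.B, (hZ _).rho, (hZ _).P, (hZ _).s,
    (hZ _).u, (hZ _).B, zero_mul, add_zero] at h1
  fin_cases i <;> simp [eJ, jr, Fin.sum_univ_three, -mul_eq_zero, -mul_eq_left₀, -mul_eq_right₀, -neg_eq_zero] at h1 ⊢ <;>
    linear_combination h1

theorem faraday_r (h : f.Determining p)
    (hT : f.T.Horizontal) (hZ : ∀ k, (f.Z k).Horizontal)
    (hr : ∀ k, (f.B k).rho = 0) (i k : Fin 3) :
    p.B i * (f.U k).rho - p.B k * (f.U i).rho = 0 := by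
  have h1 := h.faraday ⟨jr k, 0, 0, 0, 0⟩ (by simp) i
  have h2 := h.faraday ⟨0, 0, 0, 0, 0⟩ (by simp) i
  simp only [FieldData.faraday, linM, linU, linB, linX, GradData.mat, GradData.space, n, n0, c, FieldData.m,
    PointData.DB, PointData.dP, PointData.Drho, PointData.DP, PointData.Ds, PointData.Dq,
    PointData.dq, PointData.strain, PointData.div, Fin.sum_univ_three,
    hT.rho, hT.P, hT.s, hT.u, hT.B, (hZ _).rho, (hZ _).P, (hZ _).s,
    (hZ _).u, (hZ _).B, zero_mul, add_zero, hr] at h1 h2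
  fin_cases i <;> fin_cases k <;> simp [eJ, jr, Fin.sum_univ_three, -mul_eq_zero, -mul_eq_left₀, -mul_eq_right₀, -neg_eq_zero] at h1 h2 ⊢ <;>
    linear_combination h1 - h2

/-- The off-diagonal velocity gradient `∂_l u_i` has zero divergence, and its coefficient in the
`i`-th Faraday equation contains the value `vB l` undifferentiated. This is what later makes the
magnetic component explicit. -/
theorem faraday_g (h : f.Determining p)
    (hT : f.T.Horizontal) (hZ : ∀ k, (f.Z k).Horizontal)
    (hP : ∀ k, (f.B k).P = 0) (hs : ∀ k, (f.B k).s = 0) (hc : ∀ k, f.vU k - (f.Z k).D + p.u k * f.T.D = 0)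
    (i l : Fin 3) (hil : l ≠ i) :
    (f.B i).B i * p.B l - f.T.D * p.B l - p.B l * (f.U i).u i
      + ∑ k, p.B k * ((f.Z l).x k - p.u l * f.T.x k) - f.vB l
      + p.B i * ((f.U l).u i - ((f.Z l).x i - p.u l * f.T.x i)) = 0 := by
  have h1 := h.faraday ⟨0, 0, 0, eJ l i, 0⟩ (by simp) i
  have h2 := h.faraday ⟨0, 0, 0, 0, 0⟩ (by simp) i
  simp only [FieldData.faraday, linM, linU, linB, linX, GradData.mat, GradData.space, n, n0, c, FieldData.m,
    PointData.DB, PointData.dP, PointData.Drho, PointData.DP, PointData.Ds, PointData.Dq,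
    PointData.dq, PointData.strain, PointData.div, Fin.sum_univ_three,
    hT.rho, hT.P, hT.s, hT.u, hT.B, (hZ _).rho, (hZ _).P, (hZ _).s,
    (hZ _).u, (hZ _).B, zero_mul, add_zero, hP, hs, hc] at h1 h2
  fin_cases l <;> fin_cases i <;> simp [eJ, jr, Fin.sum_univ_three, -mul_eq_zero, -mul_eq_left₀, -mul_eq_right₀, -neg_eq_zero] at h1 h2 hil ⊢ <;>
    linear_combination h1 - h2

theorem momentum_const (h : f.Determining p)
    (hT : f.T.Horizontal) (hZ : ∀ k, (f.Z k).Horizontal) (i : Fin 3) :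
    p.rho * (f.U i).D + f.P.x i
      + ∑ k, (p.B i * p.B k * f.S.x k + p.s * p.B k * (f.B i).x k) = 0 := by
  have h1 := h.momentum ⟨0, 0, 0, 0, 0⟩ (by simp) i
  simp only [FieldData.momentum, linM, linU, linB, linX, GradData.mat, GradData.space, n, n0, c, FieldData.m,
    PointData.DB, PointData.dP, PointData.Drho, PointData.DP, PointData.Ds, PointData.Dq,
    PointData.dq, PointData.strain, PointData.div, Fin.sum_univ_three,
    hT.rho, hT.P, hT.s, hT.u, hT.B, (hZ _).rho, (hZ _).P, (hZ _).s,
    (hZ _).u, (hZ _).B, zero_mul, add_zero] at h1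
  fin_cases i <;> simp [eJ, jr, Fin.sum_univ_three, -mul_eq_zero, -mul_eq_left₀, -mul_eq_right₀, -neg_eq_zero] at h1 ⊢ <;>
    linear_combination h1

theorem momentum_r (h : f.Determining p)
    (hT : f.T.Horizontal) (hZ : ∀ k, (f.Z k).Horizontal)
    (hr : ∀ k, (f.B k).rho = 0) (hP : ∀ k, (f.B k).P = 0) (hs : ∀ k, (f.B k).s = 0) (i k : Fin 3) :
    (if i = k then f.P.rho else 0) + p.B i * p.B k * f.S.rho = 0 := by
  have h1 := h.momentum ⟨jr k, 0, 0, 0, 0⟩ (by simp) i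
  have h2 := h.momentum ⟨0, 0, 0, 0, 0⟩ (by simp) i
  simp only [FieldData.momentum, linM, linU, linB, linX, GradData.mat, GradData.space, n, n0, c, FieldData.m,
    PointData.DB, PointData.dP, PointData.Drho, PointData.DP, PointData.Ds, PointData.Dq,
    PointData.dq, PointData.strain, PointData.div, Fin.sum_univ_three,
    hT.rho, hT.P, hT.s, hT.u, hT.B, (hZ _).rho, (hZ _).P, (hZ _).s,
    (hZ _).u, (hZ _).B, zero_mul, add_zero, hr, hP, hs] at h1 h2
  fin_cases i <;> fin_cases k <;> simp [eJ, jr, Fin.sum_univ_three, -mul_eq_zero, -mul_eq_left₀, -mul_eq_right₀, -neg_eq_zero] at h1 h2 ⊢ <;>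
    linear_combination h1 - h2

/-- The acceleration enters directly and also through the gradient of the total pressure. Its
coefficient therefore couples the derivatives of `U` and `Z` to the derivatives of the pressure and
tension components along the total pressure. -/
theorem momentum_y (h : f.Determining p)
    (hT : f.T.Horizontal) (hZ : ∀ k, (f.Z k).Horizontal)
    (hr : ∀ k, (f.B k).rho = 0) (hP : ∀ k, (f.B k).P = 0) (hs : ∀ k, (f.B k).s = 0) (i k : Fin 3) :
    p.rho * (f.U i).u k + p.rho * ((f.Z k).x i - p.u k * f.T.x i)
      + (if i = k then f.vR - p.rho * f.T.D - p.rho * f.P.P else 0)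
      - p.rho * p.B i * p.B k * f.S.P = 0 := by
  have h1 := h.momentum ⟨0, jr k, 0, 0, 0⟩ (by simp) i
  have h2 := h.momentum ⟨0, 0, 0, 0, 0⟩ (by simp) i
  simp only [FieldData.momentum, linM, linU, linB, linX, GradData.mat, GradData.space, n, n0, c, FieldData.m,
    PointData.DB, PointData.dP, PointData.Drho, PointData.DP, PointData.Ds, PointData.Dq,
    PointData.dq, PointData.strain, PointData.div, Fin.sum_univ_three,
    hT.rho, hT.P, hT.s, hT.u, hT.B, (hZ _).rho, (hZ _).P, (hZ _).s,
    (hZ _).u, (hZ _).B, zero_mul, add_zero, hr, hP, hs] at h1 h2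
  fin_cases i <;> fin_cases k <;> simp [eJ, jr, Fin.sum_univ_three, -mul_eq_zero, -mul_eq_left₀, -mul_eq_right₀, -neg_eq_zero] at h1 h2 ⊢ <;>
    linear_combination h1 - h2

theorem momentum_s (h : f.Determining p)
    (hT : f.T.Horizontal) (hZ : ∀ k, (f.Z k).Horizontal)
    (hr : ∀ k, (f.B k).rho = 0) (hP : ∀ k, (f.B k).P = 0) (hs : ∀ k, (f.B k).s = 0)
    (hSP : f.S.P = 0) (i k : Fin 3) :
    (if i = k then f.P.s else 0) - p.B i * p.B k * f.P.P
      + ∑ l, ((f.Z l).x i - p.u l * f.T.x i) * p.B l * p.B k + p.B i * p.B k * f.S.s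
      - p.B i * ∑ l, p.B l * ((f.Z k).x l - p.u k * f.T.x l)
      + f.vB i * p.B k + p.B i * f.vB k = 0 := by
  have h1 := h.momentum ⟨0, 0, jr k, 0, 0⟩ (by simp) i
  have h2 := h.momentum ⟨0, 0, 0, 0, 0⟩ (by simp) i
  simp only [FieldData.momentum, linM, linU, linB, linX, GradData.mat, GradData.space, n, n0, c, FieldData.m,
    PointData.DB, PointData.dP, PointData.Drho, PointData.DP, PointData.Ds, PointData.Dq,
    PointData.dq, PointData.strain, PointData.div, Fin.sum_univ_three,
    hT.rho, hT.P, hT.s, hT.u, hT.B, (hZ _).rho, (hZ _).P, (hZ _).s,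
    (hZ _).u, (hZ _).B, zero_mul, add_zero, hr, hP, hs, hSP] at h1 h2
  fin_cases i <;> fin_cases k <;> simp [eJ, jr, Fin.sum_univ_three, -mul_eq_zero, -mul_eq_left₀, -mul_eq_right₀, -neg_eq_zero] at h1 h2 ⊢ <;>
    linear_combination h1 - h2

set_option maxHeartbeats 1000000 in
theorem momentum_b (h : f.Determining p)
    (hT : f.T.Horizontal) (hZ : ∀ k, (f.Z k).Horizontal)
    (hr : ∀ k, (f.B k).rho = 0) (hP : ∀ k, (f.B k).P = 0) (hs : ∀ k, (f.B k).s = 0)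
    (hSP : f.S.P = 0) (i l j : Fin 3) (hlj : l ≠ j) :
    (if i = l then f.P.B j else 0)
      + (if i = j then f.vS * p.B l + p.s * f.vB l - p.s * p.B l * f.P.P
          - p.s * ∑ k, p.B k * ((f.Z l).x k - p.u l * f.T.x k) else 0)
      + ((f.Z j).x i - p.u j * f.T.x i) * p.s * p.B l
      + p.B i * p.B l * f.S.B j + p.s * p.B l * (f.B i).B j = 0 := by
  have h1 := h.momentum ⟨0, 0, 0, 0, eJ l j⟩ (by fin_cases l <;> fin_cases j <;> simp_all [eJ]) i
  have h2 := h.momentum ⟨0, 0, 0, 0, 0⟩ (by simp) i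
  simp only [FieldData.momentum, linM, linU, linB, linX, GradData.mat, GradData.space, n, n0, c, FieldData.m,
    PointData.DB, PointData.dP, PointData.Drho, PointData.DP, PointData.Ds, PointData.Dq,
    PointData.dq, PointData.strain, PointData.div, Fin.sum_univ_three,
    hT.rho, hT.P, hT.s, hT.u, hT.B, (hZ _).rho, (hZ _).P, (hZ _).s,
    (hZ _).u, (hZ _).B, zero_mul, add_zero, hr, hP, hs, hSP] at h1 h2
  fin_cases l <;> fin_cases j <;> fin_cases i <;> simp [eJ, jr, Fin.sum_univ_three, -mul_eq_zero, -mul_eq_left₀, -mul_eq_right₀, -neg_eq_zero] at h1 h2 hlj ⊢ <;>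
    linear_combination h1 - h2

theorem perp_r (h : f.Determining p)
    (hT : f.T.Horizontal) (hZ : ∀ k, (f.Z k).Horizontal) (k : Fin 3) :
    2 * p.q * (f.U k).rho - p.q * p.w * ∑ i, p.B k * p.B i * (f.U i).rho = 0 := by
  have h1 := h.perp ⟨jr k, 0, 0, 0, 0⟩ (by simp)
  have h2 := h.perp ⟨0, 0, 0, 0, 0⟩ (by simp)
  simp only [FieldData.perp, linM, linU, linB, linX, GradData.mat, GradData.space, n, n0, c, FieldData.m,
    PointData.DB, PointData.dP, PointData.Drho, PointData.DP, PointData.Ds, PointData.Dq,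
    PointData.dq, PointData.strain, PointData.div, Fin.sum_univ_three,
    hT.rho, hT.P, hT.s, hT.u, hT.B, (hZ _).rho, (hZ _).P, (hZ _).s,
    (hZ _).u, (hZ _).B, zero_mul, add_zero] at h1 h2
  fin_cases k <;> simp [eJ, jr, Fin.sum_univ_three, -mul_eq_zero, -mul_eq_left₀, -mul_eq_right₀, -neg_eq_zero] at h1 h2 ⊢ <;>
    linear_combination h1 - h2

set_option maxHeartbeats 1000000 in
theorem perp_g (h : f.Determining p)
    (hT : f.T.Horizontal) (hZ : ∀ k, (f.Z k).Horizontal)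
    (hUP : ∀ k, (f.U k).P = 0) (hUs : ∀ k, (f.U k).s = 0) (hUB : ∀ k l, (f.U k).B l = 0)
    (hn : ∀ k, f.T.x k = 0) (hc : ∀ k, f.vU k - (f.Z k).D + p.u k * f.T.D = 0) (l j : Fin 3) :
    f.Q.P * ((if l = j then -(2 * p.q + p.m / p.w) else 0)
        + (p.q + p.m / p.w) * p.w * p.B l * p.B j)
      + f.Q.s * ((if l = j then p.γ else 0) + p.δ * p.w * p.B l * p.B j)
      - (if l = j then f.Q.rho * p.rho else 0)
      + f.Q.B j * p.B l - (if l = j then ∑ k, f.Q.B k * p.B k else 0)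
      - f.T.D * (p.q * p.w * p.B l * p.B j - (if l = j then 2 * p.q else 0))
      + 2 * p.q * ((f.U l).u j - (f.Z l).x j) + (if l = j then 2 * f.vQ else 0)
      - p.q * (∑ i, p.w * p.B l * p.B i * (f.U i).u j - ∑ k, p.w * p.B k * p.B j * (f.Z l).x k
        - 2 * p.w ^ 2 * (∑ k, p.B k * f.vB k) * p.B l * p.B j
        + p.w * (p.B l * f.vB j + p.B j * f.vB l))
      - f.vQ * p.w * p.B l * p.B j = 0 := by
  have h1 := h.perp ⟨0, 0, 0, eJ l j, 0⟩ (by simp)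
  have h2 := h.perp ⟨0, 0, 0, 0, 0⟩ (by simp)
  simp only [FieldData.perp, linM, linU, linB, linX, GradData.mat, GradData.space, n, n0, c, FieldData.m,
    PointData.DB, PointData.dP, PointData.Drho, PointData.DP, PointData.Ds, PointData.Dq,
    PointData.dq, PointData.strain, PointData.div, Fin.sum_univ_three,
    hT.rho, hT.P, hT.s, hT.u, hT.B, (hZ _).rho, (hZ _).P, (hZ _).s,
    (hZ _).u, (hZ _).B, zero_mul, add_zero, hUP, hUs, hUB, hn, hc, mul_zero] at h1 h2
  fin_cases l <;> fin_cases j <;> simp [eJ, jr, Fin.sum_univ_three, -mul_eq_zero, -mul_eq_left₀, -mul_eq_right₀, -neg_eq_zero] at h1 h2 ⊢ <;>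
    linear_combination h1 - h2

end FieldData

end CGL

end

noncomputable section

namespace CGL

/-! ### The determining equations in an algebra with commuting derivations -/

/-- The coordinate directions: time, space and states. -/
inductive Dir : Type
  | t
  | x (k : Fin 3)
  | v (f : Field)

/-- An `ℝ`-algebra of functions of the coordinates, with the partial derivatives. -/
structure CoordAlg (A : Type*) [CommRing A] [Algebra ℝ A] where
  d : Dir → Derivation ℝ A A
  comm : ∀ i j a, d i (d j a) = d j (d i a)
  coord : Field → A
  d_t_coord : ∀ f, d .t (coord f) = 0
  d_x_coord : ∀ k f, d (.x k) (coord f) = 0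
  d_v_coord : ∀ f g, d (.v f) (coord g) = if f = g then 1 else 0
  two_cancel : ∀ a : A, 2 * a = 0 → a = 0

namespace CoordAlg

variable {A : Type*} [CommRing A] [Algebra ℝ A] (C : CoordAlg A)

abbrev rho : A := C.coord .density
abbrev u (k : Fin 3) : A := C.coord (.velocity k)
abbrev B (k : Fin 3) : A := C.coord (.magnetic k)
abbrev pl : A := C.coord .pPar
abbrev q : A := C.coord .pPerp

abbrev dt : Derivation ℝ A A := C.d .t
abbrev dx (k : Fin 3) : Derivation ℝ A A := C.d (.x k)
abbrev dv (f : Field) : Derivation ℝ A A := C.d (.v f)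
abbrev du (k : Fin 3) : Derivation ℝ A A := C.d (.v (.velocity k))
abbrev dB (k : Fin 3) : Derivation ℝ A A := C.d (.v (.magnetic k))

/-- The material derivative. -/
def D (F : A) : A := C.dt F + ∑ k, C.u k * C.dx k F

/-- `|B|²`. -/
def sq : A := ∑ k, C.B k * C.B k

/-- The components of a vector field: `T, Z` in space-time, `R, U, H, Q` along `ρ, u, B, p_⊥`,
and its values `P` and `S` on the total pressure and the tension. -/
structure Components (A : Type*) where
  (T R P S Q : A)
  (Z U H : Fin 3 → A)

/-- The derivative along the total pressure, at constant tension, density, `u` and `B`. -/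
def dP (F : A) : A := C.dv .pPar F + C.dv .pPerp F
/-- The derivative along the tension, at constant total pressure, density, `u` and `B`. -/
def dS (F : A) : A := C.sq * C.dv .pPar F
/-- The derivative along `B`, at constant total pressure, tension, density and `u`. -/
def dM (m s : A) (i : Fin 3) (F : A) : A :=
  C.dB i F - m * C.B i * C.dv .pPerp F + C.B i * (2 * s + m) * C.dv .pPar F

variable {C}

theorem comm_zero {i j : Dir} {a : A} (h : C.d j a = 0) : C.d j (C.d i a) = 0 := by
  rw [C.comm, h, map_zero]

variable (C) in
/-- The determining equations used to find the components along space-time and `B`. -/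
structure KinematicEqs (c : Components A) (s : A) : Prop where
  B_cancel : ∀ k a, C.B k * a = 0 → a = 0
  rho_cancel : ∀ a, C.rho * a = 0 → a = 0
  T_v : ∀ f, C.dv f c.T = 0
  Z_v : ∀ k f, C.dv f (c.Z k) = 0
  U_eq : ∀ k, c.U k = C.D (c.Z k) - C.u k * C.D c.T
  H_rho : ∀ k, C.dv .density (c.H k) = 0
  H_par : ∀ k, C.dv .pPar (c.H k) = 0
  H_perp : ∀ k, C.dv .pPerp (c.H k) = 0
  H_u : ∀ k i, C.du i (c.H k) - C.dx i c.T * C.B k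
    + (if k = i then ∑ l, C.dx l c.T * C.B l else 0) = 0
  H_B : ∀ k i, k ≠ i → C.dB i (c.H k) - (C.dx i (c.Z k) - C.u k * C.dx i c.T) = 0
  H_B_diag : ∀ k, C.dB k (c.H k) - (C.dx k (c.Z k) - C.u k * C.dx k c.T)
    - (C.dB 0 (c.H 0) - (C.dx 0 (c.Z 0) - C.u 0 * C.dx 0 c.T)) = 0
  faraday_g : ∀ i l, l ≠ i → C.dB i (c.H i) * C.B l - C.D c.T * C.B l - C.B l * C.du i (c.U i)
    + ∑ k, C.B k * (C.dx k (c.Z l) - C.u l * C.dx k c.T) - c.H l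
    + C.B i * (C.du i (c.U l) - (C.dx i (c.Z l) - C.u l * C.dx i c.T)) = 0
  momentum_y : ∀ i k, C.rho * C.du k (c.U i) + C.rho * (C.dx i (c.Z k) - C.u k * C.dx i c.T)
    + (if i = k then c.R - C.rho * C.D c.T - C.rho * C.dP c.P else 0)
    - C.rho * C.B i * C.B k * C.dP c.S = 0

/-- The conformal factor of the space components. -/
abbrev Components.psi (C : CoordAlg A) (c : Components A) : A := C.dx 0 (c.Z 0)

/-- The scaling rate of the magnetic field relative to the flow. -/
abbrev Components.lam (C : CoordAlg A) (c : Components A) : A :=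
  C.dB 0 (c.H 0) - C.dx 0 (c.Z 0)

namespace KinematicEqs

variable {c : Components A} {s : A} (h : KinematicEqs C c s)
include h

theorem du_U (i k : Fin 3) : C.du k (c.U i) = C.dx k (c.Z i) - C.u i * C.dx k c.T
    - (if i = k then C.D c.T else 0) := by
  have hT := h.T_v
  have hZ := h.Z_v
  rw [h.U_eq]
  have e1 : ∀ l a, C.dv l a = 0 → ∀ j, C.dv l (C.d j a) = 0 := fun l a ha j => comm_zero ha
  simp only [D, map_sub, map_add, Derivation.leibniz, smul_eq_mul, C.d_v_coord,
    e1 _ _ (hT _), e1 _ _ (hZ _ _), Fin.sum_univ_three]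
  fin_cases i <;> fin_cases k <;> simp <;> ring

/-- Inserting `U = D Z - u D T` into the off-diagonal coefficient of the acceleration leaves the
symmetrized gradient of `Z`, corrected by that of `T`. -/
theorem sym_eq (i k : Fin 3) (hik : i ≠ k) :
    C.dx k (c.Z i) + C.dx i (c.Z k) - C.u i * C.dx k c.T - C.u k * C.dx i c.T
      = C.B i * C.B k * C.dP c.S := by
  have h1 := h.momentum_y i k
  rw [h.du_U] at h1
  simp only [hik, if_false] at h1
  rw [← sub_eq_zero]
  apply h.rho_cancel
  linear_combination h1

/-- In `sym_eq` the left side does not involve `B`, while the right side has the factor `B_i B_k`.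
Eliminating `∂_P S` between the pairs `(0,1)` and `(1,2)` and differentiating along `B_2` shows that
the left side for `(0,1)` is zero. -/
theorem dP_S : C.dP c.S = 0 := by
  have h1 := h.sym_eq 0 1 (by decide)
  have h2 := h.sym_eq 1 2 (by decide)
  have e1 : ∀ l a, C.dv l a = 0 → ∀ j, C.dv l (C.d j a) = 0 := fun l a ha j => comm_zero ha
  have h3 := congrArg (C.dB 2) (show (C.dx 1 (c.Z 0) + C.dx 0 (c.Z 1) - C.u 0 * C.dx 1 c.T
    - C.u 1 * C.dx 0 c.T) * C.B 2 = (C.dx 2 (c.Z 1) + C.dx 1 (c.Z 2) - C.u 1 * C.dx 2 c.T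
    - C.u 2 * C.dx 1 c.T) * C.B 0 by rw [h1, h2]; ring)
  simp [Derivation.leibniz, C.d_v_coord, e1 _ _ (h.T_v _), e1 _ _ (h.Z_v _ _)] at h3
  rw [h3] at h1
  apply h.B_cancel 1
  apply h.B_cancel 0
  linear_combination -h1

/-- The right side of `sym_eq` is now zero and its left side is affine in `u`; the coefficient of
`u_i` is `-∂_k T`. -/
theorem dx_T (k : Fin 3) : C.dx k c.T = 0 := by
  have e1 : ∀ l a, C.dv l a = 0 → ∀ j, C.dv l (C.d j a) = 0 := fun l a ha j => comm_zero ha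
  have key : ∀ i k, i ≠ k → C.dx k c.T = 0 := fun i k hik => by
    have h1 := congrArg (C.du i) (h.sym_eq i k hik)
    rw [h.dP_S] at h1
    simpa [Derivation.leibniz, C.d_v_coord, e1 _ _ (h.T_v _), e1 _ _ (h.Z_v _ _), hik,
      hik.symm] using h1
  exact key (k + 1) k (by fin_cases k <;> decide)

theorem skew (i k : Fin 3) (hik : i ≠ k) : C.dx k (c.Z i) + C.dx i (c.Z k) = 0 := by
  have := h.sym_eq i k hik
  rw [h.dP_S, h.dx_T, h.dx_T] at this
  linear_combination this

theorem D_T : C.D c.T = C.dt c.T := by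
  simp [D, h.dx_T]

theorem du_U' (i k : Fin 3) :
    C.du k (c.U i) = C.dx k (c.Z i) - (if i = k then C.dt c.T else 0) := by
  rw [h.du_U, h.D_T, h.dx_T]; ring

/-- The isotropic terms of `momentum_y` do not depend on the index, so subtracting two diagonal
equations equates the diagonal entries of `∂Z`. Together with `skew`, this makes `Z` a conformal
field at each time. -/
theorem diag (k : Fin 3) : C.dx k (c.Z k) = c.psi C := by
  have key : ∀ k, C.rho * (2 * C.dx k (c.Z k)) + c.R - 2 * C.rho * C.dt c.T
      - C.rho * C.dP c.P = 0 := fun k => by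
    have h1 := h.momentum_y k k
    rw [h.dP_S, h.du_U', h.D_T, h.dx_T] at h1
    simp only [if_true] at h1
    linear_combination h1
  rw [← sub_eq_zero]
  apply C.two_cancel
  apply h.rho_cancel
  linear_combination key k - key 0

theorem rho_dP_P : C.rho * C.dP c.P = C.rho * (2 * c.psi C) + c.R - 2 * C.rho * C.dt c.T := by
  have h1 := h.momentum_y 0 0
  rw [h.dP_S, h.du_U', h.D_T, h.dx_T] at h1
  simp only [if_true] at h1
  linear_combination -h1

theorem H_u' (k i : Fin 3) : C.du i (c.H k) = 0 := by
  have := h.H_u k i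
  simpa [h.dx_T] using this

theorem H_B_eq (k i : Fin 3) :
    C.dB i (c.H k) = C.dx i (c.Z k) + (if k = i then c.lam C else 0) := by
  rcases eq_or_ne k i with rfl | hki
  · have := h.H_B_diag k
    simp only [h.dx_T] at this
    simp only [if_true]
    linear_combination this
  · have := h.H_B k i hki
    simp only [h.dx_T] at this
    simp only [hki, if_false]
    linear_combination this

/-- In `faraday_g` the terms proportional to `B_l` collapse to `λ B_l`, and the bracket multiplying
`B_i` vanishes. Thus `B` is carried as a vector by `Z`, up to the scaling `λ`. -/
theorem H_eq (l : Fin 3) : c.H l = ∑ k, C.B k * C.dx k (c.Z l) + c.lam C * C.B l := by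
  obtain ⟨i, hi⟩ : ∃ i, l ≠ i := ⟨l + 1, by fin_cases l <;> decide⟩
  have := h.faraday_g i l hi
  rw [h.H_B_eq, h.D_T, h.du_U', h.du_U'] at this
  simp only [h.dx_T, hi, if_false, if_true, mul_zero, sub_zero] at this
  linear_combination -this

theorem v_d {f : Field} {j : Dir} : C.dv f (C.d j c.T) = 0 := comm_zero (h.T_v f)
theorem v_dZ {f : Field} {j : Dir} {k : Fin 3} : C.dv f (C.d j (c.Z k)) = 0 :=
  comm_zero (h.Z_v k f)

theorem v_U {f : Field} (hf : ∀ i, C.dv f (C.u i) = 0) (i : Fin 3) : C.dv f (c.U i) = 0 := by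
  rw [h.U_eq]
  simp only [D, map_sub, map_add, map_sum, Derivation.leibniz, smul_eq_mul, h.v_d, h.v_dZ, hf]
  simp

/-- `H_B_eq` and the other derivatives of `H` are what they would be for constant `λ`. Comparison
with the derivative of `H_eq` leaves `B_0` times the derivative of `λ`. -/
theorem lam_v (f : Field) : C.dv f (c.lam C) = 0 := by
  have h1 := congrArg (C.dv f) (h.H_eq 0)
  apply h.B_cancel 0
  have h2 : C.dv f (c.H 0) = ∑ k, C.dv f (C.B k) * C.dx k (c.Z 0)
      + c.lam C * C.dv f (C.B 0) := by
    cases f with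
    | density => rw [h.H_rho]; simp [C.d_v_coord]
    | velocity i => rw [h.H_u']; simp [C.d_v_coord]
    | magnetic i => rw [h.H_B_eq]; fin_cases i <;> simp [C.d_v_coord]
    | pPar => rw [h.H_par]; simp [C.d_v_coord]
    | pPerp => rw [h.H_perp]; simp [C.d_v_coord]
  rw [h2] at h1
  simp only [map_add, Derivation.leibniz, smul_eq_mul, h.v_dZ, mul_zero, zero_add,
    Fin.sum_univ_three] at h1
  linear_combination -h1

end KinematicEqs

end CoordAlg

end CGL

end

noncomputable section

namespace CGL

/-! ### The components along the density, the pressures and the tension -/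

namespace CoordAlg

variable {A : Type*} [CommRing A] [Algebra ℝ A] {C : CoordAlg A}

variable (C) in
/-- The determining equations used to find the components along density and pressures. -/
structure DynamicEqs (c : Components A) (w m s : A) : Prop where
  m_const : ∀ j, C.d j m = 0
  m_cancel : ∀ a, m * a = 0 → a = 0
  w_eq : w * C.sq = 1
  s_eq : s = (C.pl - C.q) * w - m
  Q_eq : c.Q = c.P - m * ∑ k, C.B k * c.H k
  momentum_r : ∀ i k, (if i = k then C.dv .density c.P else 0)
    + C.B i * C.B k * C.dv .density c.S = 0
  momentum_s : ∀ i k, (if i = k then C.dS c.P else 0) - C.B i * C.B k * C.dP c.P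
    + ∑ l, (C.dx i (c.Z l) - C.u l * C.dx i c.T) * C.B l * C.B k + C.B i * C.B k * C.dS c.S
    - C.B i * ∑ l, C.B l * (C.dx l (c.Z k) - C.u k * C.dx l c.T)
    + c.H i * C.B k + C.B i * c.H k = 0
  momentum_b : ∀ i l j, l ≠ j → (if i = l then C.dM m s j c.P else 0)
    + (if i = j then c.S * C.B l + s * c.H l - s * C.B l * C.dP c.P
        - s * ∑ k, C.B k * (C.dx k (c.Z l) - C.u l * C.dx k c.T) else 0)
    + (C.dx i (c.Z j) - C.u j * C.dx i c.T) * s * C.B l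
    + C.B i * C.B l * C.dM m s j c.S + s * C.B l * C.dM m s j (c.H i) = 0
  perp_g : C.dS c.Q = 0 → ∀ l j, C.dP c.Q * ((if l = j then -(2 * C.q + m * C.sq) else 0)
        + (C.q + m * C.sq) * w * C.B l * C.B j)
      - (if l = j then C.dv .density c.Q * C.rho else 0)
      + C.dM m s j c.Q * C.B l - (if l = j then ∑ k, C.dM m s k c.Q * C.B k else 0)
      - C.D c.T * (C.q * w * C.B l * C.B j - (if l = j then 2 * C.q else 0))
      + 2 * C.q * (C.du j (c.U l) - C.dx j (c.Z l)) + (if l = j then 2 * c.Q else 0)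
      - C.q * (∑ i, w * C.B l * C.B i * C.du j (c.U i)
        - ∑ k, w * C.B k * C.B j * C.dx k (c.Z l)
        - 2 * w ^ 2 * (∑ k, C.B k * c.H k) * C.B l * C.B j
        + w * (C.B l * c.H j + C.B j * c.H l))
      - c.Q * w * C.B l * C.B j = 0

variable {c : Components A} {w m s : A}

/-- Implicit differentiation of `w |B|² = 1`: the ring has no division, so multiplication by `w`
replaces it. -/
theorem dv_w (hw : w * C.sq = 1) (f : Field) :
    C.dv f w = -(w ^ 2 * ∑ k, (C.B k * C.dv f (C.B k) + C.B k * C.dv f (C.B k))) := by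
  have h1 := congrArg (C.dv f) hw
  simp only [Derivation.leibniz, smul_eq_mul, sq, map_sum, Derivation.map_one_eq_zero] at h1
  have hw' := hw
  simp only [sq] at hw'
  linear_combination w * h1 - C.dv f w * hw'

namespace DynamicEqs

variable (h : KinematicEqs C c s) (e : DynamicEqs C c w m s)
include h e

omit h in
theorem sq_cancel (a : A) (ha : C.sq * a = 0) : a = 0 := by
  linear_combination w * ha - a * e.w_eq

omit h in
theorem w_cancel (a : A) (ha : w * a = 0) : a = 0 := by
  linear_combination C.sq * ha - a * e.w_eq

/-- An identity `a δ_ik + b B_i B_k = 0` forces `b = 0` off the diagonal, and then `a = 0` on it.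
The derivatives along the tension are separated in the same way in `dS_S` and `dS_P`. -/
theorem dens_S : C.dv .density c.S = 0 := by
  have h1 := e.momentum_r 0 1
  apply h.B_cancel 0
  apply h.B_cancel 1
  simp only [show (0 : Fin 3) ≠ 1 by decide, if_false] at h1
  linear_combination h1

theorem dens_P : C.dv .density c.P = 0 := by
  simpa [dens_S h e] using e.momentum_r 0 0

theorem dS_S : C.dS c.S = C.dP c.P - 2 * c.psi C - 2 * c.lam C := by
  have h1 := e.momentum_s 0 1
  rw [h.H_eq 0, h.H_eq 1] at h1
  have a1 := h.skew 0 1 (by decide)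
  have a2 := h.skew 0 2 (by decide)
  have d1 := h.diag 1
  simp only [show (0 : Fin 3) ≠ 1 by decide, if_false, h.dx_T, Fin.sum_univ_three] at h1
  rw [← sub_eq_zero]
  apply h.B_cancel 0
  apply h.B_cancel 1
  linear_combination h1 - C.B 1 * C.B 1 * a1 - C.B 1 * C.B 2 * a2

theorem dS_P : C.dS c.P = 0 := by
  have h1 := e.momentum_s 0 0
  rw [h.H_eq 0, dS_S h e] at h1
  have a1 := h.skew 0 1 (by decide)
  have a2 := h.skew 0 2 (by decide)
  simp only [if_true, h.dx_T, Fin.sum_univ_three] at h1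
  linear_combination h1 - C.B 0 * C.B 1 * a1 - C.B 0 * C.B 2 * a2

omit e in
theorem dM_H (i j : Fin 3) :
    C.dM m s j (c.H i) = C.dx j (c.Z i) + (if i = j then c.lam C else 0) := by
  rw [dM, h.H_B_eq, h.H_par, h.H_perp]; ring

/-- For three distinct indices all Kronecker terms of `momentum_b` drop out, and the two remaining
entries of `∂Z` cancel by skewness. -/
theorem dM_S (j : Fin 3) : C.dM m s j c.S = 0 := by
  have key : ∀ i l, l ≠ j → i ≠ j → i ≠ l → C.dM m s j c.S = 0 := fun i l hlj hij hil => by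
    have h1 := e.momentum_b i l j hlj
    rw [dM_H h] at h1
    simp only [hij, hil, if_false, h.dx_T] at h1
    apply h.B_cancel i
    apply h.B_cancel l
    linear_combination h1 - s * C.B l * h.skew i j hij
  fin_cases j
  · exact key 1 2 (by decide) (by decide) (by decide)
  · exact key 0 2 (by decide) (by decide) (by decide)
  · exact key 0 1 (by decide) (by decide) (by decide)

theorem dM_P (j : Fin 3) : C.dM m s j c.P = 0 := by
  obtain ⟨l, hl⟩ : ∃ l, l ≠ j := ⟨j + 1, by fin_cases j <;> decide⟩
  have h1 := e.momentum_b l l j hl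
  rw [dM_H h, dM_S h e] at h1
  simp only [hl, if_false, if_true, h.dx_T] at h1
  linear_combination h1 - s * C.B l * h.skew l j hl

/-- The choice `i = j ≠ l` in `momentum_b` retains the value of `S` itself, not only its
derivatives. -/
theorem S_eq : c.S = s * (C.dP c.P - 2 * c.psi C - 2 * c.lam C) := by
  have h1 := e.momentum_b 1 0 1 (by decide)
  rw [dM_H h, dM_S h e, h.H_eq 0] at h1
  simp only [show (1 : Fin 3) ≠ 0 by decide, if_false, if_true, h.dx_T, Fin.sum_univ_three] at h1
  rw [← sub_eq_zero]
  apply h.B_cancel 0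
  have d1 := h.diag 1
  linear_combination h1 - 2 * s * C.B 0 * d1

omit h in
theorem d_s_par : C.dv .pPar s = w := by
  rw [e.s_eq]
  simp [Derivation.leibniz, C.d_v_coord, dv_w e.w_eq, e.m_const]

omit h in
theorem d_s_perp : C.dv .pPerp s = -w := by
  rw [e.s_eq]
  simp [Derivation.leibniz, C.d_v_coord, dv_w e.w_eq, e.m_const]

omit h in
theorem d_s_density : C.dv .density s = 0 := by
  rw [e.s_eq]
  simp [Derivation.leibniz, C.d_v_coord, dv_w e.w_eq, e.m_const]

/-- The common growth rate of the pressures, up to a factor `2`. -/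
abbrev _root_.CGL.CoordAlg.Components.kap (C : CoordAlg A) (c : Components A) : A :=
  c.psi C + c.lam C

-- The skew part of `∂Z` does not contribute to the quadratic form in `B`, so `|B|²` scales at the
-- rate `2κ`, where `κ = ψ + λ`.
omit e in
theorem B_dot_H : ∑ k, C.B k * c.H k = c.kap C * C.sq := by
  have a1 := h.skew 0 1 (by decide)
  have a2 := h.skew 0 2 (by decide)
  have a3 := h.skew 1 2 (by decide)
  have d1 := h.diag 1
  have d2 := h.diag 2
  simp only [h.H_eq, sq, Fin.sum_univ_three]
  linear_combination C.B 0 * C.B 1 * a1 + C.B 0 * C.B 2 * a2 + C.B 1 * C.B 2 * a3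
    + C.B 1 ^ 2 * d1 + C.B 2 ^ 2 * d2

theorem Q_eq' : c.Q = c.P - m * (c.kap C * C.sq) := by
  rw [e.Q_eq, B_dot_H h]

omit e in
theorem kap_v (f : Field) : C.dv f (c.kap C) = 0 := by
  rw [map_add, h.v_dZ, h.lam_v, add_zero]

theorem d_magnetic_energy {f : Field} (hf : C.dv f C.sq = 0) :
    C.dv f (m * (c.kap C * C.sq)) = 0 := by
  rw [Derivation.leibniz, Derivation.leibniz, kap_v h, e.m_const, hf]; simp

theorem dens_Q : C.dv .density c.Q = 0 := by
  rw [Q_eq' h e, map_sub, dens_P h e,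
    d_magnetic_energy h e (by simp [sq, Derivation.leibniz, C.d_v_coord]), sub_zero]

theorem dP_Q : C.dP c.Q = C.dP c.P := by
  rw [Q_eq' h e, dP, dP, map_sub, map_sub,
    d_magnetic_energy h e (by simp [sq, Derivation.leibniz, C.d_v_coord]),
    d_magnetic_energy h e (by simp [sq, Derivation.leibniz, C.d_v_coord]), sub_zero, sub_zero]

theorem dS_Q : C.dS c.Q = 0 := by
  have h1 := dS_P h e
  rw [dS] at h1 ⊢
  rw [Q_eq' h e, map_sub,
    d_magnetic_energy h e (by simp [sq, Derivation.leibniz, C.d_v_coord]), sub_zero, h1]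

theorem dM_Q (j : Fin 3) : C.dM m s j c.Q = -(2 * m * c.kap C * C.B j) := by
  have h1 := dM_P h e j
  rw [dM] at h1 ⊢
  rw [Q_eq' h e]
  have h2 : C.dB j (m * (c.kap C * C.sq)) = 2 * m * c.kap C * C.B j := by
    have : C.dB j C.sq = 2 * C.B j := by
      fin_cases j <;> simp [sq, Fin.sum_univ_three, Derivation.leibniz, C.d_v_coord] <;> ring
    rw [Derivation.leibniz, Derivation.leibniz, kap_v h, e.m_const, this, smul_zero, smul_zero,
      add_zero, add_zero, smul_eq_mul, smul_eq_mul]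
    ring
  rw [map_sub, map_sub, map_sub, h2,
    d_magnetic_energy h e (by simp [sq, Derivation.leibniz, C.d_v_coord]),
    d_magnetic_energy h e (by simp [sq, Derivation.leibniz, C.d_v_coord])]
  linear_combination h1

/-- Off-diagonal and diagonal velocity gradients in the perpendicular pressure equation give two
formulas for `Q`, in which the magnetic terms have different weights. -/
theorem perp_offdiag : c.Q = C.dP c.P * (C.q + m * C.sq) - 2 * m * c.kap C * C.sq := by
  have h1 := e.perp_g (dS_Q h e) 0 1
  rw [dP_Q h e, dM_Q h e, dens_Q h e, B_dot_H h, h.D_T] at h1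
  simp only [h.du_U', show (0 : Fin 3) ≠ 1 by decide, show (2 : Fin 3) ≠ 1 by decide, if_false,
    if_true, Fin.sum_univ_three, h.H_eq] at h1
  have a1 := h.skew 0 1 (by decide)
  have a2 := h.skew 0 2 (by decide)
  have a3 := h.skew 1 2 (by decide)
  have d1 := h.diag 1
  have d2 := h.diag 2
  rw [← sub_eq_zero]
  apply w_cancel e
  apply h.B_cancel 0
  apply h.B_cancel 1
  have hw := e.w_eq
  linear_combination -h1 + (2 * m + 2 * C.q * w) * c.kap C * C.B 0 * C.B 1 * hw
    - C.q * w * C.B 0 * (C.B 0 * a1 + C.B 2 * a3 + 2 * C.B 1 * d1)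

theorem perp_diag : 2 * c.Q = C.dP c.P * (2 * C.q + m * C.sq) - 2 * m * c.kap C * C.sq := by
  have h1 := e.perp_g (dS_Q h e) 0 0
  simp only [dM_Q h e] at h1
  rw [dP_Q h e, dens_Q h e, B_dot_H h, h.D_T, perp_offdiag h e] at h1
  simp only [h.du_U', show (1 : Fin 3) ≠ 0 by decide, show (2 : Fin 3) ≠ 0 by decide, if_false,
    if_true, Fin.sum_univ_three, h.H_eq] at h1
  have a1 := h.skew 0 1 (by decide)
  have a2 := h.skew 0 2 (by decide)
  have hw := e.w_eq
  rw [perp_offdiag h e]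
  have hsq : C.sq = C.B 0 * C.B 0 + C.B 1 * C.B 1 + C.B 2 * C.B 2 := by
    simp [sq, Fin.sum_univ_three]
  linear_combination h1 - (2 * m + 2 * C.q * w) * c.kap C * C.B 0 * C.B 0 * hw
    + C.q * w * C.B 0 * (C.B 1 * a1 + C.B 2 * a2) + 2 * m * c.kap C * hsq

/-- The two formulas for `Q` differ by `m |B|² (∂_P P - 2κ)`. It is thus the magnetic pressure, with
`m = 1 / μ₀` cancellable, that ties the scaling of the pressures to that of `B`. -/
theorem dP_P : C.dP c.P = 2 * c.kap C := by
  rw [← sub_eq_zero]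
  apply sq_cancel e
  apply e.m_cancel
  linear_combination perp_diag h e - 2 * perp_offdiag h e

theorem S_eq_zero : c.S = 0 := by
  rw [S_eq h e, dP_P h e]; ring

theorem Q_formula : c.Q = 2 * c.kap C * C.q := by
  rw [perp_offdiag h e, dP_P h e]; ring

theorem P_formula : c.P = c.kap C * (2 * C.q + m * C.sq) := by
  linear_combination Q_formula h e - Q_eq' h e

theorem R_formula : c.R = C.rho * (2 * c.lam C + 2 * C.dt c.T) := by
  have := h.rho_dP_P
  rw [dP_P h e] at this
  linear_combination -this

end DynamicEqs

/-! ### Terms without jet variables: second derivatives of the space-time components -/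

variable (C) in
/-- The determining equations without derivatives along the states. -/
structure ConstEqs (c : Components A) (s : A) : Prop where
  mass : C.D c.R + C.rho * ∑ i, C.dx i (c.U i) = 0
  gauss : ∑ i, C.dx i (c.H i) = 0
  faraday : ∀ i, C.D (c.H i) - ∑ k, C.B k * C.dx k (c.U i) + C.B i * ∑ k, C.dx k (c.U k) = 0
  momentum : ∀ i, C.rho * C.D (c.U i) + C.dx i c.P
    + ∑ k, (C.B i * C.B k * C.dx k c.S + s * C.B k * C.dx k (c.H i)) = 0

namespace ConstEqs

variable (h : KinematicEqs C c s) (e : DynamicEqs C c w m s) (k : ConstEqs C c s)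
include h

theorem dx_H (i l : Fin 3) : C.dx l (c.H i)
    = ∑ j, C.B j * C.dx l (C.dx j (c.Z i)) + C.dx l (c.lam C) * C.B i := by
  rw [h.H_eq, map_add, map_sum]
  simp only [Derivation.leibniz, smul_eq_mul, C.d_x_coord]
  simp [mul_comm]

theorem dt_H (i : Fin 3) : C.dt (c.H i)
    = ∑ j, C.B j * C.dt (C.dx j (c.Z i)) + C.dt (c.lam C) * C.B i := by
  rw [h.H_eq, map_add, map_sum]
  simp only [Derivation.leibniz, smul_eq_mul, C.d_t_coord]
  simp [mul_comm]

theorem v_dd {f : Field} {i j : Dir} {l : Fin 3} : C.dv f (C.d i (C.d j (c.Z l))) = 0 :=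
  comm_zero h.v_dZ

theorem v_ddT {f : Field} {i j : Dir} : C.dv f (C.d i (C.d j c.T)) = 0 :=
  comm_zero h.v_d

theorem v_dlam {f : Field} {i : Dir} : C.dv f (C.d i (c.lam C)) = 0 := comm_zero (h.lam_v f)

include k

/-- The divergence of `H` is linear in `B`. The coefficient of `B_j` is `Σ_i ∂_i ∂_j Z_i + ∂_j λ`,
and every diagonal entry `∂_i Z_i` equals `ψ`. -/
theorem div_dx (j : Fin 3) : 3 * C.dx j (c.psi C) + C.dx j (c.lam C) = 0 := by
  have h1 := congrArg (C.dB j) k.gauss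
  have hd := fun i => congrArg (C.dx j) (h.diag i)
  have hc : ∀ i, C.dx i (C.dx j (c.Z i)) = C.dx j (c.psi C) := fun i => by rw [C.comm, hd]
  simp only [dx_H h, map_sum, map_add, Derivation.leibniz, v_dd h, v_dlam h, smul_eq_mul,
    C.d_v_coord] at h1
  have h2 := hc 0
  have h3 := hc 1
  have h4 := hc 2
  fin_cases j <;> simp [Fin.sum_univ_three, -map_sub] at h1 h2 h3 h4 ⊢ <;>
    linear_combination h1 - h2 - h3 - h4

omit k in
theorem U_formula (i : Fin 3) :
    c.U i = C.dt (c.Z i) + ∑ j, C.u j * C.dx j (c.Z i) - C.u i * C.dt c.T := by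
  rw [h.U_eq, h.D_T, D]

omit k in
theorem dt_U (i : Fin 3) : C.dt (c.U i) = C.dt (C.dt (c.Z i))
    + ∑ j, C.u j * C.dt (C.dx j (c.Z i)) - C.u i * C.dt (C.dt c.T) := by
  rw [U_formula h]
  simp only [map_sub, map_add, map_sum, Derivation.leibniz, smul_eq_mul, C.d_t_coord]
  simp

omit k in
theorem dx_U (i l : Fin 3) : C.dx l (c.U i) = C.dt (C.dx l (c.Z i))
    + ∑ j, C.u j * C.dx l (C.dx j (c.Z i)) := by
  have : C.dx l (C.dt c.T) = 0 := by rw [C.comm, h.dx_T, map_zero]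
  rw [U_formula h]
  simp only [map_sub, map_add, map_sum, Derivation.leibniz, smul_eq_mul, C.d_x_coord, this]
  rw [C.comm]
  simp

omit k in
theorem v_D_U {f : Field} (hf : ∀ i, C.dv f (C.u i) = 0) (i : Fin 3) :
    C.dv f (C.D (c.U i)) = 0 := by
  simp only [D, dt_U h, dx_U h, map_sub, map_add, map_sum, Derivation.leibniz, smul_eq_mul, v_dd h,
    v_ddT h, hf]
  simp

omit k in
theorem v_dx_H {f : Field} (hf : ∀ i, C.dv f (C.B i) = 0) (i l : Fin 3) :
    C.dv f (C.dx l (c.H i)) = 0 := by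
  simp only [dx_H h, map_add, map_sum, Derivation.leibniz, smul_eq_mul, v_dd h, v_dlam h, hf]
  simp

omit k in
include e in
theorem dx_P (i : Fin 3) : C.dx i c.P = C.dx i (c.kap C) * (2 * C.q + m * C.sq) := by
  have h2 : (2 : A) * C.q = C.q + C.q := two_mul _
  rw [DynamicEqs.P_formula h e, h2, sq]
  simp only [Derivation.leibniz, smul_eq_mul, map_add, map_sum, C.d_x_coord, e.m_const]
  simp
  ring

include e

/-- Once `S = 0`, the momentum equation is affine in `ρ` with leading coefficient `D U`. -/
theorem D_U (i : Fin 3) : C.D (c.U i) = 0 := by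
  have h1 := congrArg (C.dv .density) (k.momentum i)
  have hk : C.dv .density (C.dx i (c.kap C)) = 0 := comm_zero (DynamicEqs.kap_v h _)
  have h2 : (2 : A) * C.q = C.q + C.q := two_mul _
  rw [DynamicEqs.S_eq_zero h e, dx_P h e, h2, sq] at h1
  generalize C.dx i (c.kap C) = K at h1 hk
  simp only [map_add, map_sum, Derivation.leibniz, smul_eq_mul, hk, e.m_const, C.d_v_coord,
    DynamicEqs.d_s_density e, v_D_U h (f := .density) (fun i => by simp [C.d_v_coord]),
    v_dx_H h (f := .density) (fun i => by simp [C.d_v_coord]), map_zero] at h1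
  simpa using h1

/-- The rest of the momentum equation is differentiated along `p_∥` and `p_⊥`. The tension has
derivatives `w` and `-w` there, so adding the two results leaves only `2 ∂κ`. -/
theorem dx_kap (i : Fin 3) : C.dx i (c.kap C) = 0 := by
  have h1 := k.momentum i
  rw [D_U h e k, DynamicEqs.S_eq_zero h e, dx_P h e] at h1
  have hk : ∀ f, C.dv f (C.dx i (c.kap C)) = 0 := fun f => comm_zero (DynamicEqs.kap_v h _)
  have h2 : (2 : A) * C.q = C.q + C.q := two_mul _
  generalize C.dx i (c.kap C) = K at h1 hk ⊢
  have h3 := congrArg (C.dv .pPar) h1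
  have h4 := congrArg (C.dv .pPerp) h1
  rw [h2, sq] at h3 h4
  simp only [map_add, map_sum, Derivation.leibniz, smul_eq_mul, hk, e.m_const, C.d_v_coord,
    DynamicEqs.d_s_par e, DynamicEqs.d_s_perp e,
    v_dx_H h (f := .pPar) (fun i => by simp [C.d_v_coord]),
    v_dx_H h (f := .pPerp) (fun i => by simp [C.d_v_coord]), map_zero] at h3 h4
  simp [Fin.sum_univ_three] at h3 h4
  apply C.two_cancel
  linear_combination h3 + h4

theorem dx_psi (i : Fin 3) : C.dx i (c.psi C) = 0 := by
  have h1 := div_dx h k i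
  have h2 := dx_kap h e k i
  rw [map_add] at h2
  apply C.two_cancel
  linear_combination h1 - h2

theorem dx_lam (i : Fin 3) : C.dx i (c.lam C) = 0 := by
  have h1 := div_dx h k i
  rw [dx_psi h e k] at h1
  linear_combination h1

/-- `∂_j ∂_l Z_i` is symmetric in `j, l` and, `ψ` being constant in space, antisymmetric in `i, l`.
An alternating sum over three index orders makes it vanish, as for Killing fields of flat space. -/
theorem dx_dx_Z (i j l : Fin 3) : C.dx j (C.dx l (c.Z i)) = 0 := by
  have key : ∀ i j l, C.dx j (C.dx l (c.Z i)) + C.dx j (C.dx i (c.Z l)) = 0 := fun i j l => by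
    rcases eq_or_ne i l with rfl | hil
    · rw [h.diag, dx_psi h e k, add_zero]
    · rw [← map_add, h.skew i l hil, map_zero]
  apply C.two_cancel
  have h1 := key i j l
  have h2 := key l i j
  have h3 := key j l i
  rw [C.comm (.x i) (.x j)] at h2
  rw [C.comm (.x l) (.x i), C.comm (.x l) (.x j)] at h3
  linear_combination h1 - h2 + h3

/-- This is the coefficient of `u_j` in `D U_i = 0`; the factor `2` arises because `∂_t ∂_j Z_i`
enters through both `∂_t U` and `u·∇U`. -/
theorem two_dt_dx_Z (i j : Fin 3) :
    2 * C.dt (C.dx j (c.Z i)) = if i = j then C.dt (C.dt c.T) else 0 := by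
  have h1 := congrArg (C.du j) (D_U h e k i)
  simp only [D, dt_U h, dx_U h, dx_dx_Z h e k, map_sub, map_add, map_sum, Derivation.leibniz,
    smul_eq_mul, v_dd h, v_ddT h, C.d_v_coord, map_zero] at h1
  fin_cases i <;> fin_cases j <;> simp at h1 ⊢ <;> linear_combination h1

theorem dt_dt_Z (i : Fin 3) : C.dt (C.dt (c.Z i)) = 0 := by
  have h1 := D_U h e k i
  have h2 := two_dt_dx_Z h e k i
  simp only [D, dt_U h, dx_U h, dx_dx_Z h e k] at h1
  have h3 := h2 0
  have h4 := h2 1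
  have h5 := h2 2
  fin_cases i <;> simp [Fin.sum_univ_three] at h1 h3 h4 h5 ⊢ <;>
    linear_combination h1 - C.u 0 * h3 - C.u 1 * h4 - C.u 2 * h5

theorem dt_psi_eq : 2 * C.dt (c.psi C) = C.dt (C.dt c.T) := by
  simpa using two_dt_dx_Z h e k 0 0

theorem sum_dx_U : ∑ i, C.dx i (c.U i) = 3 * C.dt (c.psi C) := by
  simp only [dx_U h, dx_dx_Z h e k, h.diag]
  simp

theorem dt_lam_eq : C.dt (c.lam C) + 3 * C.dt (c.psi C) = 0 := by
  have h1 := k.faraday 0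
  rw [sum_dx_U h e k, D, dt_H h] at h1
  simp only [dx_H h, dx_U h, dx_dx_Z h e k, dx_lam h e k] at h1
  simp [Fin.sum_univ_three, -map_sub] at h1
  apply h.B_cancel 0
  linear_combination h1

theorem rate_eq : 2 * C.dt (c.lam C) + 2 * C.dt (C.dt c.T) + 3 * C.dt (c.psi C) = 0 := by
  have h1 := k.mass
  have hT : ∀ l, C.dx l (C.dt c.T) = 0 := fun l => by rw [C.comm, h.dx_T, map_zero]
  rw [DynamicEqs.R_formula h e, sum_dx_U h e k, D, two_mul, two_mul] at h1
  simp only [Derivation.leibniz, smul_eq_mul, map_add, C.d_t_coord, C.d_x_coord, dx_lam h e k,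
    hT] at h1
  simp [-map_sub] at h1
  apply h.rho_cancel
  linear_combination h1

/-- Momentum, Faraday and mass give three independent linear relations between `ψ_t`, `λ_t` and
`T_tt`. All three vanish, which excludes a projective symmetry quadratic in `t`. -/
theorem dt_psi : C.dt (c.psi C) = 0 := by
  linear_combination rate_eq h e k - 2 * dt_lam_eq h e k + 2 * dt_psi_eq h e k

theorem dt_lam : C.dt (c.lam C) = 0 := by
  linear_combination dt_lam_eq h e k - 3 * dt_psi h e k

theorem dt_dt_T : C.dt (C.dt c.T) = 0 := by
  linear_combination 2 * dt_psi h e k - dt_psi_eq h e k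

theorem dt_dx_Z (i j : Fin 3) : C.dt (C.dx j (c.Z i)) = 0 := by
  have h1 := two_dt_dx_Z h e k i j
  rw [dt_dt_T h e k, ite_self] at h1
  exact C.two_cancel _ h1

end ConstEqs

end CoordAlg

end CGL

end
open scoped ContDiff

noncomputable section

namespace CGL

/-! ### The determining equations of a point symmetry -/

section Bridge

variable (μ₀ : ℝ) (X : Space → Space) (z : Space) (j : JetData)

/-- The state at `z`. -/
def pointData : PointData where
  rho := density z
  q := pPerp z
  w := invSqB z
  s := tension μ₀ z
  m := 1 / μ₀
  γ := pPar z * invSqB z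
  δ := (pPerp z - 4 * pPar z) * invSqB z
  u := velocity z
  B := magnetic z

/-- The variation of the state with given variations of density, velocity, magnetic field, total
pressure and tension. -/
def frameVec (r : ℝ) (u B : Fin 3 → ℝ) (P s : ℝ) : State
  | .density => r
  | .velocity i => u i
  | .magnetic i => B i
  | .pPar => P + sqB z * s + (2 * tension μ₀ z + 1 / μ₀) * ∑ i, magnetic z i * B i
  | .pPerp => P - 1 / μ₀ * ∑ i, magnetic z i * B i

/-- The derivatives of `F` at `z` in the material frame. -/
def gradData (F : Space → ℝ) : GradData where
  D := fderiv ℝ F z ((1, velocity z), 0)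
  x k := fderiv ℝ F z (eX k, 0)
  rho := fderiv ℝ F z (0, frameVec μ₀ z 1 0 0 0 0)
  u i := fderiv ℝ F z (0, frameVec μ₀ z 0 (Pi.single i 1) 0 0 0)
  B i := fderiv ℝ F z (0, frameVec μ₀ z 0 0 (Pi.single i 1) 0 0)
  P := fderiv ℝ F z (0, frameVec μ₀ z 0 0 0 1 0)
  s := fderiv ℝ F z (0, frameVec μ₀ z 0 0 0 0 1)

/-- The values and derivatives at `z` of the components of `X`. -/
def fieldData : FieldData where
  vR := lieD X density z
  vS := lieD X (tension μ₀) z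
  vQ := lieD X pPerp z
  vU i := lieD X (fun z => velocity z i) z
  vB i := lieD X (fun z => magnetic z i) z
  T := gradData μ₀ z fun z => (X z).1.1
  R := gradData μ₀ z (lieD X density)
  P := gradData μ₀ z (lieD X (totalPressure μ₀))
  S := gradData μ₀ z (lieD X (tension μ₀))
  Q := gradData μ₀ z (lieD X pPerp)
  Z k := gradData μ₀ z fun z => (X z).1.2 k
  U i := gradData μ₀ z (lieD X fun z => velocity z i)
  B i := gradData μ₀ z (lieD X fun z => magnetic z i)

/-- The space derivatives of the state at a jet. -/
def jetX (k : Fin 3) : State :=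
  frameVec μ₀ z (j.r k) (j.g k) (j.b k) ((pointData μ₀ z).dP j k) (j.s k)

/-- The material derivative of the state at a jet. -/
def jetD : State :=
  frameVec μ₀ z ((pointData μ₀ z).Drho j) j.y ((pointData μ₀ z).DB j) ((pointData μ₀ z).DP j)
    ((pointData μ₀ z).Ds j)

/-- The jet as a linear map. -/
def jetMap : Jet :=
  ((ContinuousLinearMap.fst ℝ ℝ (Fin 3 → ℝ)).smulRight (jetD μ₀ z j))
    + ∑ k, (((ContinuousLinearMap.proj k).comp (ContinuousLinearMap.snd ℝ ℝ (Fin 3 → ℝ)))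
      - velocity z k • ContinuousLinearMap.fst ℝ ℝ (Fin 3 → ℝ)).smulRight (jetX μ₀ z j k)

variable {μ₀ X z j}

theorem frameVec_eq (r : ℝ) (u B : Fin 3 → ℝ) (P s : ℝ) :
    frameVec μ₀ z r u B P s = r • frameVec μ₀ z 1 0 0 0 0
      + P • frameVec μ₀ z 0 0 0 1 0 + s • frameVec μ₀ z 0 0 0 0 1
      + ∑ i, u i • frameVec μ₀ z 0 (Pi.single i 1) 0 0 0
      + ∑ i, B i • frameVec μ₀ z 0 0 (Pi.single i 1) 0 0 := by
  ext f
  cases f with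
  | density => simp [frameVec, Fin.sum_univ_three]
  | velocity i => fin_cases i <;> simp [frameVec, Fin.sum_univ_three]
  | magnetic i => fin_cases i <;> simp [frameVec, Fin.sum_univ_three]
  | pPar => simp [frameVec, Fin.sum_univ_three]; ring
  | pPerp => simp [frameVec, Fin.sum_univ_three]; ring

theorem fderiv_frameVec (F : Space → ℝ) (y : SpaceTime) (r : ℝ) (u B : Fin 3 → ℝ) (P s : ℝ) :
    fderiv ℝ F z (y, frameVec μ₀ z r u B P s) = fderiv ℝ F z (y, 0)
      + (gradData μ₀ z F).rho * r + (gradData μ₀ z F).P * P + (gradData μ₀ z F).s * s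
      + ∑ i, (gradData μ₀ z F).u i * u i + ∑ i, (gradData μ₀ z F).B i * B i := by
  have h : (y, frameVec μ₀ z r u B P s) = (y, (0 : State))
      + ContinuousLinearMap.inr ℝ SpaceTime State (frameVec μ₀ z r u B P s) := by simp
  rw [h, map_add, frameVec_eq]
  simp only [map_add, map_smul, map_sum, ContinuousLinearMap.inr_apply, smul_eq_mul, gradData,
    mul_comm]
  ring

theorem jetMap_eX (k : Fin 3) : jetMap μ₀ z j (eX k) = jetX μ₀ z j k := by
  simp only [jetMap, eX, add_apply, sum_apply, ContinuousLinearMap.smulRight_apply]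
  fin_cases k <;> simp

theorem jetMap_mat : jetMap μ₀ z j (1, velocity z) = jetD μ₀ z j := by
  simp [jetMap]

theorem totalDeriv_eX (F : Space → ℝ) (k : Fin 3) :
    totalDeriv F z (jetMap μ₀ z j) (eX k) = (gradData μ₀ z F).space (pointData μ₀ z) j k := by
  rw [totalDeriv_apply, jetMap_eX, jetX, fderiv_frameVec]
  rfl

theorem totalDeriv_mat (F : Space → ℝ) :
    totalDeriv F z (jetMap μ₀ z j) (1, velocity z) = (gradData μ₀ z F).mat (pointData μ₀ z) j := by
  rw [totalDeriv_apply, jetMap_mat, jetD, fderiv_frameVec]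
  rfl

theorem mk_eq (t : ℝ) (x : Fin 3 → ℝ) :
    ((t, x) : SpaceTime) = t • (1, velocity z) + ∑ k, (x k - velocity z k * t) • eX k := by
  ext k
  · simp [Fin.sum_univ_three]
  · fin_cases k <;> simp [Fin.sum_univ_three] <;> ring

theorem totalDeriv_decomp (F : Space → ℝ) (L : Jet) (e : SpaceTime) :
    totalDeriv F z L e = e.1 * totalDeriv F z L (1, velocity z)
      + ∑ k, (e.2 k - velocity z k * e.1) * totalDeriv F z L (eX k) := by
  conv_lhs => rw [show e = (e.1, e.2) from rfl, mk_eq (z := z) e.1 e.2]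
  simp only [map_add, map_smul, map_sum, smul_eq_mul]

theorem one_velocity_eq : ((1, velocity z) : SpaceTime) = eT + ∑ k, velocity z k • eX k := by
  ext k
  · simp [Fin.sum_univ_three]
  · fin_cases k <;> simp [Fin.sum_univ_three]

theorem matD_eq (F : Space → ℝ) (L : Jet) : matD F z L = totalDeriv F z L (1, velocity z) := by
  rw [matD, one_velocity_eq]
  simp only [map_add, map_smul, map_sum, smul_eq_mul]

theorem totalDeriv_fst (hX : DifferentiableAt ℝ X z) (L : Jet) (e : SpaceTime) :
    totalDeriv (fun z => (X z).1) z L e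
      = (totalDeriv (fun z => (X z).1.1) z L e, fun k => totalDeriv (fun z => (X z).1.2 k) z L e) := by
  have h1 := hX.hasFDerivAt.fst
  simp only [totalDeriv_apply]
  rw [h1.fderiv, h1.fst.fderiv]
  ext k
  · rfl
  · have h2 : HasFDerivAt (fun z => (X z).1.2 k) _ z := (hasFDerivAt_pi'.1 h1.snd) k
    simp only [h2.fderiv]
    rfl

/-- `D_e ξ` is expanded along the material direction and the space directions instead of `∂_t` and
`∂_x`, so that the only derivatives occurring are those of `ReducedEqs`. -/
theorem lin_decomp (hX : DifferentiableAt ℝ X z) (F : Space → ℝ) (L : Jet) (e : SpaceTime) :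
    lin X F z L e = totalDeriv (lieD X F) z L e
      - totalDeriv (fun z => (X z).1.1) z L e * matD F z L
      - ∑ k, (totalDeriv (fun z => (X z).1.2 k) z L e
        - velocity z k * totalDeriv (fun z => (X z).1.1) z L e) * totalDeriv F z L (eX k) := by
  rw [lin, totalDeriv_decomp F, totalDeriv_fst hX, matD_eq]
  ring

theorem linX_eq (hX : DifferentiableAt ℝ X z) (F : Space → ℝ) (k : Fin 3) :
    lin X F z (jetMap μ₀ z j) (eX k) = (fieldData μ₀ X z).linX (pointData μ₀ z) j
      (gradData μ₀ z (lieD X F)) (matD F z (jetMap μ₀ z j))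
      (fun l => totalDeriv F z (jetMap μ₀ z j) (eX l)) k := by
  rw [lin_decomp hX]
  simp only [totalDeriv_eX]
  rfl

theorem linM_eq (hX : DifferentiableAt ℝ X z) (F : Space → ℝ) :
    linMat X F z (jetMap μ₀ z j) = (fieldData μ₀ X z).linM (pointData μ₀ z) j
      (gradData μ₀ z (lieD X F)) (matD F z (jetMap μ₀ z j))
      (fun l => totalDeriv F z (jetMap μ₀ z j) (eX l)) := by
  have h1 : linMat X F z (jetMap μ₀ z j) = lin X F z (jetMap μ₀ z j) (1, velocity z)
      + ∑ k, lieD X (fun z => velocity z k) z * totalDeriv F z (jetMap μ₀ z j) (eX k) := by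
    rw [linMat, one_velocity_eq]
    simp only [lin, map_add, map_smul, smul_eq_mul, Fin.sum_univ_three]
    ring
  rw [h1, lin_decomp hX]
  simp only [totalDeriv_mat, FieldData.linM, FieldData.c, FieldData.n0]
  simp only [fieldData, pointData, Fin.sum_univ_three]
  ring

theorem fderiv_coord (f : Field) (w : Space) :
    fderiv ℝ (fun z : Space => z.2 f) z w = w.2 f := by
  have h : HasFDerivAt (fun z : Space => z.2 f) ((ContinuousLinearMap.proj (R := ℝ)
      (φ := fun _ : Field => ℝ) f).comp (ContinuousLinearMap.snd ℝ SpaceTime State)) z :=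
    ((ContinuousLinearMap.proj (R := ℝ) (φ := fun _ : Field => ℝ) f).comp
      (ContinuousLinearMap.snd ℝ SpaceTime State)).hasFDerivAt
  rw [h.fderiv]; rfl

theorem fderiv_density (w : Space) : fderiv ℝ density z w = w.2 .density :=
  fderiv_coord .density w

theorem fderiv_velocity (i : Fin 3) (w : Space) :
    fderiv ℝ (fun z => velocity z i) z w = w.2 (.velocity i) :=
  fderiv_coord (.velocity i) w

theorem fderiv_magnetic (i : Fin 3) (w : Space) :
    fderiv ℝ (fun z => magnetic z i) z w = w.2 (.magnetic i) :=
  fderiv_coord (.magnetic i) w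

theorem fderiv_pPar (w : Space) : fderiv ℝ pPar z w = w.2 .pPar := fderiv_coord .pPar w

theorem fderiv_pPerp (w : Space) : fderiv ℝ pPerp z w = w.2 .pPerp := fderiv_coord .pPerp w

theorem fderiv_sqB (w : Space) :
    fderiv ℝ sqB z w = 2 * ∑ i, magnetic z i * w.2 (.magnetic i) := by
  have hB := fun i => df (cd_magnetic (z := z) i)
  unfold sqB
  rw [fderiv_fun_sum fun i _ => (hB i).fun_mul (hB i), sum_apply, Finset.mul_sum]
  refine Finset.sum_congr rfl fun i _ => ?_
  rw [fderiv_fun_mul (hB i) (hB i)]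
  simp only [add_apply, smul_apply, fderiv_magnetic, smul_eq_mul]
  ring

theorem fderiv_invSqB (hz : z ∈ region) (w : Space) :
    fderiv ℝ invSqB z w = -(2 * invSqB z ^ 2 * ∑ i, magnetic z i * w.2 (.magnetic i)) := by
  have h1 : HasFDerivAt sqB _ z := (df contDiff_sqB.contDiffAt).hasFDerivAt
  have h : HasFDerivAt invSqB _ z := (hasDerivAt_inv (sqB_pos hz).ne').comp_hasFDerivAt z h1
  rw [h.fderiv]
  simp only [smul_apply, fderiv_sqB, smul_eq_mul, invSqB, inv_pow]
  ring

theorem fderiv_totalPressure (w : Space) : fderiv ℝ (totalPressure μ₀) z w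
    = w.2 .pPerp + 1 / μ₀ * ∑ i, magnetic z i * w.2 (.magnetic i) := by
  have hq : DifferentiableAt ℝ pPerp z := df contDiff_pPerp.contDiffAt
  have hs : DifferentiableAt ℝ sqB z := df contDiff_sqB.contDiffAt
  unfold totalPressure
  rw [fderiv_fun_add hq (hs.const_mul _), fderiv_const_mul hs]
  simp only [add_apply, smul_apply, fderiv_pPerp, fderiv_sqB, smul_eq_mul]
  ring

theorem fderiv_tension (hz : z ∈ region) (w : Space) : fderiv ℝ (tension μ₀) z w
    = (w.2 .pPar - w.2 .pPerp) * invSqB z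
      - 2 * (pPar z - pPerp z) * invSqB z ^ 2 * ∑ i, magnetic z i * w.2 (.magnetic i) := by
  have hl : DifferentiableAt ℝ pPar z := df contDiff_pPar.contDiffAt
  have hq : DifferentiableAt ℝ pPerp z := df contDiff_pPerp.contDiffAt
  have hw : DifferentiableAt ℝ invSqB z := df (contDiffAt_invSqB hz)
  unfold tension
  rw [fderiv_sub_const, fderiv_fun_mul (hl.fun_sub hq) hw, fderiv_fun_sub hl hq]
  simp only [add_apply, sub_apply, smul_apply, fderiv_pPerp, fderiv_pPar, fderiv_invSqB hz,
    smul_eq_mul]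
  ring

theorem invSqB_mul (hz : z ∈ region) : invSqB z * sqB z = 1 :=
  inv_mul_cancel₀ (sqB_pos hz).ne'

theorem fderiv_totalPressure_frameVec (y : SpaceTime) (r : ℝ) (u B : Fin 3 → ℝ) (P s : ℝ) :
    fderiv ℝ (totalPressure μ₀) z (y, frameVec μ₀ z r u B P s) = P := by
  rw [fderiv_totalPressure]
  simp only [frameVec]
  ring

theorem fderiv_tension_frameVec (hz : z ∈ region) (y : SpaceTime) (r : ℝ) (u B : Fin 3 → ℝ)
    (P s : ℝ) : fderiv ℝ (tension μ₀) z (y, frameVec μ₀ z r u B P s) = s := by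
  rw [fderiv_tension hz]
  simp only [frameVec, tension]
  linear_combination s * invSqB_mul hz

section Values

variable (hz : z ∈ region)

theorem matD_jet (F : Space → ℝ) : matD F z (jetMap μ₀ z j)
    = fderiv ℝ F z ((1, velocity z), jetD μ₀ z j) := by
  rw [matD_eq, totalDeriv_apply, jetMap_mat]

theorem totalDeriv_jet (F : Space → ℝ) (k : Fin 3) : totalDeriv F z (jetMap μ₀ z j) (eX k)
    = fderiv ℝ F z (eX k, jetX μ₀ z j k) := by
  rw [totalDeriv_apply, jetMap_eX]

theorem divU_jet : divU z (jetMap μ₀ z j) = PointData.div j := by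
  simp only [divU, totalDeriv_jet, fderiv_velocity]; rfl

theorem strain_jet : strain z (jetMap μ₀ z j) = (pointData μ₀ z).strain j := by
  simp only [strain, totalDeriv_jet, fderiv_velocity]; rfl

theorem matD_density : matD density z (jetMap μ₀ z j) = (pointData μ₀ z).Drho j := by
  rw [matD_jet, fderiv_density]; rfl

theorem matD_velocity (i : Fin 3) :
    matD (fun z => velocity z i) z (jetMap μ₀ z j) = j.y i := by
  rw [matD_jet, fderiv_velocity]; rfl

theorem matD_magnetic (i : Fin 3) :
    matD (fun z => magnetic z i) z (jetMap μ₀ z j) = (pointData μ₀ z).DB j i := by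
  rw [matD_jet, fderiv_magnetic]; rfl

theorem matD_totalPressure :
    matD (totalPressure μ₀) z (jetMap μ₀ z j) = (pointData μ₀ z).DP j := by
  rw [matD_jet, jetD, fderiv_totalPressure_frameVec]

include hz

theorem matD_tension : matD (tension μ₀) z (jetMap μ₀ z j) = (pointData μ₀ z).Ds j := by
  rw [matD_jet, jetD, fderiv_tension_frameVec hz]

/-- Contracting the induction equation with `B` gives half the material derivative of `|B|²`. -/
theorem sum_B_DB : ∑ i, magnetic z i * (pointData μ₀ z).DB j i
    = sqB z * ((pointData μ₀ z).strain j - PointData.div j) := by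
  have h := invSqB_mul hz
  simp only [PointData.DB, PointData.strain, PointData.div, pointData, sqB, Fin.sum_univ_three]
    at h ⊢
  generalize magnetic z = B at h ⊢
  linear_combination -(B 0 * B 0 * j.g 0 0 + B 0 * B 1 * j.g 0 1 + B 0 * B 2 * j.g 0 2
    + B 1 * B 0 * j.g 1 0 + B 1 * B 1 * j.g 1 1 + B 1 * B 2 * j.g 1 2
    + B 2 * B 0 * j.g 2 0 + B 2 * B 1 * j.g 2 1 + B 2 * B 2 * j.g 2 2) * h

theorem matD_pPerp : matD pPerp z (jetMap μ₀ z j) = (pointData μ₀ z).Dq j := by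
  rw [matD_jet, fderiv_pPerp]
  simp only [jetD, frameVec, sum_B_DB hz]
  have h : (pointData μ₀ z).m / (pointData μ₀ z).w = 1 / μ₀ * sqB z := by
    simp [pointData, invSqB]
  rw [PointData.DP, h, PointData.Dq]
  simp only [pointData]
  ring

/-- The constants `γ` and `δ` of `pointData` come from here: they make the material derivative of
the tension the one implied by the pressure and induction equations. -/
theorem matD_pPar : matD pPar z (jetMap μ₀ z j) + pPar z * divU z (jetMap μ₀ z j)
    + 2 * pPar z * strain z (jetMap μ₀ z j) = 0 := by
  rw [matD_jet, fderiv_pPar, divU_jet, strain_jet (μ₀ := μ₀)]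
  have h : (pointData μ₀ z).m / (pointData μ₀ z).w = 1 / μ₀ * sqB z := by
    simp [pointData, invSqB]
  simp only [jetD, frameVec, sum_B_DB hz]
  rw [PointData.DP, h, PointData.Ds]
  generalize (pointData μ₀ z).strain j = θ
  simp only [pointData, tension]
  linear_combination (pPar z * PointData.div j + (pPerp z - 4 * pPar z) * θ
    + 2 * (pPar z - pPerp z) * (θ - PointData.div j)) * invSqB_mul hz

/-- The entries of `jetD` and `dP` were defined by solving the equations, so only Gauss's law
restricts the parameters; otherwise they may be varied independently. -/
theorem reducedEqs_jetMap (hj : ∑ k, j.b k k = 0) : ReducedEqs μ₀ z (jetMap μ₀ z j) where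
  mass := by
    rw [matD_density, divU_jet]
    simp only [PointData.Drho, pointData]; ring
  momentum i := by
    simp only [matD_velocity, totalDeriv_jet, jetX, fderiv_totalPressure_frameVec,
      fderiv_tension_frameVec hz, fderiv_magnetic, PointData.dP]
    simp only [pointData, frameVec]
    ring
  faraday i := by
    rw [matD_magnetic, divU_jet]
    simp only [totalDeriv_jet, fderiv_velocity, PointData.DB]
    simp only [jetX, frameVec, pointData]
    ring
  gauss := by
    simp only [totalDeriv_jet, fderiv_magnetic]
    exact hj
  par := matD_pPar hz
  perp := by
    rw [matD_pPerp hz, divU_jet, strain_jet (μ₀ := μ₀), PointData.Dq]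
    simp only [pointData]
    ring

end Values

/-- The linearized equations are evaluated at the parametrized jets. The parallel pressure equation
is left out: the component along `p_∥` is recovered later from the invariance of the tension. -/
theorem determining_of_symmetry {U : Set Space} (hU : IsOpen U) (hUr : U ⊆ region)
    (hX : IsLiePointSymmetry (cglSystem μ₀) U X) (hz : z ∈ U) :
    (fieldData μ₀ X z).Determining (pointData μ₀ z) := by
  have hr := hUr hz
  have hd : DifferentiableAt ℝ X z := (hX.1.contDiffAt (hU.mem_nhds hz)).differentiableAt (by simp)
  have key : ∀ j : JetData, ∑ k, j.b k k = 0 → LinearizedEqs μ₀ X z (jetMap μ₀ z j) :=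
    fun j hj => by
      have h1 := reducedEqs_jetMap (μ₀ := μ₀) hr hj
      exact (fderiv_cglSystem_eq_zero_iff hr hd h1).1
        (hX.2 z hz _ ((cglSystem_eq_zero_iff hr).2 h1))
  have hU' : ∀ j i k, lin X (fun z => velocity z i) z (jetMap μ₀ z j) (eX k)
      = (fieldData μ₀ X z).linU (pointData μ₀ z) j i k := fun j i k => by
    rw [linX_eq hd, matD_velocity]
    simp only [totalDeriv_jet, fderiv_velocity]; rfl
  have hB' : ∀ j i k, lin X (fun z => magnetic z i) z (jetMap μ₀ z j) (eX k)
      = (fieldData μ₀ X z).linB (pointData μ₀ z) j i k := fun j i k => by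
    rw [linX_eq hd, matD_magnetic]
    simp only [totalDeriv_jet, fderiv_magnetic]; rfl
  refine ⟨fun j hj => ?_, fun j hj => ?_, fun j hj i => ?_, fun j hj i => ?_, fun j hj => ?_⟩
  · have h := (key j hj).mass
    rw [linM_eq hd, matD_density, divU_jet] at h
    simp only [linDivU, hU', totalDeriv_jet, fderiv_density] at h
    exact h
  · have h := (key j hj).gauss
    simp only [hB'] at h
    exact h
  · have h := (key j hj).faraday i
    rw [linM_eq hd, matD_magnetic, divU_jet] at h
    simp only [linDivU, hU', totalDeriv_jet, fderiv_magnetic, fderiv_velocity] at h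
    exact h
  · have h := (key j hj).momentum i
    rw [linM_eq hd, matD_velocity] at h
    simp only [hB', linX_eq hd, matD_tension hr, matD_totalPressure] at h
    simp only [totalDeriv_jet, fderiv_magnetic, fderiv_velocity, jetX,
      fderiv_totalPressure_frameVec, fderiv_tension_frameVec hr] at h
    exact h
  · have h := (key j hj).perp
    have hw : lieD X invSqB z = -(2 * invSqB z ^ 2 * ∑ l, magnetic z l
        * lieD X (fun z => magnetic z l) z) := by
      simp only [lieD, fderiv_invSqB hr, fderiv_magnetic]
    rw [linM_eq hd, matD_pPerp hr, divU_jet, strain_jet (μ₀ := μ₀)] at h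
    simp only [linDivU, linStrain, hU', totalDeriv_jet, fderiv_velocity, fderiv_pPerp,
      hw] at h
    rw [← h]
    rfl

end Bridge

end CGL

end
open scoped ContDiff

noncomputable section

namespace CGL

/-! ### The algebra of smooth functions on an open set -/

section SmoothAlgebra

variable {E : Type*} [NormedAddCommGroup E] [NormedSpace ℝ E]

/-- The smooth functions on a set, as an algebra of functions on the set. -/
def smoothOn (V : Set E) : Subalgebra ℝ (V → ℝ) where
  carrier := {f | ∃ F : E → ℝ, ContDiffOn ℝ ∞ F V ∧ ∀ z : V, F z = f z}
  mul_mem' := by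
    rintro a b ⟨F, hF, hFa⟩ ⟨G, hG, hGb⟩
    exact ⟨fun z => F z * G z, hF.mul hG, fun z => by simp [hFa, hGb]⟩
  add_mem' := by
    rintro a b ⟨F, hF, hFa⟩ ⟨G, hG, hGb⟩
    exact ⟨fun z => F z + G z, hF.add hG, fun z => by simp [hFa, hGb]⟩
  algebraMap_mem' r := ⟨fun _ => r, contDiffOn_const, fun _ => rfl⟩

namespace smoothOn

variable {V : Set E}

/-- The element of the algebra given by a function that is smooth on the set. -/
def of (F : E → ℝ) (hF : ContDiffOn ℝ ∞ F V) : smoothOn V := ⟨fun z => F z, F, hF, fun _ => rfl⟩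

/-- A function inducing the given element of the algebra. -/
def ext (f : smoothOn V) : E → ℝ := f.2.choose

theorem contDiffOn_ext (f : smoothOn V) : ContDiffOn ℝ ∞ (ext f) V := f.2.choose_spec.1

theorem ext_apply (f : smoothOn V) (z : V) : ext f z = f.1 z := f.2.choose_spec.2 z

theorem contDiffOn_fderiv_apply (hV : IsOpen V) {F : E → ℝ} (hF : ContDiffOn ℝ ∞ F V) (w : E) :
    ContDiffOn ℝ ∞ (fun z => fderiv ℝ F z w) V :=
  (hF.fderiv_of_isOpen hV (m := ∞) (by simp)).clm_apply contDiffOn_const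

theorem differentiableAt (hV : IsOpen V) {F : E → ℝ} (hF : ContDiffOn ℝ ∞ F V) (z : V) :
    DifferentiableAt ℝ F z :=
  (hF.contDiffAt (hV.mem_nhds z.2)).differentiableAt (by simp)

theorem fderiv_congr (hV : IsOpen V) {F G : E → ℝ} (h : ∀ z : V, F z = G z) (z : V) :
    fderiv ℝ F z = fderiv ℝ G z :=
  Filter.EventuallyEq.fderiv_eq (Set.EqOn.eventuallyEq_of_mem (s := V)
    (fun y hy => h ⟨y, hy⟩) (hV.mem_nhds z.2))

/-- The extension beyond `V` is an arbitrary choice, but on the open set `V` it does not affect the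
derivative. -/
theorem fderiv_ext (hV : IsOpen V) {f : smoothOn V} {F : E → ℝ} (h : ∀ z : V, F z = f.1 z)
    (z : V) : fderiv ℝ (ext f) z = fderiv ℝ F z :=
  fderiv_congr hV (fun z => by rw [ext_apply, h]) z

/-- The derivative in a fixed direction. -/
def deriv (hV : IsOpen V) (w : E) : Derivation ℝ (smoothOn V) (smoothOn V) :=
  Derivation.mk'
    { toFun f := of (fun z => fderiv ℝ (ext f) z w)
        (contDiffOn_fderiv_apply hV (contDiffOn_ext f) w)
      map_add' f g := by
        ext z
        have h := fderiv_ext hV (f := f + g) (F := fun z => ext f z + ext g z)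
          (fun z => by simp [ext_apply]) z
        simp only [of, h]
        rw [fderiv_fun_add (differentiableAt hV (contDiffOn_ext f) z)
          (differentiableAt hV (contDiffOn_ext g) z)]
        rfl
      map_smul' r f := by
        ext z
        have h := fderiv_ext hV (f := r • f) (F := fun z => r * ext f z)
          (fun z => by simp [ext_apply]) z
        simp only [of, h]
        rw [fderiv_const_mul (differentiableAt hV (contDiffOn_ext f) z)]
        rfl }
    fun f g => by
      ext z
      have h := fderiv_ext hV (f := f * g) (F := fun z => ext f z * ext g z)
        (fun z => by simp [ext_apply]) z
      simp only [of, LinearMap.coe_mk, AddHom.coe_mk, h]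
      rw [fderiv_fun_mul (differentiableAt hV (contDiffOn_ext f) z)
        (differentiableAt hV (contDiffOn_ext g) z)]
      simp [ext_apply]

theorem deriv_apply (hV : IsOpen V) (w : E) (f : smoothOn V) {F : E → ℝ}
    (h : ∀ z : V, F z = f.1 z) (z : V) : (deriv hV w f).1 z = fderiv ℝ F z w := by
  change fderiv ℝ (ext f) z w = _
  rw [fderiv_ext hV h]

theorem deriv_deriv_apply (hV : IsOpen V) (v w : E) (f : smoothOn V) {F : E → ℝ}
    (h : ∀ z : V, F z = f.1 z) (z : V) :
    (deriv hV v (deriv hV w f)).1 z = fderiv ℝ (fderiv ℝ F) z v w := by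
  have hF : ContDiffOn ℝ ∞ F V := (contDiffOn_ext f).congr fun y hy => by
    rw [h ⟨y, hy⟩, ← ext_apply]
  have h1 := (hF.fderiv_of_isOpen hV (m := ∞) (by simp)).contDiffAt (hV.mem_nhds z.2)
  rw [deriv_apply hV v _ (F := fun z => fderiv ℝ F z w)
    (fun z => (deriv_apply hV w f h z).symm)]
  rw [fderiv_clm_apply (h1.differentiableAt (by simp)) (differentiableAt_const _)]
  simp

theorem deriv_comm (hV : IsOpen V) (v w : E) (f : smoothOn V) :
    deriv hV v (deriv hV w f) = deriv hV w (deriv hV v f) := by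
  ext z
  have hf := (contDiffOn_ext f).contDiffAt (hV.mem_nhds z.2)
  rw [deriv_deriv_apply hV v w f (ext_apply f), deriv_deriv_apply hV w v f (ext_apply f)]
  exact (hf.isSymmSndFDerivAt (by
    rw [minSmoothness_of_isRCLikeNormedField]; exact WithTop.coe_le_coe.2 le_top)).eq v w

end smoothOn

end SmoothAlgebra

/-! ### Smooth functions as an algebra with commuting partial derivatives -/

section Coordinates

variable {V : Set Space}

/-- The vector of a coordinate direction. -/
def Dir.vec : Dir → Space
  | .t => ((1, 0), 0)
  | .x k => (eX k, 0)
  | .v f => (0, Pi.single f 1)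

theorem contDiff_coord {n : ℕ∞ω} (f : Field) : ContDiff ℝ n (fun z : Space => z.2 f) := by
  fun_prop

/-- The smooth functions on an open set of the space of all variables. -/
def coordAlg (hV : IsOpen V) : CoordAlg (smoothOn V) where
  d i := smoothOn.deriv hV i.vec
  comm i j f := smoothOn.deriv_comm hV _ _ f
  coord f := smoothOn.of (fun z => z.2 f) (contDiff_coord f).contDiffOn
  d_t_coord f := by
    ext z
    rw [smoothOn.deriv_apply hV _ _ (F := fun z => z.2 f) (fun _ => rfl), fderiv_coord]
    rfl
  d_x_coord k f := by
    ext z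
    rw [smoothOn.deriv_apply hV _ _ (F := fun z => z.2 f) (fun _ => rfl), fderiv_coord]
    rfl
  d_v_coord f g := by
    ext z
    rw [smoothOn.deriv_apply hV _ _ (F := fun z => z.2 g) (fun _ => rfl), fderiv_coord]
    by_cases h : f = g
    · subst h; simp [Dir.vec]
    · simp [Dir.vec, h, Ne.symm h]
  two_cancel a h := by
    ext z
    have h1 : (2 : ℝ) * a.1 z = 0 := congrFun (congrArg Subtype.val h) z
    change a.1 z = 0
    linarith

theorem coordAlg_d_apply (hV : IsOpen V) (i : Dir) (f : smoothOn V) {F : Space → ℝ}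
    (h : ∀ z : V, F z = f.1 z) (z : V) : ((coordAlg hV).d i f).1 z = fderiv ℝ F z i.vec :=
  smoothOn.deriv_apply hV _ f h z

end Coordinates

end CGL

end
open scoped ContDiff

noncomputable section

namespace CGL

/-! ### The determining equations on the generic set -/

namespace FieldData

variable {f : FieldData} {p : PointData}

/-- Faraday's equation makes `∂_ρ U` parallel to `B`. For such a vector the perpendicular pressure
equation reads `2 p_⊥ ∂_ρ U = p_⊥ ∂_ρ U`. -/
theorem U_rho (h : f.Determining p) (hp : p.Generic) (hw : p.w * ∑ i, p.B i * p.B i = 1)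
    (k : Fin 3) : (f.U k).rho = 0 := by
  have hT := horizontal_T h hp
  have hZ := horizontal_Z h hp
  have h1 := fun i => faraday_r h hT hZ (gauss_r h hT hZ) i k
  have h2 := perp_r h hT hZ k
  simp only [Fin.sum_univ_three] at h2 hw
  have h3 : p.q * (f.U k).rho = 0 := by
    linear_combination h2 - p.q * p.w * (p.B 0 * h1 0 + p.B 1 * h1 1 + p.B 2 * h1 2)
      + p.q * (f.U k).rho * hw
  exact (mul_eq_zero.1 h3).resolve_left hp.q

theorem vU_eq (h : f.Determining p) (hp : p.Generic) (hw : p.w * ∑ i, p.B i * p.B i = 1)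
    (k : Fin 3) : f.vU k - (f.Z k).D + p.u k * f.T.D = 0 := by
  have h1 := mass_r h (horizontal_T h hp) (horizontal_Z h hp) k
  rwa [U_rho h hp hw, mul_zero, add_zero] at h1

theorem B_P (h : f.Determining p) (hp : p.Generic) (k : Fin 3) : (f.B k).P = 0 :=
  (mul_eq_zero.1 (gauss_y h (horizontal_T h hp) (horizontal_Z h hp) k)).resolve_left hp.rho

theorem B_s (h : f.Determining p) (hp : p.Generic) (k : Fin 3) : (f.B k).s = 0 :=
  gauss_s h (horizontal_T h hp) (horizontal_Z h hp) (B_P h hp) k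

end FieldData

section

variable {μ₀ : ℝ} {X : Space → Space} {z : Space}

theorem eq_frameVec (hz : z ∈ region) (w : State) : ∃ r u B P s, w = frameVec μ₀ z r u B P s := by
  -- Total pressure and tension serve as coordinates in place of the pressures; the last two
  -- witnesses are the variations of these two functions along `w`.
  refine ⟨w .density, fun i => w (.velocity i), fun i => w (.magnetic i),
    w .pPerp + 1 / μ₀ * ∑ i, magnetic z i * w (.magnetic i),
    invSqB z * (w .pPar - (w .pPerp + 1 / μ₀ * ∑ i, magnetic z i * w (.magnetic i))
      - (2 * tension μ₀ z + 1 / μ₀) * ∑ i, magnetic z i * w (.magnetic i)), ?_⟩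
  ext f
  cases f with
  | pPar =>
    simp only [frameVec]
    linear_combination -(w .pPar - (w .pPerp + 1 / μ₀ * ∑ i, magnetic z i * w (.magnetic i))
      - (2 * tension μ₀ z + 1 / μ₀) * ∑ i, magnetic z i * w (.magnetic i)) * invSqB_mul hz
  | pPerp => simp only [frameVec]; ring
  | _ => rfl

theorem GradData.Horizontal.fderiv_eq_zero (hz : z ∈ region) {F : Space → ℝ}
    (h : (gradData μ₀ z F).Horizontal) (w : State) : fderiv ℝ F z (0, w) = 0 := by
  obtain ⟨r, u, B, P, s, rfl⟩ := eq_frameVec (μ₀ := μ₀) hz w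
  rw [fderiv_frameVec, h.rho, h.P, h.s]
  have : ((0, 0) : Space) = 0 := rfl
  simp [h.u, h.B, this]

variable (μ₀) in
/-- The points of the region where the components of the magnetic field, the perpendicular pressure
and the tension do not vanish. -/
def generic : Set Space :=
  {z | z ∈ region ∧ (∀ i, magnetic z i ≠ 0) ∧ pPerp z ≠ 0 ∧ tension μ₀ z ≠ 0}

theorem generic_pointData (hz : z ∈ generic μ₀) : (pointData μ₀ z).Generic where
  rho := hz.1.1.ne'
  q := hz.2.2.1
  s := hz.2.2.2
  B := hz.2.1

theorem _root_.CGL.IsLiePointSymmetry.mono {T V W : Type*} [NormedAddCommGroup T] [NormedSpace ℝ T]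
    [NormedAddCommGroup V] [NormedSpace ℝ V] [NormedAddCommGroup W] [NormedSpace ℝ W]
    {Δ : (T × V) × (T →L[ℝ] V) → W} {U U' : Set (T × V)} {X : T × V → T × V}
    (h : IsLiePointSymmetry Δ U X) (hU : U' ⊆ U) : IsLiePointSymmetry Δ U' X :=
  ⟨h.1.mono hU, fun z hz => h.2 z (hU hz)⟩

end

/-! ### Frame derivatives at a point as values of algebraic derivations -/

section Components

variable {V : Set Space} {μ₀ : ℝ} {X : Space → Space}

theorem contDiffOn_lieD (hV : IsOpen V) {F : Space → ℝ} (hX : ContDiffOn ℝ ∞ X V)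
    (hF : ContDiffOn ℝ ∞ F V) : ContDiffOn ℝ ∞ (lieD X F) V :=
  (hF.fderiv_of_isOpen hV (m := ∞) (by simp)).clm_apply hX

theorem contDiffOn_tension (hr : V ⊆ region) : ContDiffOn ℝ ∞ (tension μ₀) V :=
  fun _ hz => (contDiffAt_tension (hr hz)).contDiffWithinAt

theorem contDiffOn_invSqB (hr : V ⊆ region) : ContDiffOn ℝ ∞ invSqB V :=
  fun _ hz => (contDiffAt_invSqB (hr hz)).contDiffWithinAt

theorem contDiffOn_time (hX : ContDiffOn ℝ ∞ X V) : ContDiffOn ℝ ∞ (fun z => (X z).1.1) V :=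
  contDiff_fst.comp_contDiffOn (contDiff_fst.comp_contDiffOn hX)

theorem contDiffOn_space (hX : ContDiffOn ℝ ∞ X V) (k : Fin 3) :
    ContDiffOn ℝ ∞ (fun z => (X z).1.2 k) V :=
  (contDiff_apply ℝ ℝ k).comp_contDiffOn
    (contDiff_snd.comp_contDiffOn (contDiff_fst.comp_contDiffOn hX))

variable (μ₀) in
/-- The components of a smooth vector field on an open set. -/
def components (hV : IsOpen V) (hr : V ⊆ region) (hX : ContDiffOn ℝ ∞ X V) :
    CoordAlg.Components (smoothOn V) where
  T := smoothOn.of (fun z => (X z).1.1) (contDiffOn_time hX)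
  R := smoothOn.of (lieD X density) (contDiffOn_lieD hV hX contDiff_density.contDiffOn)
  P := smoothOn.of (lieD X (totalPressure μ₀)) (contDiffOn_lieD hV hX contDiff_totalPressure.contDiffOn)
  S := smoothOn.of (lieD X (tension μ₀)) (contDiffOn_lieD hV hX (contDiffOn_tension hr))
  Q := smoothOn.of (lieD X pPerp) (contDiffOn_lieD hV hX contDiff_pPerp.contDiffOn)
  Z k := smoothOn.of (fun z => (X z).1.2 k) (contDiffOn_space hX k)
  U i := smoothOn.of (lieD X fun z => velocity z i) (contDiffOn_lieD hV hX (contDiff_velocity i).contDiffOn)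
  H i := smoothOn.of (lieD X fun z => magnetic z i) (contDiffOn_lieD hV hX (contDiff_magnetic i).contDiffOn)

/-- Evaluation at a point. -/
def ev (z : V) : smoothOn V →ₐ[ℝ] ℝ := (Pi.evalAlgHom ℝ (fun _ : V => ℝ) z).comp (smoothOn V).val

theorem ev_of (z : V) {F : Space → ℝ} (hF : ContDiffOn ℝ ∞ F V) : ev z (smoothOn.of F hF) = F z := rfl

theorem ev_ext {a b : smoothOn V} (h : ∀ z, ev z a = ev z b) : a = b :=
  Subtype.ext (funext h)

variable (hV : IsOpen V) (hr : V ⊆ region) (z : V)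

theorem ev_d (i : Dir) {F : Space → ℝ} (hF : ContDiffOn ℝ ∞ F V) :
    ev z ((coordAlg hV).d i (smoothOn.of F hF)) = fderiv ℝ F z i.vec :=
  coordAlg_d_apply hV i _ (fun _ => rfl) z

theorem ev_rho : ev z (coordAlg hV).rho = density z := rfl
theorem ev_u (k : Fin 3) : ev z ((coordAlg hV).u k) = velocity z k := rfl
theorem ev_B (k : Fin 3) : ev z ((coordAlg hV).B k) = magnetic z k := rfl
theorem ev_pl : ev z (coordAlg hV).pl = pPar z := rfl
theorem ev_q : ev z (coordAlg hV).q = pPerp z := rfl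
theorem ev_sq : ev z (coordAlg hV).sq = sqB z := by
  simp only [CoordAlg.sq, map_sum, map_mul, ev_B]; rfl

variable (μ₀) in
theorem ev_density {F : Space → ℝ} (hF : ContDiffOn ℝ ∞ F V) :
    ev z ((coordAlg hV).dv .density (smoothOn.of F hF)) = (gradData μ₀ z F).rho := by
  rw [CoordAlg.dv, ev_d, gradData, Dir.vec]
  congr 2
  ext f; cases f <;> simp [frameVec]

variable (μ₀) in
theorem ev_velocity (k : Fin 3) {F : Space → ℝ} (hF : ContDiffOn ℝ ∞ F V) :
    ev z ((coordAlg hV).du k (smoothOn.of F hF)) = (gradData μ₀ z F).u k := by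
  rw [CoordAlg.du, ev_d, gradData, Dir.vec]
  congr 2
  ext f; cases f <;> simp [frameVec, Pi.single_apply]

variable (μ₀) in
theorem ev_dx (k : Fin 3) {F : Space → ℝ} (hF : ContDiffOn ℝ ∞ F V) :
    ev z ((coordAlg hV).dx k (smoothOn.of F hF)) = (gradData μ₀ z F).x k := by
  rw [CoordAlg.dx, ev_d]
  rfl

variable (μ₀) in
theorem ev_D {F : Space → ℝ} (hF : ContDiffOn ℝ ∞ F V) :
    ev z ((coordAlg hV).D (smoothOn.of F hF)) = (gradData μ₀ z F).D := by
  simp only [CoordAlg.D, map_add, map_sum, map_mul, ev_d, ev_u, gradData, Dir.vec]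
  have h : (((1, velocity z), 0) : Space) = ((1, 0), 0) + ∑ k, velocity z k • (eX k, 0) := by
    rw [one_velocity_eq]
    ext i
    · simp [eT, Prod.fst_sum]
    · simp [eT, Prod.fst_sum, Prod.snd_sum]
    · simp [Prod.snd_sum]
  rw [h, map_add, map_sum]
  simp only [map_smul, smul_eq_mul]

variable (μ₀) in
theorem ev_dP {F : Space → ℝ} (hF : ContDiffOn ℝ ∞ F V) :
    ev z ((coordAlg hV).dP (smoothOn.of F hF)) = (gradData μ₀ z F).P := by
  simp only [CoordAlg.dP, map_add, ev_d, gradData, Dir.vec]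
  have h : ((0, frameVec μ₀ z 0 0 0 1 0) : Space)
      = (0, Pi.single .pPar 1) + (0, Pi.single .pPerp 1) := by
    ext f
    · simp
    · simp
    · cases f <;> simp [frameVec]
  rw [h, map_add]

variable (μ₀) in
theorem ev_dS {F : Space → ℝ} (hF : ContDiffOn ℝ ∞ F V) :
    ev z ((coordAlg hV).dS (smoothOn.of F hF)) = (gradData μ₀ z F).s := by
  simp only [CoordAlg.dS, map_mul, ev_d, gradData, Dir.vec, ev_sq]
  have h : ((0, frameVec μ₀ z 0 0 0 0 1) : Space) = sqB z • (0, Pi.single .pPar 1) := by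
    ext f
    · simp
    · simp
    · cases f <;> simp [frameVec]
  rw [h, map_smul, smul_eq_mul]

theorem ev_dM {m s : smoothOn V} (hm : ev z m = 1 / μ₀) (hs : ev z s = tension μ₀ z) (i : Fin 3)
    {F : Space → ℝ} (hF : ContDiffOn ℝ ∞ F V) :
    ev z ((coordAlg hV).dM m s i (smoothOn.of F hF)) = (gradData μ₀ z F).B i := by
  simp only [CoordAlg.dM, map_add, map_sub, map_mul, ev_d, gradData, Dir.vec, ev_B, hm, hs]
  have h : ((0, frameVec μ₀ z 0 0 (Pi.single i 1) 0 0) : Space)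
      = (0, Pi.single (.magnetic i) 1) - (1 / μ₀ * magnetic z i) • (0, Pi.single .pPerp 1)
        + (magnetic z i * (2 * tension μ₀ z + 1 / μ₀)) • (0, Pi.single .pPar 1) := by
    ext f
    · simp
    · simp
    · cases f <;> simp [frameVec, Pi.single_apply]
      ring
  rw [h, map_add, map_sub, map_smul, map_smul, map_ofNat]
  simp

end Components

end CGL

end
open scoped ContDiff

noncomputable section

namespace CGL

theorem IsLiePointSymmetry.contDiffOn {T V W : Type*} [NormedAddCommGroup T] [NormedSpace ℝ T]
    [NormedAddCommGroup V] [NormedSpace ℝ V] [NormedAddCommGroup W] [NormedSpace ℝ W]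
    {Δ : (T × V) × (T →L[ℝ] V) → W} {U : Set (T × V)} {X : T × V → T × V}
    (h : IsLiePointSymmetry Δ U X) : ContDiffOn ℝ ∞ X U := h.1

/-! ### The determining equations as identities between smooth functions -/

section Equations

variable {V : Set Space} {μ₀ : ℝ} {X : Space → Space}
  (hV : IsOpen V) (hg : V ⊆ generic μ₀) (hX : IsLiePointSymmetry (cglSystem μ₀) V X)

theorem generic_subset_region : generic μ₀ ⊆ region := fun _ hz => hz.1

variable (μ₀) in
/-- The tension as a smooth function. -/
def tensionOn (hr : V ⊆ region) : smoothOn V := smoothOn.of (tension μ₀) (contDiffOn_tension hr)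

/-- `1 / |B|²` as a smooth function. -/
def invSqBOn (hr : V ⊆ region) : smoothOn V := smoothOn.of invSqB (contDiffOn_invSqB hr)

theorem fderiv_state_eq_zero {z : Space} (hz : z ∈ generic μ₀) {F : Space → ℝ}
    (h : (gradData μ₀ z F).Horizontal) (f : Field) :
    fderiv ℝ F z (Dir.v f).vec = 0 :=
  h.fderiv_eq_zero hz.1 _

omit hV in
include hg in
theorem pointData_w (z : V) :
    (pointData μ₀ z).w * ∑ i, (pointData μ₀ z).B i * (pointData μ₀ z).B i = 1 :=
  invSqB_mul (hg z.2).1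

include hV hg hX

theorem determining (z : V) : (fieldData μ₀ X z).Determining (pointData μ₀ z) :=
  determining_of_symmetry hV (hg.trans generic_subset_region) hX z.2

theorem kinematicEqs : CoordAlg.KinematicEqs (coordAlg hV)
    (components μ₀ hV (hg.trans generic_subset_region) hX.contDiffOn)
    (tensionOn μ₀ (hg.trans generic_subset_region)) := by
  have hr := hg.trans generic_subset_region
  have hd := determining hV hg hX
  have hp : ∀ z : V, (pointData μ₀ z).Generic := fun z => generic_pointData (hg z.2)
  have hT := fun z => FieldData.horizontal_T (hd z) (hp z)
  have hZ := fun z => FieldData.horizontal_Z (hd z) (hp z)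
  -- The frame derivative along the tension is `|B|² ∂_{p_∥}`, so `∂_{p_∥} H` vanishes. The frame
  -- derivative along the total pressure, `∂_{p_∥} + ∂_{p_⊥}`, then gives `∂_{p_⊥} H = 0`.
  have hpar : ∀ k, (coordAlg hV).dv .pPar ((components μ₀ hV hr hX.contDiffOn).H k) = 0 := fun k =>
    ev_ext fun z => by
      have h1 := FieldData.B_s (hd z) (hp z) k
      have h2 := ev_dS μ₀ hV z (contDiffOn_lieD hV hX.contDiffOn (contDiff_magnetic k).contDiffOn)
      rw [CoordAlg.dS, map_mul, ev_sq] at h2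
      rw [map_zero]
      exact (mul_eq_zero.1 (h2.trans h1)).resolve_left (sqB_pos (hr z.2)).ne'
  have hperp : ∀ k, (coordAlg hV).dv .pPerp ((components μ₀ hV hr hX.contDiffOn).H k) = 0 := fun k => by
    have h1 : (coordAlg hV).dP ((components μ₀ hV hr hX.contDiffOn).H k) = 0 := ev_ext fun z => by
      rw [map_zero]
      exact (ev_dP μ₀ hV z (contDiffOn_lieD hV hX.contDiffOn
        (contDiff_magnetic k).contDiffOn)).trans (FieldData.B_P (hd z) (hp z) k)
    rwa [CoordAlg.dP, hpar, zero_add] at h1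
  have hM : ∀ k i (z : V), ev z ((coordAlg hV).dB i ((components μ₀ hV hr hX.contDiffOn).H k))
      = ((fieldData μ₀ X z).B k).B i := fun k i z => by
    have h1 := ev_dM (μ₀ := μ₀) (z := z) hV (m := algebraMap ℝ _ (1 / μ₀)) (s := tensionOn μ₀ hr)
      rfl rfl i (contDiffOn_lieD hV hX.contDiffOn (contDiff_magnetic k).contDiffOn)
    change ev z ((coordAlg hV).dM _ _ i ((components μ₀ hV hr hX.contDiffOn).H k)) = _ at h1
    rwa [CoordAlg.dM, hpar, hperp, mul_zero, mul_zero, add_zero, sub_zero] at h1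
  constructor
  · intro k a ha
    refine ev_ext fun z => ?_
    have := congrArg (ev z) ha
    rw [map_mul, ev_B, map_zero] at this
    rw [map_zero]
    exact (mul_eq_zero.1 this).resolve_left ((hp z).B k)
  · intro a ha
    refine ev_ext fun z => ?_
    have := congrArg (ev z) ha
    rw [map_mul, ev_rho, map_zero] at this
    rw [map_zero]
    exact (mul_eq_zero.1 this).resolve_left (hp z).rho
  · exact fun f => ev_ext fun z => 
      (ev_d hV z _ (contDiffOn_time hX.contDiffOn)).trans (fderiv_state_eq_zero (hg z.2) (hT z) f)
  · exact fun k f => ev_ext fun z =>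
      (ev_d hV z _ (contDiffOn_space hX.contDiffOn k)).trans
        (fderiv_state_eq_zero (hg z.2) (hZ z k) f)
  · intro k
    refine ev_ext fun z => ?_
    have h1 := FieldData.vU_eq (hd z) (hp z) (pointData_w hg z) k
    rw [map_sub, map_mul, ev_u]
    dsimp only [components]
    rw [ev_D μ₀, ev_D μ₀, ev_of]
    simp only [fieldData, pointData] at h1
    linear_combination h1
  · exact fun k => ev_ext fun z => (ev_density μ₀ hV z
      (contDiffOn_lieD hV hX.contDiffOn (contDiff_magnetic k).contDiffOn)).trans
      (FieldData.gauss_r (hd z) (hT z) (hZ z) k)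
  · exact hpar
  · exact hperp
  · intro k i
    refine ev_ext fun z => ?_
    have h1 := FieldData.gauss_g (hd z) (hT z) (hZ z) (FieldData.B_P (hd z) (hp z)) k i
    dsimp only [components]
    simp only [map_add, map_sub, map_mul, map_sum, map_zero, apply_ite (ev z), ev_velocity μ₀,
      ev_dx μ₀, ev_B]
    exact h1
  · intro k i hki
    refine ev_ext fun z => ?_
    have h1 := FieldData.gauss_b (hd z) (hT z) (hZ z) (FieldData.B_P (hd z) (hp z)) k i hki
    rw [map_sub, hM]
    dsimp only [components]
    simp only [map_sub, map_mul, map_zero, ev_dx μ₀, ev_u]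
    exact h1
  · intro k
    refine ev_ext fun z => ?_
    have h1 := FieldData.gauss_b_diag (hd z) (hT z) (hZ z) (FieldData.B_P (hd z) (hp z)) k
    simp only [map_sub, map_mul, map_zero, hM]
    dsimp only [components]
    simp only [ev_dx μ₀, ev_u]
    exact h1
  · intro i l hl
    refine ev_ext fun z => ?_
    have h1 := FieldData.faraday_g (hd z) (hT z) (hZ z) (FieldData.B_P (hd z) (hp z))
      (FieldData.B_s (hd z) (hp z)) (FieldData.vU_eq (hd z) (hp z) (pointData_w hg z)) i l hl
    simp only [map_add, map_sub, map_mul, map_sum, map_zero, hM]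
    dsimp only [components]
    simp only [ev_velocity μ₀, ev_D μ₀, ev_dx μ₀, ev_B, ev_u, ev_of]
    exact h1
  · intro i k
    refine ev_ext fun z => ?_
    have h1 := FieldData.momentum_y (hd z) (hT z) (hZ z) (FieldData.gauss_r (hd z) (hT z) (hZ z))
      (FieldData.B_P (hd z) (hp z)) (FieldData.B_s (hd z) (hp z)) i k
    dsimp only [components]
    simp only [map_add, map_sub, map_mul, map_zero, apply_ite (ev z), ev_velocity μ₀, ev_D μ₀,
      ev_dx μ₀, ev_dP μ₀, ev_B, ev_u, ev_of, ev_rho]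
    exact h1

theorem dynamicEqs (hμ₀ : μ₀ ≠ 0) : CoordAlg.DynamicEqs (coordAlg hV)
    (components μ₀ hV (hg.trans generic_subset_region) hX.contDiffOn)
    (invSqBOn (hg.trans generic_subset_region)) (algebraMap ℝ _ (1 / μ₀))
    (tensionOn μ₀ (hg.trans generic_subset_region)) := by
  have hr := hg.trans generic_subset_region
  have hd := determining hV hg hX
  have hp : ∀ z : V, (pointData μ₀ z).Generic := fun z => generic_pointData (hg z.2)
  have hT := fun z => FieldData.horizontal_T (hd z) (hp z)
  have hZ := fun z => FieldData.horizontal_Z (hd z) (hp z)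
  have hBr := fun z => FieldData.gauss_r (hd z) (hT z) (hZ z)
  have hBP := fun z => FieldData.B_P (hd z) (hp z)
  have hBs := fun z => FieldData.B_s (hd z) (hp z)
  have hc := fun z => FieldData.vU_eq (hd z) (hp z) (pointData_w hg z)
  have h := kinematicEqs hV hg hX
  have hm : ∀ z : V, ev z (algebraMap ℝ _ (1 / μ₀)) = 1 / μ₀ := fun z => rfl
  have hs : ∀ z : V, ev z (tensionOn μ₀ hr) = tension μ₀ z := fun z => rfl
  have hw : ∀ z : V, ev z (invSqBOn hr) = invSqB z := fun z => rfl
  -- The kinematic equations already make `U` independent of the pressures and of `B`, and `T` of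
  -- space. The remaining coefficients are stated under these simplifications.
  have hUP : ∀ (z : V) k, ((fieldData μ₀ X z).U k).P = 0 := fun z k => by
    refine (ev_dP μ₀ hV z (contDiffOn_lieD hV hX.contDiffOn (contDiff_velocity k).contDiffOn)).symm.trans
      ?_
    change ev z ((coordAlg hV).dP ((components μ₀ hV hr hX.contDiffOn).U k)) = 0
    rw [CoordAlg.dP, h.v_U (by simp [CoordAlg.d_v_coord]), h.v_U (by simp [CoordAlg.d_v_coord]),
      add_zero, map_zero]
  have hUs : ∀ (z : V) k, ((fieldData μ₀ X z).U k).s = 0 := fun z k => by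
    refine (ev_dS μ₀ hV z (contDiffOn_lieD hV hX.contDiffOn (contDiff_velocity k).contDiffOn)).symm.trans
      ?_
    change ev z ((coordAlg hV).dS ((components μ₀ hV hr hX.contDiffOn).U k)) = 0
    rw [CoordAlg.dS, h.v_U (by simp [CoordAlg.d_v_coord]), mul_zero, map_zero]
  have hUB : ∀ (z : V) k l, ((fieldData μ₀ X z).U k).B l = 0 := fun z k l => by
    refine (ev_dM hV z (hm z) (hs z) l
      (contDiffOn_lieD hV hX.contDiffOn (contDiff_velocity k).contDiffOn)).symm.trans
      ?_
    change ev z ((coordAlg hV).dM _ _ l ((components μ₀ hV hr hX.contDiffOn).U k)) = 0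
    rw [CoordAlg.dM, h.v_U (by simp [CoordAlg.d_v_coord]), h.v_U (by simp [CoordAlg.d_v_coord]),
      h.v_U (by simp [CoordAlg.d_v_coord])]
    simp
  have hSP : ∀ z : V, (fieldData μ₀ X z).S.P = 0 := fun z =>
    (ev_dP μ₀ hV z (contDiffOn_lieD hV hX.contDiffOn (contDiffOn_tension hr))).symm.trans
      ((congrArg (ev z) h.dP_S).trans (map_zero _))
  have hn : ∀ (z : V) k, (fieldData μ₀ X z).T.x k = 0 := fun z k =>
    (ev_dx μ₀ hV z k (contDiffOn_time hX.contDiffOn)).symm.trans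
      ((congrArg (ev z) (h.dx_T k)).trans (map_zero _))
  constructor
  · exact fun j => Derivation.map_algebraMap _ _
  · intro a ha
    refine ev_ext fun z => ?_
    have := congrArg (ev z) ha
    rw [map_mul, hm, map_zero] at this
    rw [map_zero]
    exact (mul_eq_zero.1 this).resolve_left (one_div_ne_zero hμ₀)
  · refine ev_ext fun z => ?_
    rw [map_mul, hw, ev_sq, map_one]
    exact invSqB_mul (hr z.2)
  · refine ev_ext fun z => ?_
    rw [map_sub, map_mul, map_sub, hm, hw, ev_pl, ev_q]
    rfl
  · refine ev_ext fun z => ?_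
    rw [map_sub, map_mul, hm]
    simp only [map_sum, map_mul, ev_B]
    dsimp only [components]
    simp only [ev_of, lieD, fderiv_totalPressure, fderiv_pPerp, fderiv_magnetic]
    ring
  · intro i k
    refine ev_ext fun z => ?_
    have h1 := FieldData.momentum_r (hd z) (hT z) (hZ z) (hBr z) (hBP z) (hBs z) i k
    dsimp only [components]
    simp only [map_add, map_mul, map_zero, apply_ite (ev z), ev_density μ₀, ev_B]
    exact h1
  · intro i k
    refine ev_ext fun z => ?_
    have h1 := FieldData.momentum_s (hd z) (hT z) (hZ z) (hBr z) (hBP z) (hBs z) (hSP z) i k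
    dsimp only [components]
    simp only [map_add, map_sub, map_mul, map_sum, map_zero, apply_ite (ev z), ev_dS μ₀, ev_dP μ₀,
      ev_dx μ₀, ev_B, ev_u, ev_of]
    exact h1
  · intro i l j hlj
    refine ev_ext fun z => ?_
    have h1 := FieldData.momentum_b (hd z) (hT z) (hZ z) (hBr z) (hBP z) (hBs z) (hSP z) i l j hlj
    dsimp only [components]
    simp only [map_add, map_sub, map_mul, map_sum, map_zero, apply_ite (ev z),
      ev_dM hV z (hm z) (hs z), ev_dP μ₀, ev_dx μ₀, ev_B, ev_u, ev_of, hs]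
    exact h1
  -- `hQ` removes from this coefficient the material derivative of the tension, and with it `γ` and
  -- `δ`. It is a premise because it is itself a consequence of the other dynamic equations.
  · intro hQ l j
    refine ev_ext fun z => ?_
    have h1 := FieldData.perp_g (hd z) (hT z) (hZ z) (hUP z) (hUs z) (hUB z) (hn z) (hc z) l j
    have h2 : (fieldData μ₀ X z).Q.s = 0 :=
      (ev_dS μ₀ hV z (contDiffOn_lieD hV hX.contDiffOn contDiff_pPerp.contDiffOn)).symm.trans
        ((congrArg (ev z) hQ).trans (map_zero _))
    have h3 : (pointData μ₀ z).m / (pointData μ₀ z).w = 1 / μ₀ * sqB z := by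
      simp [pointData, invSqB]
    rw [h2, zero_mul, add_zero, h3] at h1
    dsimp only [components]
    simp only [map_add, map_sub, map_neg, map_mul, map_pow, map_sum, map_zero, map_ofNat,
      apply_ite (ev z), ev_dM hV z (hm z) (hs z), ev_dP μ₀, ev_dx μ₀, ev_B, ev_of, hm, hw,
      ev_sq, ev_q, ev_rho, ev_density μ₀, ev_D μ₀, ev_velocity μ₀]
    exact h1

theorem constEqs : CoordAlg.ConstEqs (coordAlg hV)
    (components μ₀ hV (hg.trans generic_subset_region) hX.contDiffOn)
    (tensionOn μ₀ (hg.trans generic_subset_region)) := by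
  have hr := hg.trans generic_subset_region
  have hd := determining hV hg hX
  have hp : ∀ z : V, (pointData μ₀ z).Generic := fun z => generic_pointData (hg z.2)
  have hT := fun z => FieldData.horizontal_T (hd z) (hp z)
  have hZ := fun z => FieldData.horizontal_Z (hd z) (hp z)
  have hs : ∀ z : V, ev z (tensionOn μ₀ hr) = tension μ₀ z := fun z => rfl
  constructor
  · refine ev_ext fun z => ?_
    have h1 := FieldData.mass_const (hd z) (hT z) (hZ z)
    dsimp only [components]
    simp only [map_add, map_mul, map_sum, map_zero, ev_D μ₀, ev_dx μ₀, ev_rho]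
    exact h1
  · refine ev_ext fun z => ?_
    have h1 := FieldData.gauss_const (hd z) (hT z) (hZ z)
    dsimp only [components]
    simp only [map_sum, map_zero, ev_dx μ₀]
    exact h1
  · intro i
    refine ev_ext fun z => ?_
    have h1 := FieldData.faraday_const (hd z) (hT z) (hZ z) i
    dsimp only [components]
    simp only [map_add, map_sub, map_mul, map_sum, map_zero, ev_D μ₀, ev_dx μ₀, ev_B]
    exact h1
  · intro i
    refine ev_ext fun z => ?_
    have h1 := FieldData.momentum_const (hd z) (hT z) (hZ z) i
    dsimp only [components]
    simp only [map_add, map_mul, map_sum, map_zero, ev_D μ₀, ev_dx μ₀, ev_B, ev_rho, hs]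
    exact h1

end Equations

end CGL

end
open scoped ContDiff

noncomputable section

namespace CGL

/-! ### Linear combinations of the generators -/

section Combinations

theorem sum_generator {M : Type*} [AddCommMonoid M] (f : Generator → M) : ∑ g, f g =
    f .P0 + (∑ i, f (.P i) + (∑ i, f (.K i) + (∑ i, f (.J i) + (f .S1 + (f .S2 + f .S3))))) := by
  have h : (Finset.univ : Finset Generator) =
    {.P0, .P 0, .P 1, .P 2, .K 0, .K 1, .K 2, .J 0, .J 1, .J 2, .S1, .S2, .S3} := by decide
  rw [h]
  simp [Fin.sum_univ_three, add_assoc]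

/-- The linear combination of the generators with the given coefficients. -/
def combo (c : Generator → ℝ) (z : Space) : Space := ∑ g, c g • generator g z

/-- The infinitesimal rotation in a linear combination of the generators. -/
def rot (c : Generator → ℝ) : Matrix (Fin 3) (Fin 3) ℝ :=
  !![0, -c (.J 2), c (.J 1); c (.J 2), 0, -c (.J 0); -c (.J 1), c (.J 0), 0]

theorem rot_skew (c : Generator → ℝ) (i j : Fin 3) : rot c i j = -rot c j i := by
  fin_cases i <;> fin_cases j <;> simp [rot]

variable (c : Generator → ℝ) (z : Space)

theorem combo_eq : combo c z = mkVec (c .P0 + (c .S1 + c .S2) * z.1.1)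
    (fun i => c (.P i) + c (.K i) * z.1.1 + ∑ j, rot c i j * z.1.2 j + c .S1 * z.1.2 i)
    ((2 * c .S2 + 2 * c .S3) * density z)
    (fun i => c (.K i) + ∑ j, rot c i j * velocity z j - c .S2 * velocity z i)
    (fun i => ∑ j, rot c i j * magnetic z j + c .S3 * magnetic z i)
    (2 * c .S3 * pPar z) (2 * c .S3 * pPerp z) := by
  rw [combo, sum_generator]
  refine Prod.ext (Prod.ext ?_ (funext fun i => ?_)) (funext fun f => ?_)
  · simp [generator, mkVec, Fin.sum_univ_three]; ring
  · fin_cases i <;>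
      simp [generator, mkVec, Fin.sum_univ_three, rot, crossProduct, Matrix.vecHead,
        Matrix.vecTail] <;> ring
  · cases f with
    | velocity i =>
      fin_cases i <;>
        simp [generator, mkVec, Fin.sum_univ_three, rot, crossProduct, Matrix.vecHead,
        Matrix.vecTail] <;> ring
    | magnetic i =>
      fin_cases i <;>
        simp [generator, mkVec, Fin.sum_univ_three, rot, crossProduct, Matrix.vecHead,
        Matrix.vecTail] <;> ring
    | _ => (simp [generator, mkVec, Fin.sum_univ_three]; ring)

theorem contDiff_combo {n : ℕ∞ω} : ContDiff ℝ n (combo c) := by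
  rw [show combo c = _ from funext (combo_eq c)]
  refine ContDiff.prodMk (ContDiff.prodMk ?_ (contDiff_pi.2 fun i => ?_))
    (contDiff_pi.2 fun f => ?_)
  · fun_prop
  · fun_prop
  · cases f <;> simp only [density, velocity, magnetic, pPar, pPerp] <;> fun_prop

end Combinations

/-! ### Points of the generic set are dense -/

section Density

/-- `F` has unit slope along `e`, so each of its zeros is a limit of non-zeros on the line in that
direction. -/
theorem dense_ne_zero {F : Space → ℝ} (e : Space) (h : ∀ z (ε : ℝ), F (z + ε • e) = F z + ε) :
    Dense {z | F z ≠ 0} := fun z => by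
  by_cases hz : F z = 0
  · have h1 : Filter.Tendsto (fun ε : ℝ => z + ε • e) (nhdsWithin 0 {0}ᶜ) (nhds z) := by
      have : Continuous fun ε : ℝ => z + ε • e := by fun_prop
      simpa using (this.tendsto 0).mono_left nhdsWithin_le_nhds
    refine mem_closure_of_tendsto h1 ?_
    filter_upwards [self_mem_nhdsWithin] with ε hε
    rw [h, hz, zero_add]
    exact hε
  · exact subset_closure hz

theorem isOpen_ne_zero {F : Space → ℝ} (h : Continuous F) : IsOpen {z | F z ≠ 0} :=
  isOpen_ne_fun h continuous_const

variable {μ₀ : ℝ} {U : Set Space}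

theorem subset_closure_generic (hU : IsOpen U) (hr : U ⊆ region) :
    U ⊆ closure (U ∩ generic μ₀) := by
  have hB : ∀ i, IsOpen {z | magnetic z i ≠ 0} := fun i =>
    isOpen_ne_zero (contDiff_magnetic (n := 0) i).continuous
  have hq : IsOpen {z | pPerp z ≠ 0} := isOpen_ne_zero (contDiff_pPerp (n := 0)).continuous
  have hB' : ∀ i, Dense {z | magnetic z i ≠ 0} := fun i =>
    dense_ne_zero (0, Pi.single (.magnetic i) 1) fun z ε => by simp [magnetic]
  have hq' : Dense {z | pPerp z ≠ 0} :=
    dense_ne_zero (0, Pi.single .pPerp 1) fun z ε => by simp [pPerp]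
  -- This function is `|B|²` times the tension on the region. It is polynomial on the whole space
  -- and has slope one in `p_∥`.
  have hs : Dense {z | pPar z - pPerp z - 1 / μ₀ * sqB z ≠ 0} :=
    dense_ne_zero (0, Pi.single .pPar 1) fun z ε => by
      simp [pPar, pPerp, sqB, magnetic]; ring
  have h := ((((hB' 0).inter_of_isOpen_left (hB' 1) (hB 0)).inter_of_isOpen_left (hB' 2)
    ((hB 0).inter (hB 1))).inter_of_isOpen_left hq' (((hB 0).inter (hB 1)).inter
      (hB 2))).inter_of_isOpen_left hs ((((hB 0).inter (hB 1)).inter (hB 2)).inter hq)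
  refine (h.open_subset_closure_inter hU).trans (closure_mono ?_)
  rintro z ⟨hz, ⟨⟨⟨h0, h1⟩, h2⟩, h3⟩, h4⟩
  refine ⟨hz, hr hz, fun i => by fin_cases i <;> assumption, h3, fun h5 => h4 ?_⟩
  rw [tension] at h5
  linear_combination sqB z * h5 - (pPar z - pPerp z) * invSqB_mul (hr hz)

theorem isOpen_inter_generic (hU : IsOpen U) : IsOpen (U ∩ generic μ₀) := by
  have hB : ∀ i, IsOpen {z | magnetic z i ≠ 0} := fun i =>
    isOpen_ne_zero (contDiff_magnetic (n := 0) i).continuous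
  have hq : IsOpen {z | pPerp z ≠ 0} := isOpen_ne_zero (contDiff_pPerp (n := 0)).continuous
  have hs : IsOpen {z | pPar z - pPerp z - 1 / μ₀ * sqB z ≠ 0} := isOpen_ne_zero
    ((((contDiff_pPar (n := 0)).sub contDiff_pPerp).sub
      (contDiff_const.mul contDiff_sqB)).continuous)
  have h : generic μ₀ = region ∩ ((((({z | magnetic z 0 ≠ 0} ∩ {z | magnetic z 1 ≠ 0}) ∩
      {z | magnetic z 2 ≠ 0}) ∩ {z | pPerp z ≠ 0}) ∩
      {z | pPar z - pPerp z - 1 / μ₀ * sqB z ≠ 0})) := by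
    ext z
    constructor
    · rintro ⟨hz, hb, hq, hs⟩
      refine ⟨hz, ⟨⟨⟨hb 0, hb 1⟩, hb 2⟩, hq⟩, fun h5 => hs ?_⟩
      rw [tension]
      linear_combination invSqB z * h5 + 1 / μ₀ * invSqB_mul hz
    · rintro ⟨hz, ⟨⟨⟨h0, h1⟩, h2⟩, h3⟩, h4⟩
      refine ⟨hz, fun i => by fin_cases i <;> assumption, h3, fun h5 => h4 ?_⟩
      rw [tension] at h5
      linear_combination sqB z * h5 - (pPar z - pPerp z) * invSqB_mul hz
  rw [h]
  exact hU.inter (isOpen_region.inter (((((hB 0).inter (hB 1)).inter (hB 2)).inter hq).inter hs))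

theorem eq_zero_of_dir {G : Type*} [NormedAddCommGroup G] [NormedSpace ℝ G] {ℓ : Space →L[ℝ] G}
    (h : ∀ i : Dir, ℓ i.vec = 0) : ℓ = 0 := by
  refine ContinuousLinearMap.ext fun z => ?_
  have : z = z.1.1 • Dir.t.vec + ∑ k, z.1.2 k • (Dir.x k).vec + ∑ f, z.2 f • (Dir.v f).vec := by
    refine Prod.ext (Prod.ext ?_ (funext fun i => ?_)) (funext fun f => ?_)
    · simp [Dir.vec, Prod.fst_sum]
    · simp [Dir.vec, Prod.fst_sum, Prod.snd_sum, Finset.sum_apply, Pi.single_apply]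
    · simp [Dir.vec, Prod.snd_sum, Finset.sum_apply, Pi.single_apply]
  rw [this]
  simp [map_add, map_sum, h]

/-- Removing the exceptional set may disconnect `U`, so constants on the pieces would not suffice.
The derivative of `F` is continuous on `U`, so it vanishes on `U` as soon as it does on the dense
subset. -/
theorem exists_const {V : Set Space} (hU : IsOpen U) (hc : IsPreconnected U) (hV : V ⊆ U)
    (hd : U ⊆ closure V) {F : Space → ℝ} (hF : ContDiffOn ℝ ∞ F U)
    (h : ∀ z ∈ V, ∀ i : Dir, fderiv ℝ F z i.vec = 0) : ∃ a, ∀ z ∈ U, F z = a := by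
  refine hU.exists_is_const_of_fderiv_eq_zero hc (hF.differentiableOn (by simp)) ?_
  exact Set.EqOn.of_subset_closure (s := V) (fun z hz => eq_zero_of_dir (h z hz))
    (hF.fderiv_of_isOpen hU (m := ∞) (by simp)).continuousOn continuousOn_const hV hd

end Density

end CGL

end
open scoped ContDiff

noncomputable section

namespace CGL

/-! ### Point symmetries are combinations of the generators -/

section Necessity

variable {μ₀ : ℝ} {U : Set Space} {X : Space → Space}

/-- This turns second-order identities in the algebra over the generic set into constants valid on
all of `U`. -/
theorem exists_const_fderiv (hU : IsOpen U) (hc : IsPreconnected U) (hr : U ⊆ region)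
    {F : Space → ℝ} (hF : ContDiffOn ℝ ∞ F U) (j : Dir)
    (h : ∀ i, (coordAlg (isOpen_inter_generic (μ₀ := μ₀) hU)).d i
      ((coordAlg (isOpen_inter_generic (μ₀ := μ₀) hU)).d j
        (smoothOn.of F (hF.mono Set.inter_subset_left))) = 0) :
    ∃ a, ∀ z ∈ U, fderiv ℝ F z j.vec = a := by
  refine exists_const (V := U ∩ generic μ₀) hU hc Set.inter_subset_left
    (subset_closure_generic hU hr) (smoothOn.contDiffOn_fderiv_apply hU hF _) fun z hz i => ?_
  rw [← coordAlg_d_apply (isOpen_inter_generic (μ₀ := μ₀) hU) i _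
    (fun z => (coordAlg_d_apply _ j (smoothOn.of F (hF.mono Set.inter_subset_left)) (F := F)
      (fun _ => rfl) z).symm) ⟨z, hz⟩, h]
  rfl

theorem fderiv_time (z w : Space) : fderiv ℝ (fun z : Space => z.1.1) z w = w.1.1 := by
  have h : HasFDerivAt (fun z : Space => z.1.1) ((ContinuousLinearMap.fst ℝ ℝ (Fin 3 → ℝ)).comp
      (ContinuousLinearMap.fst ℝ SpaceTime State)) z :=
    ((ContinuousLinearMap.fst ℝ ℝ (Fin 3 → ℝ)).comp
      (ContinuousLinearMap.fst ℝ SpaceTime State)).hasFDerivAt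
  rw [h.fderiv]; rfl

theorem fderiv_space (k : Fin 3) (z w : Space) :
    fderiv ℝ (fun z : Space => z.1.2 k) z w = w.1.2 k := by
  have h : HasFDerivAt (fun z : Space => z.1.2 k) (((ContinuousLinearMap.proj (R := ℝ)
      (φ := fun _ : Fin 3 => ℝ) k).comp (ContinuousLinearMap.snd ℝ ℝ (Fin 3 → ℝ))).comp
      (ContinuousLinearMap.fst ℝ SpaceTime State)) z :=
    (((ContinuousLinearMap.proj (R := ℝ) (φ := fun _ : Fin 3 => ℝ) k).comp
      (ContinuousLinearMap.snd ℝ ℝ (Fin 3 → ℝ))).comp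
      (ContinuousLinearMap.fst ℝ SpaceTime State)).hasFDerivAt
  rw [h.fderiv]; rfl

/-- A function with constant space-time derivatives that does not depend on the state. -/
theorem exists_affine (hU : IsOpen U) (hc : IsPreconnected U) (hr : U ⊆ region)
    {F : Space → ℝ} (hF : ContDiffOn ℝ ∞ F U) {a : ℝ} {b : Fin 3 → ℝ}
    (ht : ∀ z ∈ U, fderiv ℝ F z Dir.t.vec = a) (hx : ∀ i, ∀ z ∈ U, fderiv ℝ F z (Dir.x i).vec = b i)
    (hv : ∀ f, (coordAlg (isOpen_inter_generic (μ₀ := μ₀) hU)).dv f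
        (smoothOn.of F (hF.mono Set.inter_subset_left)) = 0) :
    ∃ e, ∀ z ∈ U, F z = e + a * z.1.1 + ∑ j, b j * z.1.2 j := by
  have h1 : ∀ z : Space, DifferentiableAt ℝ (fun z : Space => a * z.1.1) z := fun z => by fun_prop
  have h2 : ∀ (z : Space) j, DifferentiableAt ℝ (fun z : Space => b j * z.1.2 j) z :=
    fun z j => by fun_prop
  obtain ⟨e, he⟩ := exists_const (V := U ∩ generic μ₀) (F := fun z => F z - a * z.1.1
      - ∑ j, b j * z.1.2 j) hU hc Set.inter_subset_left
    (subset_closure_generic hU hr) (by fun_prop) fun z hz i => by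
      have hFz : DifferentiableAt ℝ F z :=
        (hF.contDiffAt (hU.mem_nhds hz.1)).differentiableAt (by simp)
      rw [fderiv_fun_sub (hFz.fun_sub (h1 z)) (DifferentiableAt.fun_sum fun j _ => h2 z j),
        fderiv_fun_sub hFz (h1 z), fderiv_fun_sum fun j _ => h2 z j,
        fderiv_const_mul (by fun_prop)]
      have h3 : ∀ j, fderiv ℝ (fun z : Space => b j * z.1.2 j) z i.vec = b j * i.vec.1.2 j :=
        fun j => by rw [fderiv_const_mul (by fun_prop), smul_apply, fderiv_space]; rfl
      simp only [sub_apply, smul_apply, sum_apply, fderiv_time, h3]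
      cases i with
      | t => simp [ht z hz.1]; simp [Dir.vec]
      | x k => simp [hx k z hz.1]; simp [Dir.vec, Pi.single_apply]
      | v f =>
        rw [← ev_d (isOpen_inter_generic (μ₀ := μ₀) hU) ⟨z, hz⟩ _ (hF.mono Set.inter_subset_left)]
        have := hv f
        rw [CoordAlg.dv] at this
        rw [this]
        simp [Dir.vec]
  exact ⟨e, fun z hz => by linear_combination he z hz⟩

/-- The first derivatives of `T` and `Z` and the rate `κ` are constants on `U`, and together with
the constant terms of `T` and `Z` they give the coefficients. The components along the states are
compared on the generic set only, and continuity does the rest. -/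
theorem exists_combo (hμ₀ : μ₀ ≠ 0) (hU : IsOpen U) (hc : IsConnected U) (hr : U ⊆ region)
    (hX : IsLiePointSymmetry (cglSystem μ₀) U X) : ∃ c, ∀ z ∈ U, X z = combo c z := by
  have hV := isOpen_inter_generic (μ₀ := μ₀) hU
  have hXV := hX.mono (Set.inter_subset_left (t := generic μ₀))
  have hg : U ∩ generic μ₀ ⊆ generic μ₀ := Set.inter_subset_right
  have h := kinematicEqs hV hg hXV
  have e := dynamicEqs hV hg hXV hμ₀
  have k := constEqs hV hg hXV
  have hcl := subset_closure_generic (μ₀ := μ₀) hU hr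
  obtain ⟨z₀, hz₀⟩ : (U ∩ generic μ₀).Nonempty := by
    rw [← closure_nonempty_iff]
    exact hc.nonempty.mono hcl
  obtain ⟨n, hn⟩ := exists_const_fderiv (μ₀ := μ₀) hU hc.isPreconnected hr
    (contDiffOn_time hX.contDiffOn) .t fun i => by
      cases i with
      | t => exact k.dt_dt_T h e
      | x j => exact (CoordAlg.comm _ _ _ _).trans ((congrArg _ (h.dx_T j)).trans (map_zero _))
      | v f => exact h.v_d
  have hK := fun l => exists_const_fderiv (μ₀ := μ₀) hU hc.isPreconnected hr
    (contDiffOn_space hX.contDiffOn l) .t fun i => by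
      cases i with
      | t => exact k.dt_dt_Z h e l
      | x j => exact (CoordAlg.comm _ _ _ _).trans (k.dt_dx_Z h e l j)
      | v f => exact h.v_dZ
  choose K hK using hK
  have hA := fun l m => exists_const_fderiv (μ₀ := μ₀) hU hc.isPreconnected hr
    (contDiffOn_space hX.contDiffOn l) (.x m) fun i => by
      cases i with
      | t => exact k.dt_dx_Z h e l m
      | x j => exact k.dx_dx_Z h e l j m
      | v f => exact h.v_dZ
  choose A hA using hA
  -- By `H_B_eq`, the rate `κ = ψ + λ` equals `∂_{B_0} H_0`, which is smooth on all of `U`.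
  obtain ⟨κ, hκ⟩ := exists_const_fderiv (μ₀ := μ₀) hU hc.isPreconnected hr
    (contDiffOn_lieD hU hX.contDiffOn (contDiff_magnetic 0).contDiffOn) (.v (.magnetic 0))
    fun i => by
      refine (congrArg _ (h.H_B_eq 0 0)).trans ?_
      rw [if_pos rfl, map_add]
      cases i with
      | t => exact (congrArg₂ _ (k.dt_dx_Z h e 0 0) (k.dt_lam h e)).trans (add_zero _)
      | x j => exact (congrArg₂ _ (k.dx_dx_Z h e 0 j 0) (k.dx_lam h e j)).trans (add_zero _)
      | v f => exact (congrArg₂ _ h.v_dZ (h.lam_v f)).trans (add_zero _)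
  have hTx : ∀ i, ∀ z ∈ U, fderiv ℝ (fun z => (X z).1.1) z (Dir.x i).vec = 0 := fun i => by
    -- The vanishing of `∂_i T` is known on the generic set; constancy on `U` spreads the value at
    -- `z₀`.
    obtain ⟨a, ha⟩ := exists_const_fderiv (μ₀ := μ₀) hU hc.isPreconnected hr
      (contDiffOn_time hX.contDiffOn) (.x i) fun j =>
        (congrArg _ (h.dx_T i)).trans (map_zero _)
    have h0 : fderiv ℝ (fun z => (X z).1.1) z₀ (Dir.x i).vec = 0 :=
      (ev_d hV ⟨z₀, hz₀⟩ (.x i) (contDiffOn_time hXV.contDiffOn)).symm.trans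
        ((congrArg _ (h.dx_T i)).trans (map_zero _))
    intro z hz
    rw [ha z hz, ← ha z₀ hz₀.1, h0]
  obtain ⟨a, ha⟩ := exists_affine (μ₀ := μ₀) hU hc.isPreconnected hr
    (contDiffOn_time hX.contDiffOn) hn hTx h.T_v
  have hZ := fun l => exists_affine (μ₀ := μ₀) hU hc.isPreconnected hr
    (contDiffOn_space hX.contDiffOn l) (hK l) (hA l) (h.Z_v l)
  choose b hb using hZ
  set C := coordAlg hV
  set x := components μ₀ hV (hg.trans generic_subset_region) hXV.contDiffOn
  have hA' : ∀ i j (z : ↥(U ∩ generic μ₀)), ev z (C.dx j (x.Z i)) = A i j := fun i j z =>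
    (ev_d hV z (.x j) (contDiffOn_space hXV.contDiffOn i)).trans (hA i j z z.2.1)
  have hK' : ∀ i (z : ↥(U ∩ generic μ₀)), ev z (C.dt (x.Z i)) = K i := fun i z =>
    (ev_d hV z .t (contDiffOn_space hXV.contDiffOn i)).trans (hK i z z.2.1)
  have hn' : ∀ z : ↥(U ∩ generic μ₀), ev z (C.dt x.T) = n := fun z =>
    (ev_d hV z .t (contDiffOn_time hXV.contDiffOn)).trans (hn z z.2.1)
  have hκ' : ∀ z : ↥(U ∩ generic μ₀), ev z (C.dB 0 (x.H 0)) = κ := fun z =>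
    (ev_d hV z _ (contDiffOn_lieD hV hXV.contDiffOn (contDiff_magnetic 0).contDiffOn)).trans
      (hκ z z.2.1)
  have hlam : ∀ z : ↥(U ∩ generic μ₀), ev z (x.lam C) = κ - A 0 0 := fun z => by
    rw [map_sub, hκ', hA']
  have hkap : ∀ z : ↥(U ∩ generic μ₀), ev z (x.kap C) = κ := fun z => by
    rw [map_add, hA', hlam]; ring
  have hskew : ∀ i j, i ≠ j → A i j + A j i = 0 := fun i j hij => by
    have := congrArg (ev ⟨z₀, hz₀⟩) (h.skew i j hij)
    rwa [map_add, hA', hA', map_zero] at this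
  have hdiag : ∀ i, A i i = A 0 0 := fun i => by
    have := congrArg (ev ⟨z₀, hz₀⟩) (h.diag i)
    rwa [hA', hA'] at this
  -- Space is scaled by `S1` alone and time by `S1 + S2`, hence `S1 = ψ` and `S2 = n - ψ`. The
  -- coefficients of `J` are the entries of the skew part of `A`.
  let c : Generator → ℝ
    | .P0 => a
    | .P i => b i
    | .K i => K i
    | .J i => ![A 2 1, A 0 2, A 1 0] i
    | .S1 => A 0 0
    | .S2 => n - A 0 0
    | .S3 => κ
  have hrot : ∀ i (v : Fin 3 → ℝ), ∑ j, A i j * v j = ∑ j, rot c i j * v j + A 0 0 * v i := by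
    have h01 := hskew 0 1 (by decide)
    have h02 := hskew 0 2 (by decide)
    have h12 := hskew 1 2 (by decide)
    have h1 := hdiag 1
    have h2 := hdiag 2
    intro i v
    fin_cases i <;> simp [Fin.sum_univ_three, rot, c]
    · linear_combination v 1 * h01
    · linear_combination v 2 * h12 + v 1 * h1
    · linear_combination v 0 * h02 + v 2 * h2
  refine ⟨c, Set.EqOn.of_subset_closure (s := U ∩ generic μ₀) ?_ hX.contDiffOn.continuousOn
    (contDiff_combo c (n := 0)).continuous.continuousOn Set.inter_subset_left hcl⟩
  intro z hz
  have hH : ∀ i, (X z).2 (.magnetic i) = ∑ j, A i j * magnetic z j + (κ - A 0 0) * magnetic z i :=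
    fun i => by
      have := congrArg (ev ⟨z, hz⟩) (h.H_eq i)
      simp only [map_add, map_sum, map_mul, hA', hlam] at this
      rw [← fderiv_magnetic (z := z)]
      refine this.trans ?_
      simp only [mul_comm _ (A i _)]
      rfl
  have hQ : (X z).2 .pPerp = 2 * κ * pPerp z := by
    have := congrArg (ev ⟨z, hz⟩) (CoordAlg.DynamicEqs.Q_formula h e)
    rw [map_mul, map_mul, hkap, map_ofNat] at this
    rw [← fderiv_pPerp (z := z)]
    exact this
  have hBH : ∑ i, magnetic z i * (X z).2 (.magnetic i) = κ * sqB z := by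
    have := congrArg (ev ⟨z, hz⟩) (CoordAlg.DynamicEqs.B_dot_H h)
    rw [map_mul, hkap, ev_sq, map_sum] at this
    rw [← this]
    refine Finset.sum_congr rfl fun i _ => ?_
    rw [map_mul, ← fderiv_magnetic (z := z)]
    rfl
  -- The tension is invariant, while `p_⊥` and `|B|²` both scale at the rate `2κ`; hence so does
  -- `p_∥`.
  have hS : (X z).2 .pPar = 2 * κ * pPar z := by
    have : fderiv ℝ (tension μ₀) z (X z) = 0 :=
      (congrArg (ev ⟨z, hz⟩) (CoordAlg.DynamicEqs.S_eq_zero h e)).trans (map_zero _)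
    rw [fderiv_tension (hr hz.1), hQ, hBH] at this
    have hw := invSqB_mul (hr hz.1)
    linear_combination sqB z * this
      + (2 * κ * pPerp z - (X z).2 .pPar + 2 * κ * (pPar z - pPerp z) * (1 + invSqB z * sqB z)) * hw
  rw [combo_eq]
  refine Prod.ext (Prod.ext ?_ (funext fun i => ?_)) (funext fun f => ?_)
  · simp only [ha z hz.1, mkVec, c]
    simp
  · simp only [hb i z hz.1, mkVec, hrot, c]
    ring
  · cases f with
    | density =>
      have := congrArg (ev ⟨z, hz⟩) (CoordAlg.DynamicEqs.R_formula h e)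
      simp only [map_mul, map_add, map_ofNat, hlam, hn'] at this
      rw [← fderiv_density (z := z)]
      refine this.trans ?_
      change density z * _ = (2 * (n - A 0 0) + 2 * κ) * density z
      ring
    | velocity i =>
      have := congrArg (ev ⟨z, hz⟩) (CoordAlg.ConstEqs.U_formula h i)
      simp only [map_sub, map_add, map_sum, map_mul, hA', hK', hn'] at this
      have h2 := hrot i (velocity z)
      rw [← fderiv_velocity (z := z)]
      refine this.trans ?_
      change K i + ∑ j, velocity z j * A i j - velocity z i * n
        = K i + ∑ j, rot c i j * velocity z j - (n - A 0 0) * velocity z i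
      simp only [mul_comm (velocity z _) (A _ _), h2]
      ring
    | magnetic i =>
      rw [hH, hrot]
      change _ = ∑ j, rot c i j * magnetic z j + κ * magnetic z i
      ring
    | pPar => exact hS
    | pPerp => exact hQ

end Necessity

end CGL

end
open scoped ContDiff

noncomputable section

namespace CGL

/-! ### Linear combinations of the generators are point symmetries -/

section Sufficiency

variable {μ₀ : ℝ} (c : Generator → ℝ) {z : Space} {L : Jet} {F : Space → ℝ}

theorem lieD_combo_density :
    lieD (combo c) density = fun z => (2 * c .S2 + 2 * c .S3) * density z := by
  ext z; rw [lieD, fderiv_density, combo_eq]; rfl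

theorem lieD_combo_velocity (i : Fin 3) : lieD (combo c) (fun z => velocity z i)
    = fun z => c (.K i) + ∑ j, rot c i j * velocity z j - c .S2 * velocity z i := by
  ext z; rw [lieD, fderiv_velocity, combo_eq]; rfl

theorem lieD_combo_magnetic (i : Fin 3) : lieD (combo c) (fun z => magnetic z i)
    = fun z => ∑ j, rot c i j * magnetic z j + c .S3 * magnetic z i := by
  ext z; rw [lieD, fderiv_magnetic, combo_eq]; rfl

theorem lieD_combo_pPar : lieD (combo c) pPar = fun z => 2 * c .S3 * pPar z := by
  ext z; rw [lieD, fderiv_pPar, combo_eq]; rfl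

theorem lieD_combo_pPerp : lieD (combo c) pPerp = fun z => 2 * c .S3 * pPerp z := by
  ext z; rw [lieD, fderiv_pPerp, combo_eq]; rfl

theorem sum_magnetic_combo (z : Space) :
    ∑ i, magnetic z i * (combo c z).2 (.magnetic i) = c .S3 * sqB z := by
  rw [combo_eq]
  simp [mkVec, sqB, Fin.sum_univ_three, rot]
  ring

theorem lieD_combo_totalPressure :
    lieD (combo c) (totalPressure μ₀) = fun z => 2 * c .S3 * totalPressure μ₀ z := by
  ext z
  rw [lieD, fderiv_totalPressure, sum_magnetic_combo, combo_eq]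
  simp only [mkVec, totalPressure]
  ring

theorem lieD_combo_invSqB (hz : z ∈ region) :
    lieD (combo c) invSqB z = -(2 * c .S3 * invSqB z) := by
  rw [lieD, fderiv_invSqB hz, sum_magnetic_combo]
  linear_combination -(2 * c .S3 * invSqB z) * invSqB_mul hz

theorem lieD_combo_tension (hz : z ∈ region) : lieD (combo c) (tension μ₀) z = 0 := by
  rw [lieD, fderiv_tension hz, sum_magnetic_combo, combo_eq]
  simp only [mkVec]
  linear_combination -(2 * c .S3 * (pPar z - pPerp z) * invSqB z) * invSqB_mul hz

theorem totalDeriv_combo_fst (e : SpaceTime) : totalDeriv (fun z => (combo c z).1) z L e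
    = ((c .S1 + c .S2) * e.1,
      fun i => c (.K i) * e.1 + ∑ j, rot c i j * e.2 j + c .S1 * e.2 i) := by
  rw [totalDeriv_fst ((contDiff_combo c (n := 1)).differentiable (by simp) z)]
  refine Prod.ext ?_ (funext fun i => ?_)
  · simp only [totalDeriv_apply, combo_eq, mkVec]
    rw [fderiv_const_add, fderiv_const_mul (by fun_prop), smul_apply, fderiv_time, smul_eq_mul]
  · simp only [totalDeriv_apply, combo_eq, mkVec]
    have h1 : ∀ j, DifferentiableAt ℝ (fun z : Space => rot c i j * z.1.2 j) z := fun j => by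
      fun_prop
    rw [fderiv_fun_add (by fun_prop) (by fun_prop), fderiv_fun_add (by fun_prop) (by fun_prop),
      fderiv_const_add, fderiv_const_mul (by fun_prop), fderiv_fun_sum fun j _ => h1 j,
      fderiv_const_mul (by fun_prop)]
    have h2 : ∀ j w, fderiv ℝ (fun z : Space => rot c i j * z.1.2 j) z w = rot c i j * w.1.2 j :=
      fun j w => by rw [fderiv_const_mul (by fun_prop), smul_apply, fderiv_space, smul_eq_mul]
    simp only [add_apply, smul_apply, sum_apply, fderiv_time, fderiv_space, h2, smul_eq_mul]

theorem lin_combo_eX (k : Fin 3) : lin (combo c) F z L (eX k)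
    = totalDeriv (lieD (combo c) F) z L (eX k)
      - (∑ i, rot c i k * totalDeriv F z L (eX i) + c .S1 * totalDeriv F z L (eX k)) := by
  have h : totalDeriv (fun z => (combo c z).1) z L (eX k)
      = ∑ i, rot c i k • eX i + c .S1 • eX k := by
    rw [totalDeriv_combo_fst]
    refine Prod.ext ?_ (funext fun i => ?_)
    · simp [Prod.fst_sum]
    · simp [Prod.snd_sum, Pi.single_apply]
  rw [lin, h, map_add, map_sum]
  simp only [map_smul, smul_eq_mul]

/-- Galilean covariance: the derivative of the space-time part along the material direction is a
multiple of that direction plus the variation of `u`. The latter cancels the variation of `u` in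
`u·∇`, so the material derivative is merely rescaled. -/
theorem linMat_combo : linMat (combo c) F z L
    = totalDeriv (lieD (combo c) F) z L (1, velocity z) - (c .S1 + c .S2) * matD F z L := by
  have h1 : linMat (combo c) F z L = lin (combo c) F z L (1, velocity z)
      + ∑ k, lieD (combo c) (fun z => velocity z k) z * totalDeriv F z L (eX k) := by
    rw [linMat, one_velocity_eq]
    simp only [lin, map_add, map_smul, smul_eq_mul, Fin.sum_univ_three]
    ring
  have h2 : totalDeriv (fun z => (combo c z).1) z L (1, velocity z)
      = (c .S1 + c .S2) • (1, velocity z)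
        + ∑ k, lieD (combo c) (fun z => velocity z k) z • eX k := by
    rw [totalDeriv_combo_fst]
    refine Prod.ext ?_ (funext fun i => ?_)
    · simp [Prod.fst_sum]
    · simp [Prod.snd_sum, Pi.single_apply, lieD_combo_velocity]
      ring
  rw [h1, lin, h2, map_add, map_sum, matD_eq]
  simp only [map_smul, smul_eq_mul]
  ring

theorem totalDeriv_const_mul (a : ℝ) (hF : DifferentiableAt ℝ F z) (e : SpaceTime) :
    totalDeriv (fun z => a * F z) z L e = a * totalDeriv F z L e := by
  simp only [totalDeriv_apply]; rw [fderiv_const_mul hF]; rfl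

theorem totalDeriv_combo_velocity (i : Fin 3) (e : SpaceTime) :
    totalDeriv (lieD (combo c) fun z => velocity z i) z L e
      = ∑ j, rot c i j * totalDeriv (fun z => velocity z j) z L e
        - c .S2 * totalDeriv (fun z => velocity z i) z L e := by
  have h := fun j => df (cd_velocity (z := z) j)
  rw [lieD_combo_velocity]
  simp only [totalDeriv_apply]
  have h1 : ∀ j, DifferentiableAt ℝ (fun z : Space => rot c i j * velocity z j) z :=
    fun j => (h j).const_mul _
  rw [fderiv_fun_sub ((DifferentiableAt.fun_sum fun j _ => h1 j).const_add _) ((h i).const_mul _),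
    fderiv_const_add, fderiv_fun_sum fun j _ => h1 j, fderiv_const_mul (h i)]
  simp only [sub_apply, sum_apply, smul_apply, smul_eq_mul, fun j => fderiv_const_mul (h j)]

theorem totalDeriv_combo_magnetic (i : Fin 3) (e : SpaceTime) :
    totalDeriv (lieD (combo c) fun z => magnetic z i) z L e
      = ∑ j, rot c i j * totalDeriv (fun z => magnetic z j) z L e
        + c .S3 * totalDeriv (fun z => magnetic z i) z L e := by
  have h := fun j => df (cd_magnetic (z := z) j)
  rw [lieD_combo_magnetic]
  simp only [totalDeriv_apply]
  have h1 : ∀ j, DifferentiableAt ℝ (fun z : Space => rot c i j * magnetic z j) z :=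
    fun j => (h j).const_mul _
  rw [fderiv_fun_add (DifferentiableAt.fun_sum fun j _ => h1 j) ((h i).const_mul _),
    fderiv_fun_sum fun j _ => h1 j, fderiv_const_mul (h i)]
  simp only [add_apply, sum_apply, smul_apply, smul_eq_mul, fun j => fderiv_const_mul (h j)]

theorem totalDeriv_combo_tension (hz : z ∈ region) (e : SpaceTime) :
    totalDeriv (lieD (combo c) (tension μ₀)) z L e = 0 := by
  rw [totalDeriv_congr (f₂ := fun _ => 0), totalDeriv_const]
  filter_upwards [isOpen_region.mem_nhds hz] with y hy using lieD_combo_tension c hy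

/-- Vector equations are mixed by the rotation matrix and every equation is multiplied by its
scaling weight; the coefficients of `linear_combination` are these weights and rotation entries. -/
theorem linearizedEqs_combo (hz : z ∈ region) (h : ReducedEqs μ₀ z L) :
    LinearizedEqs μ₀ (combo c) z L := by
  have hρ : DifferentiableAt ℝ density z := df cd_density
  have hl : DifferentiableAt ℝ pPar z := df contDiff_pPar.contDiffAt
  have hq : DifferentiableAt ℝ pPerp z := df contDiff_pPerp.contDiffAt
  have hP : DifferentiableAt ℝ (totalPressure μ₀) z := df contDiff_totalPressure.contDiffAt
  have r1 : rot c 1 0 = -rot c 0 1 := rot_skew c 1 0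
  have r2 : rot c 2 0 = -rot c 0 2 := rot_skew c 2 0
  have r3 : rot c 2 1 = -rot c 1 2 := rot_skew c 2 1
  have s0 : rot c 0 0 = 0 := by simp [rot]
  have s1 : rot c 1 1 = 0 := by simp [rot]
  have s2 : rot c 2 2 = 0 := by simp [rot]
  have hd : linDivU (combo c) z L = -((c .S1 + c .S2) * divU z L) := by
    simp only [linDivU, divU, lin_combo_eX, totalDeriv_combo_velocity, Fin.sum_univ_three]
    ring
  have hst : linStrain (combo c) z L = -((c .S1 + c .S2) * strain z L) := by
    simp only [linStrain, strain, lin_combo_eX, totalDeriv_combo_velocity, lieD_combo_invSqB c hz,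
      lieD_combo_magnetic, Fin.sum_univ_three]
    rw [r1, r2, r3, s0, s1, s2]
    ring
  have hmom := h.momentum
  have hfar := h.faraday
  have hg := h.gauss
  constructor
  · rw [linMat_combo, hd, lieD_combo_density, totalDeriv_const_mul _ hρ, ← matD_eq]
    linear_combination (2 * c .S2 + 2 * c .S3 - c .S1 - c .S2) * h.mass
  · intro i
    simp only [linMat_combo, lin_combo_eX, totalDeriv_combo_velocity, totalDeriv_combo_magnetic,
      totalDeriv_combo_tension c hz]
    simp only [lieD_combo_density, lieD_combo_magnetic, lieD_combo_tension c hz,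
      lieD_combo_totalPressure, totalDeriv_const_mul _ hP, ← matD_eq, Fin.sum_univ_three] at hmom ⊢
    have h0 := hmom 0
    have h1 := hmom 1
    have h2 := hmom 2
    fin_cases i <;> simp only [Fin.zero_eta, Fin.mk_one, Fin.reduceFinMk, r1, r2, r3, s0, s1, s2]
    · linear_combination (2 * c .S3 - c .S1) * h0 + rot c 0 1 * h1 + rot c 0 2 * h2
    · linear_combination (2 * c .S3 - c .S1) * h1 - rot c 0 1 * h0 + rot c 1 2 * h2
    · linear_combination (2 * c .S3 - c .S1) * h2 - rot c 0 2 * h0 - rot c 1 2 * h1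
  · intro i
    simp only [linMat_combo, lin_combo_eX, totalDeriv_combo_velocity, totalDeriv_combo_magnetic, hd]
    simp only [lieD_combo_magnetic, ← matD_eq, Fin.sum_univ_three] at hfar ⊢
    have h0 := hfar 0
    have h1 := hfar 1
    have h2 := hfar 2
    fin_cases i <;> simp only [Fin.zero_eta, Fin.mk_one, Fin.reduceFinMk, r1, r2, r3, s0, s1, s2]
    · linear_combination (c .S3 - c .S1 - c .S2) * h0 + rot c 0 1 * h1 + rot c 0 2 * h2
    · linear_combination (c .S3 - c .S1 - c .S2) * h1 - rot c 0 1 * h0 + rot c 1 2 * h2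
    · linear_combination (c .S3 - c .S1 - c .S2) * h2 - rot c 0 2 * h0 - rot c 1 2 * h1
  · simp only [lin_combo_eX, totalDeriv_combo_magnetic, Fin.sum_univ_three] at hg ⊢
    linear_combination (c .S3 - c .S1) * hg
  · rw [linMat_combo, hd, hst, lieD_combo_pPar, totalDeriv_const_mul _ hl, ← matD_eq]
    linear_combination (2 * c .S3 - c .S1 - c .S2) * h.par
  · rw [linMat_combo, hd, hst, lieD_combo_pPerp, totalDeriv_const_mul _ hq, ← matD_eq]
    linear_combination (2 * c .S3 - c .S1 - c .S2) * h.perp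

end Sufficiency

end CGL

end
open scoped ContDiff

noncomputable section

namespace CGL

/-! ### The point symmetries of the system without entropy -/

section Classification

variable {μ₀ : ℝ} {U : Set Space} {X : Space → Space} {c : Generator → ℝ}

theorem fderiv_cglSystem_combo {z : Space} (hz : z ∈ region) {L : Jet}
    (hL : cglSystem μ₀ (z, L) = 0) :
    fderiv ℝ (cglSystem μ₀) (z, L) (combo c z, prolongation (combo c) z L) = 0 := by
  have h := (cglSystem_eq_zero_iff hz).1 hL
  exact (fderiv_cglSystem_eq_zero_iff hz ((contDiff_combo c (n := 1)).differentiable (by simp) z)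
    h).2 (linearizedEqs_combo c hz h)

theorem isLiePointSymmetry_of_eqOn_combo (hU : IsOpen U) (hr : U ⊆ region)
    (h : Set.EqOn X (combo c) U) : IsLiePointSymmetry (cglSystem μ₀) U X := by
  refine ⟨(contDiff_combo c).contDiffOn.congr h, fun z hz L hL => ?_⟩
  have he := h.eventuallyEq_of_mem (hU.mem_nhds hz)
  have h1 : prolongation X z L = prolongation (combo c) z L := by
    have h2 : fderiv ℝ (fun z => (X z).1) z = fderiv ℝ (fun z => (combo c z).1) z :=
      Filter.EventuallyEq.fderiv_eq (he.fun_comp Prod.fst)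
    have h3 : fderiv ℝ (fun z => (X z).2) z = fderiv ℝ (fun z => (combo c z).2) z :=
      Filter.EventuallyEq.fderiv_eq (he.fun_comp Prod.snd)
    simp only [prolongation, totalDeriv, h2, h3]
  rw [h hz, h1]
  exact fderiv_cglSystem_combo (hr hz) hL

theorem sum_smul_domRestrict (c : Generator → ℝ) :
    ∑ g, c g • U.domRestrict (generator g) = U.domRestrict (combo c) := by
  ext1 z
  rw [Finset.sum_apply]
  rfl

theorem combo_add_smul (c : Generator → ℝ) (z w : Space) (ε : ℝ) :
    combo c (z + ε • w) = combo c z + ε • (combo c w - combo c 0) := by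
  simp only [combo_eq]
  refine Prod.ext (Prod.ext ?_ (funext fun i => ?_)) (funext fun f => ?_)
  · simp [mkVec]; ring
  · simp [mkVec, Fin.sum_univ_three]; ring
  · cases f <;> simp [mkVec, Fin.sum_univ_three, density, velocity, magnetic, pPar, pPerp] <;> ring

/-- A combination is an affine field, so vanishing on an open set propagates to the whole space. The
space-time and magnetic components alone already detect every coefficient, which is all that the
entropy argument provides. -/
theorem eq_zero_of_combo (hU : IsOpen U) (hne : U.Nonempty)
    (h : ∀ z ∈ U, (combo c z).1 = 0 ∧ ∀ i, (combo c z).2 (.magnetic i) = 0) : c = 0 := by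
  obtain ⟨z₀, hz₀⟩ := hne
  have h1 : ∀ w, (combo c w - combo c 0).1 = 0 ∧
      ∀ i, (combo c w - combo c 0).2 (.magnetic i) = 0 := fun w => by
    have h2 : ∀ᶠ ε : ℝ in nhdsWithin 0 {0}ᶜ, z₀ + ε • w ∈ U := by
      have h3 : Continuous fun ε : ℝ => z₀ + ε • w := by fun_prop
      refine nhdsWithin_le_nhds (h3.continuousAt.eventually_mem ?_)
      simpa using hU.mem_nhds hz₀
    obtain ⟨ε, hε, hε0⟩ := (h2.and self_mem_nhdsWithin).exists
    have h4 := h _ hε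
    have h5 := h _ hz₀
    rw [combo_add_smul, Prod.fst_add, Prod.smul_fst, h5.1, zero_add] at h4
    refine ⟨(smul_eq_zero.1 h4.1).resolve_left hε0, fun i => ?_⟩
    have h6 := h4.2 i
    rw [Prod.snd_add, Pi.add_apply, Prod.smul_snd, Pi.smul_apply, h5.2, zero_add] at h6
    exact (smul_eq_zero.1 h6).resolve_left hε0
  have h0 : (combo c 0).1 = 0 ∧ ∀ i, (combo c 0).2 (.magnetic i) = 0 := by
    have h2 := h1 z₀
    have h3 := h z₀ hz₀
    simpa [h3.1, h3.2] using h2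
  have h2 : ∀ w, (combo c w).1 = 0 ∧ ∀ i, (combo c w).2 (.magnetic i) = 0 := fun w => by
    have h3 := h1 w
    simpa [h0.1, h0.2] using h3
  simp only [combo_eq, mkVec, Prod.mk_eq_zero, funext_iff, Pi.zero_apply] at h2
  -- The origin shows the translations, a unit time the boosts and `S1 + S2`, a unit space vector
  -- the rotations and `S1`, and a unit magnetic field `S3`.
  have a0 := (h2 0).1
  have a1 := (h2 ((1, 0), 0)).1
  have a2 := fun j => (h2 ((0, Pi.single j 1), 0)).1.2
  have a3 := (h2 (0, Pi.single (.magnetic 0) 1)).2 0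
  simp at a0
  simp [a0.1, a0.2] at a1
  simp [a0.2] at a2
  have b0 := a2 0 0
  have b1 := a2 0 1
  have b2 := a2 0 2
  have b3 := a2 1 2
  simp [Fin.sum_univ_three, rot] at b0 b1 b2 b3
  simp [magnetic, Fin.sum_univ_three, rot] at a3
  funext g
  change c g = 0
  cases g with
  | P0 => exact a0.1
  | P i => exact a0.2 i
  | K i => exact a1.2 i
  | J i => fin_cases i <;> assumption
  | S1 => exact b0
  | S2 => simpa [b0] using a1.1
  | S3 => exact a3

theorem linearIndependent_generator (hU : IsOpen U) (hne : U.Nonempty) :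
    LinearIndependent ℝ fun g => U.domRestrict (generator g) := by
  rw [Fintype.linearIndependent_iff]
  intro c hc
  rw [sum_smul_domRestrict] at hc
  refine congrFun (eq_zero_of_combo hU hne fun z hz => ?_)
  have h : combo c z = 0 := congrFun hc ⟨z, hz⟩
  rw [h]
  exact ⟨rfl, fun _ => rfl⟩

theorem isLiePointSymmetry_iff (hμ₀ : μ₀ ≠ 0) (hU : IsOpen U) (hc : IsConnected U)
    (hr : U ⊆ region) : IsLiePointSymmetry (cglSystem μ₀) U X ↔
      U.domRestrict X ∈ Submodule.span ℝ (Set.range fun g => U.domRestrict (generator g)) := by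
  rw [Submodule.mem_span_range_iff_exists_fun]
  simp only [sum_smul_domRestrict]
  constructor
  · intro h
    obtain ⟨c, hc⟩ := exists_combo hμ₀ hU hc hr h
    exact ⟨c, funext fun z => (hc z z.2).symm⟩
  · rintro ⟨c, hc⟩
    exact isLiePointSymmetry_of_eqOn_combo hU hr fun z hz => (congrFun hc ⟨z, hz⟩).symm

end Classification

end CGL

end
open scoped ContDiff

noncomputable section

namespace CGL

/-! ### The system with entropy -/

section FullSystem

variable {μ₀ : ℝ}

abbrev FullJet : Type := SpaceTime →L[ℝ] State × ℝ

/-- Forgetting the entropy, as a linear map. -/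
def forgetL : FullSpace →L[ℝ] Space :=
  (ContinuousLinearMap.fst ℝ SpaceTime (State × ℝ)).prod
    ((ContinuousLinearMap.fst ℝ State ℝ).comp (ContinuousLinearMap.snd ℝ SpaceTime (State × ℝ)))

/-- Forgetting the entropy and its derivatives, as a linear map. -/
def forgetJetL : FullSpace × FullJet →L[ℝ] Space × Jet :=
  (forgetL.comp (ContinuousLinearMap.fst ℝ FullSpace FullJet)).prod
    ((ContinuousLinearMap.compL ℝ SpaceTime (State × ℝ) State
      (ContinuousLinearMap.fst ℝ State ℝ)).comp (ContinuousLinearMap.snd ℝ FullSpace FullJet))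

theorem differentiableAt_cglSystem {z : Space} (hz : z ∈ region) (L : Jet) :
    DifferentiableAt ℝ (cglSystem μ₀) (z, L) := by
  -- `HasProl` contains the differentiability of the equations, so any differentiable field serves
  -- here.
  have hX : DifferentiableAt ℝ (fun _ : Space => (0 : Space)) z := differentiableAt_const _
  have h1 := massEq_hasProl (L := L) hX
  have h2 := hasProl_pi (momentumEq_hasProl (μ₀ := μ₀) (L := L) hz hX)
  have h3 := hasProl_pi (faradayEq_hasProl (L := L) hX)
  have h4 := gaussEq_hasProl (L := L) hX
  have h5 := parEq_hasProl (L := L) hz hX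
  have h6 := perpEq_hasProl (L := L) hz hX
  exact h1.1.prodMk (h2.1.prodMk (h3.1.prodMk (h4.1.prodMk (h5.1.prodMk h6.1))))

theorem fderiv_entropy (Z V : FullSpace) : fderiv ℝ entropy Z V = V.2.2 := by
  have h : HasFDerivAt entropy ((ContinuousLinearMap.snd ℝ State ℝ).comp
      (ContinuousLinearMap.snd ℝ SpaceTime (State × ℝ))) Z :=
    ((ContinuousLinearMap.snd ℝ State ℝ).comp
      (ContinuousLinearMap.snd ℝ SpaceTime (State × ℝ))).hasFDerivAt
  rw [h.fderiv]; rfl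

theorem totalDeriv_entropy (Z : FullSpace) (L : FullJet) (e : SpaceTime) :
    totalDeriv entropy Z L e = (L e).2 := by
  rw [totalDeriv_apply, fderiv_entropy]

theorem entropyEq_eq (J : FullSpace × FullJet) :
    entropyEq J = (J.2 (1, 0)).2 + ∑ k, velocity (forget J.1) k * (J.2 (eX k)).2 := by
  simp only [entropyEq, totalDeriv_entropy]

theorem entropyEq_eq' (J : FullSpace × FullJet) :
    entropyEq J = (J.2 (1, velocity (forget J.1))).2 := by
  rw [entropyEq_eq, one_velocity_eq]
  simp only [map_add, map_sum, map_smul, Prod.snd_add, Prod.snd_sum, Prod.smul_snd, smul_eq_mul]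

theorem hasFDerivAt_entropyEq (J : FullSpace × FullJet) : ∃ A : FullSpace × FullJet →L[ℝ] ℝ,
    HasFDerivAt entropyEq A J ∧
    ∀ V M, A (V, M) = (M (1, velocity (forget J.1))).2
      + ∑ k, V.2.1 (.velocity k) * (J.2 (eX k)).2 := by
  have h1 : ∀ e, HasFDerivAt (fun J : FullSpace × FullJet => (J.2 e).2)
      ((ContinuousLinearMap.snd ℝ State ℝ).comp ((ContinuousLinearMap.apply ℝ (State × ℝ) e).comp
        (ContinuousLinearMap.snd ℝ FullSpace FullJet))) J := fun e =>
    ((ContinuousLinearMap.snd ℝ State ℝ).comp ((ContinuousLinearMap.apply ℝ (State × ℝ) e).comp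
        (ContinuousLinearMap.snd ℝ FullSpace FullJet))).hasFDerivAt
  have h2 : ∀ k, HasFDerivAt (fun J : FullSpace × FullJet => velocity (forget J.1) k)
      (((ContinuousLinearMap.proj (R := ℝ) (φ := fun _ : Field => ℝ) (.velocity k)).comp
        ((ContinuousLinearMap.snd ℝ SpaceTime State).comp forgetL)).comp
        (ContinuousLinearMap.fst ℝ FullSpace FullJet)) J := fun k =>
    (((ContinuousLinearMap.proj (R := ℝ) (φ := fun _ : Field => ℝ) (.velocity k)).comp
        ((ContinuousLinearMap.snd ℝ SpaceTime State).comp forgetL)).comp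
        (ContinuousLinearMap.fst ℝ FullSpace FullJet)).hasFDerivAt
  have h3 := (h1 (1, 0)).fun_add (HasFDerivAt.fun_sum (u := Finset.univ) fun k _ =>
      (h2 k).fun_mul (h1 (eX k)))
  rw [← show entropyEq = _ from funext entropyEq_eq] at h3
  refine ⟨_, h3, fun V M => ?_⟩
  rw [one_velocity_eq, map_add, map_sum]
  simp only [map_smul]
  simp [forgetL, Prod.snd_sum, Finset.sum_add_distrib, velocity, forget]
  simp only [mul_comm, Fin.sum_univ_three]
  ring

theorem fderiv_cglFullSystem {Z : FullSpace} (hz : forget Z ∈ region) (L : FullJet)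
    (V : FullSpace) (M : FullJet) : fderiv ℝ (cglFullSystem μ₀) (Z, L) (V, M)
      = (fderiv ℝ (cglSystem μ₀) (forgetJet (Z, L)) (forgetJet (V, M)),
        (M (1, velocity (forget Z))).2 + ∑ k, V.2.1 (.velocity k) * (L (eX k)).2) := by
  obtain ⟨A, hA, hA'⟩ := hasFDerivAt_entropyEq (Z, L)
  have h1 : HasFDerivAt (fun J : FullSpace × FullJet => cglSystem μ₀ (forgetJet J)) _ (Z, L) :=
    (differentiableAt_cglSystem (μ₀ := μ₀) hz
      (forgetJet (Z, L)).2).hasFDerivAt.comp (f := forgetJet) (Z, L) forgetJetL.hasFDerivAt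
  have h2 : HasFDerivAt (cglFullSystem μ₀) _ (Z, L) := h1.prodMk hA
  rw [h2.fderiv]
  exact Prod.ext rfl (hA' V M)

end FullSystem

/-! ### Variations of the jets of rank one -/

section Transverse

variable {μ₀ : ℝ} {z : Space} {L : Jet}

/-- The vector field that vanishes at `z` and whose prolongation there is `q ⊗ a`. -/
def rankOneField (z : Space) (q : SpaceTime →L[ℝ] ℝ) (a : State) (y : Space) : Space :=
  (0, q (y.1 - z.1) • a)

variable (q : SpaceTime →L[ℝ] ℝ) (a : State)

theorem differentiable_rankOneField : Differentiable ℝ (rankOneField z q a) := by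
  unfold rankOneField
  fun_prop

theorem prolongation_rankOneField : prolongation (rankOneField z q a) z L = q.smulRight a := by
  have h1 : totalDeriv (fun y => (rankOneField z q a y).1) z L = 0 := by
    have : (fun y => (rankOneField z q a y).1) = fun _ => 0 := rfl
    rw [totalDeriv, this, fderiv_const_apply, ContinuousLinearMap.zero_comp]
  have h2 : HasFDerivAt (fun y => (rankOneField z q a y).2)
      ((q.comp (ContinuousLinearMap.fst ℝ SpaceTime State)).smulRight a) z := by
    have h3 : HasFDerivAt (fun y : Space => q (y.1 - z.1))
        (q.comp (ContinuousLinearMap.fst ℝ SpaceTime State)) z :=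
      q.hasFDerivAt.comp z (hasFDerivAt_fst.sub_const _)
    exact h3.smul_const a
  rw [prolongation, h1, totalDeriv, h2.fderiv]
  refine ContinuousLinearMap.ext fun e => ?_
  simp

theorem lieD_rankOneField (F : Space → ℝ) (y : Space) :
    lieD (rankOneField z q a) F y = q (y.1 - z.1) * fderiv ℝ F y (0, a) := by
  have : rankOneField z q a y = q (y.1 - z.1) • (0, a) := by simp [rankOneField]
  rw [lieD, this, map_smul, smul_eq_mul]

theorem lieD_rankOneField_self (F : Space → ℝ) : lieD (rankOneField z q a) F z = 0 := by
  rw [lieD_rankOneField, sub_self, map_zero, zero_mul]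

theorem lin_rankOneField {F : Space → ℝ} (hF : ContDiffAt ℝ 2 F z) (e : SpaceTime) :
    lin (rankOneField z q a) F z L e = q e * fderiv ℝ F z (0, a) := by
  have h1 : totalDeriv (fun y => (rankOneField z q a y).1) z L = 0 := by
    have : (fun y => (rankOneField z q a y).1) = fun _ => 0 := rfl
    rw [totalDeriv, this, fderiv_const_apply, ContinuousLinearMap.zero_comp]
  have h2 : HasFDerivAt (fun y : Space => q (y.1 - z.1))
      (q.comp (ContinuousLinearMap.fst ℝ SpaceTime State)) z :=
    q.hasFDerivAt.comp z (hasFDerivAt_fst.sub_const _)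
  have h3 : DifferentiableAt ℝ (fun y => fderiv ℝ F y (0, a)) z :=
    (ContDiffAt.differentiableAt_fderiv' hF).clm_apply (differentiableAt_const _)
  rw [lin, h1, show lieD (rankOneField z q a) F = _ from funext (lieD_rankOneField q a F),
    totalDeriv_mul h2.differentiableAt h3]
  have h4 : ((0, 0) : Space) = 0 := rfl
  simp only [totalDeriv_apply, h2.fderiv]
  simp [mul_comm, h4]

/-- The covector with the given space components that vanishes on the material direction. -/
def transverse (z : Space) (v : Fin 3 → ℝ) : SpaceTime →L[ℝ] ℝ :=
  ∑ k, v k • ((ContinuousLinearMap.proj (R := ℝ) (φ := fun _ : Fin 3 => ℝ) k).comp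
    (ContinuousLinearMap.snd ℝ ℝ (Fin 3 → ℝ)) - velocity z k • ContinuousLinearMap.fst ℝ ℝ _)

theorem transverse_mat (v : Fin 3 → ℝ) : transverse z v (1, velocity z) = 0 := by
  simp [transverse]

theorem transverse_eX (v : Fin 3 → ℝ) (k : Fin 3) : transverse z v (eX k) = v k := by
  simp [transverse, Pi.single_apply]

/-- A variation transverse to the flow does not change material derivatives, so the linearized
equations become algebraic in `a`: mass gives the velocity entries, Gauss the magnetic ones,
momentum the pressures. The density entry escapes, because derivatives of `ρ` occur only in its
material derivative. -/
theorem eq_zero_of_rankOne (hz : z ∈ region) (hL : ReducedEqs μ₀ z L)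
    (h : ∀ v, fderiv ℝ (cglSystem μ₀) (z, L) (0, (transverse z v).smulRight a) = 0) :
    (∀ i, a (.velocity i) = 0) ∧ (∀ i, a (.magnetic i) = 0) ∧ a .pPar = 0 ∧ a .pPerp = 0 := by
  -- The variation is realized as the prolongation of a field vanishing at `z`, so that the general
  -- linearization applies.
  have key : ∀ v, LinearizedEqs μ₀ (rankOneField z (transverse z v) a) z L := fun v => by
    refine (fderiv_cglSystem_eq_zero_iff hz (differentiable_rankOneField _ _ _) hL).1 ?_
    rw [prolongation_rankOneField]
    have : rankOneField z (transverse z v) a z = 0 := by simp [rankOneField]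
    rw [this]
    exact h v
  have hmat : ∀ v F, ContDiffAt ℝ 2 F z →
      linMat (rankOneField z (transverse z v) a) F z L = 0 := fun v F hF => by
    have h1 := transverse_mat (z := z) v
    rw [one_velocity_eq] at h1
    simp only [map_add, map_sum, map_smul, smul_eq_mul] at h1
    simp only [linMat, lin_rankOneField _ _ hF, lieD_rankOneField_self, zero_mul, add_zero,
      ← mul_assoc, ← Finset.sum_mul, ← add_mul, h1]
  have hu : ∀ i, a (.velocity i) = 0 := fun i => by
    have h1 := (key (Pi.single i 1)).mass
    rw [hmat _ _ cd_density, lieD_rankOneField_self] at h1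
    simp only [linDivU, lin_rankOneField _ _ (cd_velocity _), transverse_eX, fderiv_velocity] at h1
    simpa [Pi.single_apply, hz.1.ne'] using h1
  have hB : ∀ i, a (.magnetic i) = 0 := fun i => by
    have h1 := (key (Pi.single i 1)).gauss
    simp only [lin_rankOneField _ _ (cd_magnetic _), transverse_eX, fderiv_magnetic] at h1
    simpa [Pi.single_apply] using h1
  have hm : ∀ (v : Fin 3 → ℝ) i, v i * a .pPerp
      + ∑ j, magnetic z i * magnetic z j * (v j * ((a .pPar - a .pPerp) * invSqB z)) = 0 :=
    fun v i => by
      have h1 := (key v).momentum i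
      rw [hmat _ _ (cd_velocity _)] at h1
      simp only [lieD_rankOneField_self, lin_rankOneField _ _ (cd_magnetic _),
        lin_rankOneField _ _ (contDiff_totalPressure (μ₀ := μ₀)).contDiffAt,
        lin_rankOneField _ _ (contDiffAt_tension (μ₀ := μ₀) hz), transverse_eX, fderiv_magnetic,
        fderiv_totalPressure, fderiv_tension hz, hB] at h1
      simpa using h1
  have hw := invSqB_mul hz
  -- Unit covectors give the trace relation `3 a_⊥ + (a_∥ - a_⊥) = 0`; the covector `B`, contracted
  -- with `B`, gives `a_∥ = 0`.
  have h0 := hm (Pi.single 0 1) 0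
  have h1 := hm (Pi.single 1 1) 1
  have h2 := hm (Pi.single 2 1) 2
  have g0 := hm (magnetic z) 0
  have g1 := hm (magnetic z) 1
  have g2 := hm (magnetic z) 2
  simp [Fin.sum_univ_three] at h0 h1 h2
  simp only [sqB, Fin.sum_univ_three] at g0 g1 g2 hw
  have hpar : a .pPar = 0 := by
    linear_combination invSqB z * (magnetic z 0 * g0 + magnetic z 1 * g1 + magnetic z 2 * g2)
      - (a .pPerp + (invSqB z * (magnetic z 0 ^ 2 + magnetic z 1 ^ 2 + magnetic z 2 ^ 2) + 1)
        * (a .pPar - a .pPerp)) * hw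
  refine ⟨hu, hB, hpar, ?_⟩
  rw [hpar] at h0 h1 h2
  linear_combination (h0 + h1 + h2 + a .pPerp * hw) / 2

end Transverse

end CGL

end
open scoped ContDiff

noncomputable section

namespace CGL

/-! ### The components of a symmetry of the full system other than that along the entropy -/

section Slices

variable {μ₀ : ℝ} {U : Set FullSpace} {X : FullSpace → FullSpace}

/-- The point with the given entropy. -/
def withEntropy (s : ℝ) (y : Space) : FullSpace := (y.1, (y.2, s))

theorem hasFDerivAt_withEntropy (s : ℝ) (y : Space) : HasFDerivAt (withEntropy s)
    ((ContinuousLinearMap.fst ℝ SpaceTime State).prod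
      ((ContinuousLinearMap.snd ℝ SpaceTime State).prod 0)) y :=
  hasFDerivAt_fst.prodMk (hasFDerivAt_snd.prodMk (hasFDerivAt_const s y))

theorem contDiff_withEntropy (s : ℝ) : ContDiff ℝ ∞ (withEntropy s) :=
  contDiff_fst.prodMk (contDiff_snd.prodMk contDiff_const)

/-- The components other than that along the entropy, at fixed entropy. -/
def slice (X : FullSpace → FullSpace) (s : ℝ) (y : Space) : Space := forget (X (withEntropy s y))

/-- The derivative of a vector field with respect to the entropy. -/
def dEntropy (X : FullSpace → FullSpace) (Z : FullSpace) : FullSpace :=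
  fderiv ℝ X Z (0, (0, 1))

/-- Compared with the slice at constant entropy, the chain rule adds the entropy gradient `q` times
the derivative of the field along `S`. -/
theorem prolongation_fst {Z : FullSpace} (hX : DifferentiableAt ℝ X Z) (L : Jet)
    (q : SpaceTime →L[ℝ] ℝ) :
    (ContinuousLinearMap.fst ℝ State ℝ).comp (prolongation X Z (L.prod q))
      = prolongation (slice X Z.2.2) (forget Z) L
        + q.smulRight ((dEntropy X Z).2.1 - L (dEntropy X Z).1) := by
  have h1 : HasFDerivAt (slice X Z.2.2) ((forgetL.comp (fderiv ℝ X Z)).comp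
      ((ContinuousLinearMap.fst ℝ SpaceTime State).prod
        ((ContinuousLinearMap.snd ℝ SpaceTime State).prod 0))) (forget Z) :=
    (forgetL.hasFDerivAt.comp (f := X) Z hX.hasFDerivAt).comp (f := withEntropy Z.2.2) (forget Z)
      (hasFDerivAt_withEntropy _ _)
  refine ContinuousLinearMap.ext fun e => ?_
  have h2 : ((e, (L e, q e)) : FullSpace) = (e, (L e, 0)) + q e • (0, (0, 1)) := by simp
  simp only [prolongation, totalDeriv, dEntropy, h1.fst.fderiv, h1.snd.fderiv,
    hX.hasFDerivAt.fst.fderiv, hX.hasFDerivAt.snd.fderiv]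
  have h3 : fderiv ℝ X Z (e, (L e, q e))
      = fderiv ℝ X Z (e, (L e, 0)) + q e • fderiv ℝ X Z (0, (0, 1)) := by
    rw [h2, map_add, map_smul]
  change (fderiv ℝ X Z (e, (L e, q e))).2.1 - L (fderiv ℝ X Z (e, (L e, q e))).1
    = ((fderiv ℝ X Z (e, (L e, 0))).2.1 - L (fderiv ℝ X Z (e, (L e, 0))).1)
      + q e • ((fderiv ℝ X Z (0, (0, 1))).2.1 - L (fderiv ℝ X Z (0, (0, 1))).1)
  rw [h3]
  simp only [Prod.fst_add, Prod.snd_add, Prod.smul_fst, Prod.smul_snd, map_add, map_smul]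
  module

theorem cglFullSystem_prod_eq_zero_iff {Z : FullSpace} {L : Jet} {q : SpaceTime →L[ℝ] ℝ} :
    cglFullSystem μ₀ (Z, L.prod q) = 0
      ↔ cglSystem μ₀ (forget Z, L) = 0 ∧ q (1, velocity (forget Z)) = 0 := by
  rw [cglFullSystem, entropyEq_eq', Prod.mk_eq_zero]
  rfl

theorem fderiv_cglSystem_of_full (hU : IsOpen U) (hr : ∀ Z ∈ U, forget Z ∈ region)
    (hX : IsLiePointSymmetry (cglFullSystem μ₀) U X) {Z : FullSpace} (hZ : Z ∈ U) {L : Jet}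
    {q : SpaceTime →L[ℝ] ℝ} (hL : cglSystem μ₀ (forget Z, L) = 0)
    (hq : q (1, velocity (forget Z)) = 0) :
    fderiv ℝ (cglSystem μ₀) (forget Z, L) (slice X Z.2.2 (forget Z),
      prolongation (slice X Z.2.2) (forget Z) L
        + q.smulRight ((dEntropy X Z).2.1 - L (dEntropy X Z).1)) = 0 := by
  have hd : DifferentiableAt ℝ X Z := (hX.1.contDiffAt (hU.mem_nhds hZ)).differentiableAt (by simp)
  have h := hX.2 Z hZ (L.prod q) (cglFullSystem_prod_eq_zero_iff.2 ⟨hL, hq⟩)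
  rw [fderiv_cglFullSystem (hr Z hZ)] at h
  rw [← prolongation_fst hd]
  exact congrArg Prod.fst h

theorem isLiePointSymmetry_slice (hU : IsOpen U) (hr : ∀ Z ∈ U, forget Z ∈ region)
    (hX : IsLiePointSymmetry (cglFullSystem μ₀) U X) (s : ℝ) :
    IsLiePointSymmetry (cglSystem μ₀) (withEntropy s ⁻¹' U) (slice X s) := by
  refine ⟨?_, fun y hy L hL => ?_⟩
  · exact forgetL.contDiff.comp_contDiffOn
      (hX.1.comp (contDiff_withEntropy s).contDiffOn fun y hy => hy)
  · have h := fderiv_cglSystem_of_full hU hr hX hy (q := 0) hL rfl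
    simp only [ContinuousLinearMap.zero_smulRight, add_zero] at h
    exact h

/-- The symmetry conditions for a transverse entropy gradient `q` and for `q = 0` differ by the
variation `q ⊗ (∂_S η - L ∂_S ξ)`, to which `eq_zero_of_rankOne` applies for every solution jet `L`.
Varying the acceleration in `L` kills the time part of `∂_S ξ`, and varying the velocity gradient
its space part. -/
theorem dEntropy_eq_zero (hU : IsOpen U) (hr : ∀ Z ∈ U, forget Z ∈ region)
    (hX : IsLiePointSymmetry (cglFullSystem μ₀) U X) {Z : FullSpace} (hZ : Z ∈ U) :
    (dEntropy X Z).1 = 0 ∧ ∀ i, (dEntropy X Z).2.1 (.magnetic i) = 0 := by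
  set z := forget Z
  have hz : z ∈ region := hr Z hZ
  set W := dEntropy X Z
  have h1 : ∀ j : JetData, ∑ k, j.b k k = 0 →
      (∀ i, W.2.1 (.velocity i) = (jetMap μ₀ z j W.1) (.velocity i)) ∧
      ∀ i, W.2.1 (.magnetic i) = (jetMap μ₀ z j W.1) (.magnetic i) := fun j hj => by
    have hL := reducedEqs_jetMap (μ₀ := μ₀) hz hj
    have hL' := (cglSystem_eq_zero_iff hz).2 hL
    have h2 := eq_zero_of_rankOne (W.2.1 - jetMap μ₀ z j W.1) hz hL fun v => by
      have h3 := fderiv_cglSystem_of_full hU hr hX hZ hL' (transverse_mat v)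
      have h4 := fderiv_cglSystem_of_full hU hr hX hZ hL' (q := 0) rfl
      have h5 := sub_eq_zero.2 (h3.trans h4.symm)
      rw [← map_sub] at h5
      convert h5 using 2
      simp [W, z]
    exact ⟨fun i => sub_eq_zero.1 (h2.1 i), fun i => sub_eq_zero.1 (h2.2.1 i)⟩
  have h2 : W.1 = W.1.1 • (1, velocity z) + ∑ k, (W.1.2 k - W.1.1 * velocity z k) • eX k := by
    refine Prod.ext ?_ (funext fun i => ?_)
    · simp [Prod.fst_sum]
    · simp [Prod.snd_sum, Pi.single_apply]
  have h3 : ∀ j : JetData, ∑ k, j.b k k = 0 → ∀ i, W.2.1 (.velocity i)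
      = W.1.1 * j.y i + ∑ k, (W.1.2 k - W.1.1 * velocity z k) * j.g k i := fun j hj i => by
    have h4 : jetMap μ₀ z j W.1 = W.1.1 • jetD μ₀ z j
        + ∑ k, (W.1.2 k - W.1.1 * velocity z k) • jetX μ₀ z j k := by
      conv_lhs => rw [h2, map_add, map_sum]
      simp only [map_smul, jetMap_eX, jetMap_mat]
    rw [(h1 j hj).1 i, h4]
    simp [jetD, jetX, frameVec]
  have h4 : ∀ i, W.2.1 (.velocity i) = 0 := fun i => by
    simpa using h3 ⟨0, 0, 0, 0, 0⟩ (by simp) i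
  have h5 : W.1.1 = 0 := by
    have := h3 { y := fun _ => 1, g := 0, b := 0, r := 0, s := 0 } (by simp) 0
    simpa [h4] using this.symm
  have h6 : ∀ k, W.1.2 k = 0 := fun k => by
    have := h3 { y := 0, g := fun l _ => if l = k then 1 else 0, b := 0, r := 0, s := 0 }
      (by simp) 0
    simpa [h4, h5] using this.symm
  have h7 : W.1 = 0 := Prod.ext h5 (funext h6)
  refine ⟨h7, fun i => ?_⟩
  simpa [h7] using (h1 ⟨0, 0, 0, 0, 0⟩ (by simp)).2 i

theorem combo_sub (c d : Generator → ℝ) (z : Space) :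
    combo (c - d) z = combo c z - combo d z := by
  simp [combo, sub_smul, Finset.sum_sub_distrib]

theorem combo_injective {c d : Generator → ℝ} {z : Space}
    (h : ∀ᶠ y in nhds z, (combo c y).1 = (combo d y).1 ∧
      ∀ i, (combo c y).2 (.magnetic i) = (combo d y).2 (.magnetic i)) : c = d := by
  obtain ⟨V, hV, hVo, hz⟩ := eventually_nhds_iff.1 h
  refine sub_eq_zero.1 (eq_zero_of_combo hVo ⟨z, hz⟩ fun y hy => ?_)
  rw [combo_sub, Prod.fst_sub, Prod.snd_sub, (hV y hy).1, sub_self]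
  exact ⟨rfl, fun i => sub_eq_zero.2 ((hV y hy).2 i)⟩

theorem eventually_withEntropy {p : FullSpace → Prop} {Z : FullSpace} (h : ∀ᶠ Y in nhds Z, p Y) :
    ∀ᶠ y in nhds (forget Z), p (withEntropy Z.2.2 y) :=
  have h1 : Filter.Tendsto (withEntropy Z.2.2) (nhds (forget Z)) (nhds Z) :=
    (contDiff_withEntropy Z.2.2).continuous.tendsto (forget Z)
  h1.eventually h

/-- In the maximum metric a ball of the full space is a product of balls, so its slices are
connected and each is governed by some coefficients `c s`. These do not vary with `s`, since the
components that determine them do not depend on the entropy. -/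
theorem exists_combo_local (hμ₀ : μ₀ ≠ 0) (hU : IsOpen U) (hr : ∀ Z ∈ U, forget Z ∈ region)
    (hX : IsLiePointSymmetry (cglFullSystem μ₀) U X) {Z₀ : FullSpace} (hZ₀ : Z₀ ∈ U) :
    ∃ c, ∀ᶠ Z in nhds Z₀, forget (X Z) = combo c (forget Z) := by
  obtain ⟨r, hr0, hrU⟩ := Metric.isOpen_iff.1 hU Z₀ hZ₀
  have hmem : ∀ s ∈ Metric.ball Z₀.2.2 r, ∀ y ∈ Metric.ball (forget Z₀) r,
      withEntropy s y ∈ U := fun s hs y hy => hrU <| by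
    simp only [Metric.mem_ball, Prod.dist_eq, max_lt_iff] at hs hy ⊢
    exact ⟨hy.1, hy.2, hs⟩
  have hy₀ : forget Z₀ ∈ Metric.ball (forget Z₀) r := Metric.mem_ball_self hr0
  have hs₀ : Z₀.2.2 ∈ Metric.ball Z₀.2.2 r := Metric.mem_ball_self hr0
  have h1 : ∀ s, ∃ c, s ∈ Metric.ball Z₀.2.2 r → ∀ y ∈ Metric.ball (forget Z₀) r,
      slice X s y = combo c y := fun s => by
    by_cases hs : s ∈ Metric.ball Z₀.2.2 r
    · obtain ⟨c, hc⟩ := exists_combo hμ₀ Metric.isOpen_ball (Metric.isConnected_ball hr0)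
        (fun y hy => hr _ (hmem s hs y hy))
        ((isLiePointSymmetry_slice hU hr hX s).mono fun y hy => hmem s hs y hy)
      exact ⟨c, fun _ => hc⟩
    · exact ⟨0, fun h => absurd h hs⟩
  choose c hc using h1
  have h2 : ∀ y ∈ Metric.ball (forget Z₀) r, ∀ s ∈ Metric.ball Z₀.2.2 r,
      HasDerivAt (fun s => X (withEntropy s y)) (dEntropy X (withEntropy s y)) s :=
    fun y hy s hs => by
      have hd : DifferentiableAt ℝ X (withEntropy s y) :=
        (hX.1.contDiffAt (hU.mem_nhds (hmem s hs y hy))).differentiableAt (by simp)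
      exact hd.hasFDerivAt.comp_hasDerivAt s
        ((hasDerivAt_const s y.1).prodMk ((hasDerivAt_const s y.2).prodMk (hasDerivAt_id s)))
  have h3 : ∀ {E : Type} [NormedAddCommGroup E] [NormedSpace ℝ E] (A : FullSpace →L[ℝ] E),
      (∀ Z ∈ U, A (dEntropy X Z) = 0) → ∀ y ∈ Metric.ball (forget Z₀) r,
      ∀ s ∈ Metric.ball Z₀.2.2 r, A (X (withEntropy s y)) = A (X (withEntropy Z₀.2.2 y)) := by
    intro E _ _ A hA y hy s hs
    have h4 : ∀ s ∈ Metric.ball Z₀.2.2 r, HasDerivAt (fun s => A (X (withEntropy s y))) 0 s :=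
      fun s hs => by
        rw [← hA _ (hmem s hs y hy)]
        exact A.hasFDerivAt.comp_hasDerivAt s (h2 y hy s hs)
    exact Metric.isOpen_ball.is_const_of_deriv_eq_zero (convex_ball _ _).isPreconnected
      (fun s hs => (h4 s hs).differentiableAt.differentiableWithinAt)
      (fun s hs => (h4 s hs).deriv) hs hs₀
  have h4 : ∀ s ∈ Metric.ball Z₀.2.2 r, c s = c Z₀.2.2 := fun s hs => by
    refine combo_injective (z := forget Z₀) ?_
    filter_upwards [Metric.isOpen_ball.mem_nhds hy₀] with y hy
    rw [← hc s hs y hy, ← hc _ hs₀ y hy]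
    exact ⟨h3 (ContinuousLinearMap.fst ℝ SpaceTime (State × ℝ))
        (fun Z hZ => (dEntropy_eq_zero hU hr hX hZ).1) y hy s hs,
      fun i => h3 ((ContinuousLinearMap.proj (R := ℝ) (φ := fun _ : Field => ℝ) (.magnetic i)).comp
        ((ContinuousLinearMap.snd ℝ SpaceTime State).comp forgetL))
        (fun Z hZ => (dEntropy_eq_zero hU hr hX hZ).2 i) y hy s hs⟩
  refine ⟨c Z₀.2.2, ?_⟩
  filter_upwards [Metric.ball_mem_nhds Z₀ hr0] with Z hZ
  simp only [Metric.mem_ball, Prod.dist_eq, max_lt_iff] at hZ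
  have h5 := hc Z.2.2 hZ.2.2 (forget Z) (by
    simp only [Metric.mem_ball, Prod.dist_eq, max_lt_iff]
    exact ⟨hZ.1, hZ.2.1⟩)
  rw [h4 _ hZ.2.2] at h5
  exact h5

/-- Slices of `U` at constant entropy may be disconnected, so the coefficients are found locally.
They agree on overlaps, hence are locally constant on the connected set `U`. -/
theorem exists_combo_full (hμ₀ : μ₀ ≠ 0) (hU : IsOpen U) (hc : IsConnected U)
    (hr : ∀ Z ∈ U, forget Z ∈ region) (hX : IsLiePointSymmetry (cglFullSystem μ₀) U X) :
    ∃ c, ∀ Z ∈ U, forget (X Z) = combo c (forget Z) := by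
  choose c hcX using fun Z : U => exists_combo_local hμ₀ hU hr hX Z.2
  have : PreconnectedSpace U := Subtype.preconnectedSpace hc.isPreconnected
  have h1 : IsLocallyConstant c := (IsLocallyConstant.iff_eventually_eq c).2 fun Z => by
    filter_upwards [continuous_subtype_val.continuousAt.eventually (hcX Z).eventually_nhds]
      with Y hY
    refine combo_injective (z := forget (Y : FullSpace)) ?_
    filter_upwards [eventually_withEntropy (hcX Y), eventually_withEntropy hY] with y h2 h3
    have h4 : combo (c Y) y = combo (c Z) y := h2.symm.trans h3
    rw [h4]
    exact ⟨rfl, fun _ => rfl⟩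
  obtain ⟨Z₀, hZ₀⟩ := hc.nonempty
  refine ⟨c ⟨Z₀, hZ₀⟩, fun Z hZ => ?_⟩
  rw [← h1.apply_eq_of_preconnectedSpace ⟨Z, hZ⟩ ⟨Z₀, hZ₀⟩]
  exact (hcX ⟨Z, hZ⟩).self_of_nhds

end Slices

end CGL

end
open scoped ContDiff

noncomputable section

namespace CGL

/-! ### Advected functions -/

section Advected

variable {μ₀ : ℝ} {Z : FullSpace}

/-- The coordinates of the state, as linear forms. -/
def coordL (f : Field) : FullSpace →L[ℝ] ℝ :=
  (ContinuousLinearMap.proj (R := ℝ) (φ := fun _ : Field => ℝ) f).comp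
    ((ContinuousLinearMap.snd ℝ SpaceTime State).comp forgetL)

theorem coordL_apply (f : Field) (V : FullSpace) : coordL f V = V.2.1 f := rfl

theorem hasFDerivAt_sqB : HasFDerivAt (fun Z : FullSpace => sqB (forget Z))
    ((2 : ℝ) • ∑ i, magnetic (forget Z) i • coordL (.magnetic i)) Z := by
  have h1 : HasFDerivAt sqB (fderiv ℝ sqB (forget Z)) (forget Z) :=
    (df contDiff_sqB.contDiffAt).hasFDerivAt
  have h2 : (2 : ℝ) • ∑ i, magnetic (forget Z) i • coordL (.magnetic i)
      = (fderiv ℝ sqB (forget Z)).comp forgetL := ContinuousLinearMap.ext fun V => by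
    simp only [ContinuousLinearMap.comp_apply, fderiv_sqB, smul_apply, sum_apply, smul_eq_mul]
    rfl
  rw [h2]
  exact h1.comp (f := forget) Z forgetL.hasFDerivAt

theorem magneticStrength_eq (z : Space) : magneticStrength z = Real.sqrt (sqB z) := by
  rw [← magneticStrength_sq, Real.sqrt_sq (by unfold magneticStrength; positivity)]

theorem magneticStrength_pos {z : Space} (hz : z ∈ region) : 0 < magneticStrength z := by
  rw [magneticStrength_eq]
  exact Real.sqrt_pos.2 (sqB_pos hz)

theorem fderiv_parInvariant (hz : forget Z ∈ region) (V : FullSpace) :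
    fderiv ℝ parInvariant Z V = (V.2.1 .pPar * sqB (forget Z)
        + 2 * pPar (forget Z) * ∑ i, magnetic (forget Z) i * V.2.1 (.magnetic i))
        / density (forget Z) ^ 3
      - 3 * pPar (forget Z) * sqB (forget Z) * V.2.1 .density / density (forget Z) ^ 4 := by
  have hρ : density (forget Z) ≠ 0 := hz.1.ne'
  have h1 : HasFDerivAt (fun Z => density (forget Z)) (coordL .density) Z :=
    (coordL .density).hasFDerivAt
  have h2 : HasFDerivAt (fun Z => pPar (forget Z)) (coordL .pPar) Z := (coordL .pPar).hasFDerivAt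
  have h3 : HasFDerivAt (fun Z => (density (forget Z) ^ 3)⁻¹) _ Z :=
    HasDerivAt.comp_hasFDerivAt (h₂ := fun r : ℝ => (r ^ 3)⁻¹) Z
      ((hasDerivAt_pow 3 (density (forget Z))).fun_inv (pow_ne_zero 3 hρ)) h1
  have h4 := (h2.fun_mul hasFDerivAt_sqB).fun_mul h3
  have h5 : parInvariant = fun Z => pPar (forget Z) * sqB (forget Z) * (density (forget Z) ^ 3)⁻¹ :=
    funext fun Z => by rw [parInvariant, magneticStrength_sq, div_eq_mul_inv]
  rw [h5, h4.fderiv]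
  simp only [add_apply, smul_apply, sum_apply, smul_eq_mul, coordL_apply]
  field_simp
  ring

theorem fderiv_perpInvariant (hz : forget Z ∈ region) (V : FullSpace) :
    fderiv ℝ perpInvariant Z V
      = V.2.1 .pPerp / (density (forget Z) * magneticStrength (forget Z))
      - pPerp (forget Z) * V.2.1 .density
        / (density (forget Z) ^ 2 * magneticStrength (forget Z))
      - pPerp (forget Z) * (∑ i, magnetic (forget Z) i * V.2.1 (.magnetic i))
        / (density (forget Z) * magneticStrength (forget Z) ^ 3) := by
  have hρ : density (forget Z) ≠ 0 := hz.1.ne'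
  have hb : magneticStrength (forget Z) ≠ 0 := (magneticStrength_pos hz).ne'
  have h1 : HasFDerivAt (fun Z => density (forget Z)) (coordL .density) Z :=
    (coordL .density).hasFDerivAt
  have h2 : HasFDerivAt (fun Z => pPerp (forget Z)) (coordL .pPerp) Z :=
    (coordL .pPerp).hasFDerivAt
  have h3 : HasFDerivAt (fun Z => magneticStrength (forget Z)) _ Z :=
    ((hasFDerivAt_sqB (Z := Z)).sqrt (sqB_pos hz).ne').congr_of_eventuallyEq
      (Filter.Eventually.of_forall fun Z => magneticStrength_eq (forget Z))
  have h4 : HasFDerivAt (fun Z => (density (forget Z) * magneticStrength (forget Z))⁻¹) _ Z :=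
    (hasDerivAt_inv (mul_ne_zero hρ hb)).comp_hasFDerivAt Z (h1.fun_mul h3)
  have h5 := h2.fun_mul h4
  have h6 : perpInvariant
      = fun Z => pPerp (forget Z) * (density (forget Z) * magneticStrength (forget Z))⁻¹ :=
    funext fun Z => by rw [perpInvariant, div_eq_mul_inv]
  rw [h6, h5.fderiv]
  simp only [add_apply, smul_apply, sum_apply, smul_eq_mul, coordL_apply, ← magneticStrength_eq]
  field_simp
  ring

section Material

variable {z : Space} {L : Jet} (h : ReducedEqs μ₀ z L)
include h

theorem material_density : L (1, velocity z) .density = -(density z * divU z L) := by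
  have h1 := h.mass
  rw [matD_eq, totalDeriv_apply, fderiv_density] at h1
  exact eq_neg_of_add_eq_zero_left h1

theorem material_pPar :
    L (1, velocity z) .pPar = -(pPar z * (divU z L + 2 * strain z L)) := by
  have h1 := h.par
  rw [matD_eq, totalDeriv_apply, fderiv_pPar] at h1
  linear_combination h1

theorem material_pPerp :
    L (1, velocity z) .pPerp = pPerp z * (strain z L - 2 * divU z L) := by
  have h1 := h.perp
  rw [matD_eq, totalDeriv_apply, fderiv_pPerp] at h1
  linear_combination h1

theorem sum_material_magnetic (hz : z ∈ region) :
    ∑ i, magnetic z i * L (1, velocity z) (.magnetic i) = sqB z * (strain z L - divU z L) := by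
  have h1 := h.faraday
  have h2 := invSqB_mul hz
  simp only [matD_eq, totalDeriv_apply, fderiv_magnetic, fderiv_velocity] at h1
  simp only [strain, sqB, totalDeriv_apply, fderiv_velocity, Fin.sum_univ_three] at h1 h2 ⊢
  linear_combination magnetic z 0 * h1 0 + magnetic z 1 * h1 1 + magnetic z 2 * h1 2
    - (magnetic z 0 * magnetic z 0 * L (eX 0) (.velocity 0)
      + magnetic z 0 * magnetic z 1 * L (eX 0) (.velocity 1)
      + magnetic z 0 * magnetic z 2 * L (eX 0) (.velocity 2)
      + magnetic z 1 * magnetic z 0 * L (eX 1) (.velocity 0)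
      + magnetic z 1 * magnetic z 1 * L (eX 1) (.velocity 1)
      + magnetic z 1 * magnetic z 2 * L (eX 1) (.velocity 2)
      + magnetic z 2 * magnetic z 0 * L (eX 2) (.velocity 0)
      + magnetic z 2 * magnetic z 1 * L (eX 2) (.velocity 1)
      + magnetic z 2 * magnetic z 2 * L (eX 2) (.velocity 2)) * h2

end Material

/-- With `θ` the strain along `B`, the logarithmic rates along the flow are `-(∇·u + 2θ)` for `p_∥`,
`2(θ - ∇·u)` for `|B|²` and `-3∇·u` for `ρ³`; they balance. For the other scalar the rates are `θ -
2∇·u`, `-∇·u` and `θ - ∇·u`. -/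
theorem fderiv_parInvariant_material (hz : forget Z ∈ region) {L : Jet}
    (h : ReducedEqs μ₀ (forget Z) L) (e : SpaceTime) (s : ℝ) :
    fderiv ℝ parInvariant Z (e, (L (1, velocity (forget Z)), s)) = 0 := by
  have hρ : density (forget Z) ≠ 0 := hz.1.ne'
  simp only [fderiv_parInvariant hz, material_density h, material_pPar h,
    sum_material_magnetic h hz]
  field_simp
  ring

theorem fderiv_perpInvariant_material (hz : forget Z ∈ region) {L : Jet}
    (h : ReducedEqs μ₀ (forget Z) L) (e : SpaceTime) (s : ℝ) :
    fderiv ℝ perpInvariant Z (e, (L (1, velocity (forget Z)), s)) = 0 := by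
  have hρ : density (forget Z) ≠ 0 := hz.1.ne'
  have hb : magneticStrength (forget Z) ≠ 0 := (magneticStrength_pos hz).ne'
  simp only [fderiv_perpInvariant hz, material_density h, material_pPerp h,
    sum_material_magnetic h hz, ← magneticStrength_sq]
  field_simp
  ring

theorem sum_field {M : Type*} [AddCommMonoid M] (f : Field → M) : ∑ i, f i =
    f .density + (∑ i, f (.velocity i) + (∑ i, f (.magnetic i) + (f .pPar + f .pPerp))) := by
  have h : (Finset.univ : Finset Field) = {.density, .velocity 0, .velocity 1, .velocity 2,
    .magnetic 0, .magnetic 1, .magnetic 2, .pPar, .pPerp} := by decide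
  rw [h]
  simp [Fin.sum_univ_three, add_assoc]

theorem apply_eq_sum (ℓ : FullSpace →L[ℝ] ℝ) (V : FullSpace) : ℓ V = ℓ (V.1, 0)
    + ∑ f, V.2.1 f * ℓ (0, (Pi.single f 1, 0)) + V.2.2 * ℓ (0, (0, 1)) := by
  have h1 : V = (V.1, 0) + ∑ f, V.2.1 f • ((0, (Pi.single f 1, 0)) : FullSpace)
      + V.2.2 • ((0, (0, 1)) : FullSpace) := by
    refine Prod.ext ?_ (Prod.ext (funext fun g => ?_) ?_)
    · simp [Prod.fst_sum]
    · simp [Prod.fst_sum, Prod.snd_sum, Pi.single_apply]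
    · simp [Prod.snd_sum]
  conv_lhs => rw [h1]
  simp only [map_add, map_sum, map_smul, smul_eq_mul]

/-- A linear form that vanishes along the material derivatives of all the solutions, on space-time
and along the velocities, is a combination of the differentials of the advected scalars. -/
theorem mem_span_of_material (hz : forget Z ∈ region) (ℓ : FullSpace →L[ℝ] ℝ)
    (he : ∀ e, ℓ (e, 0) = 0) (hu : ∀ i, ℓ (0, (Pi.single (.velocity i) 1, 0)) = 0)
    (h : ∀ L, ReducedEqs μ₀ (forget Z) L →
      ℓ ((1, velocity (forget Z)), (L (1, velocity (forget Z)), 0)) = 0) :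
    ℓ ∈ Submodule.span ℝ
      {fderiv ℝ entropy Z, fderiv ℝ parInvariant Z, fderiv ℝ perpInvariant Z} := by
  have hρ : density (forget Z) ≠ 0 := hz.1.ne'
  have hb : magneticStrength (forget Z) ≠ 0 := (magneticStrength_pos hz).ne'
  have hs : sqB (forget Z) ≠ 0 := (sqB_pos hz).ne'
  rw [Submodule.mem_span_triple]
  -- Each of the directions `S`, `p_∥`, `p_⊥` is seen by exactly one of the three differentials,
  -- which forces the coefficients.
  refine ⟨ℓ (0, (0, 1)), ℓ (0, (Pi.single .pPar 1, 0)) * density (forget Z) ^ 3 / sqB (forget Z),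
    ℓ (0, (Pi.single .pPerp 1, 0)) * (density (forget Z) * magneticStrength (forget Z)), ?_⟩
  rw [← sub_eq_zero, ← neg_eq_zero, neg_sub]
  set m := ℓ - (_ + _ + _) with hm
  have hm' : ∀ V, m V = ℓ V - (ℓ (0, (0, 1)) * fderiv ℝ entropy Z V
      + ℓ (0, (Pi.single .pPar 1, 0)) * density (forget Z) ^ 3 / sqB (forget Z)
        * fderiv ℝ parInvariant Z V
      + ℓ (0, (Pi.single .pPerp 1, 0)) * (density (forget Z) * magneticStrength (forget Z))
        * fderiv ℝ perpInvariant Z V) := fun V => rfl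
  have h1 : ∀ e, m (e, 0) = 0 := fun e => by
    simp [hm', he, fderiv_entropy, fderiv_parInvariant hz, fderiv_perpInvariant hz]
  have h2 : m (0, (0, 1)) = 0 := by
    simp [hm', fderiv_entropy, fderiv_parInvariant hz, fderiv_perpInvariant hz]
  have h3 : m (0, (Pi.single .pPar 1, 0)) = 0 := by
    simp [hm', fderiv_entropy, fderiv_parInvariant hz, fderiv_perpInvariant hz]
    field_simp
    ring
  have h4 : m (0, (Pi.single .pPerp 1, 0)) = 0 := by
    simp [hm', fderiv_entropy, fderiv_parInvariant hz, fderiv_perpInvariant hz]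
    field_simp
    ring
  have h5 : ∀ i, m (0, (Pi.single (.velocity i) 1, 0)) = 0 := fun i => by
    simp [hm', hu, fderiv_entropy, fderiv_parInvariant hz, fderiv_perpInvariant hz]
  have h6 : ∀ V, m V = V.2.1 .density * m (0, (Pi.single .density 1, 0))
      + ∑ i, V.2.1 (.magnetic i) * m (0, (Pi.single (.magnetic i) 1, 0)) := fun V => by
    rw [apply_eq_sum, sum_field]
    simp [h1, h2, h3, h4, h5]
  -- Only the `ρ` and `B` entries of `m` remain, and along the flow these variables change by an
  -- arbitrary velocity gradient `g`.
  have h7 : ∀ g : Fin 3 → Fin 3 → ℝ,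
      -(density (forget Z) * ∑ k, g k k) * m (0, (Pi.single .density 1, 0))
      + ∑ i, (∑ k, magnetic (forget Z) k * g k i - magnetic (forget Z) i * ∑ k, g k k)
        * m (0, (Pi.single (.magnetic i) 1, 0)) = 0 := fun g => by
    have h8 := reducedEqs_jetMap (μ₀ := μ₀) (z := forget Z)
      (j := { r := 0, y := 0, s := 0, g := g, b := 0 }) hz (by simp)
    have h9 : m ((1, velocity (forget Z)), (jetMap μ₀ (forget Z)
        { r := 0, y := 0, s := 0, g := g, b := 0 } (1, velocity (forget Z)), 0)) = 0 := by
      rw [hm', h _ h8, fderiv_entropy, fderiv_parInvariant_material hz h8,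
        fderiv_perpInvariant_material hz h8]
      simp
    rw [h6, jetMap_mat] at h9
    exact h9
  generalize m (0, (Pi.single .density 1, 0)) = a at h6 h7
  generalize hc : (fun i => m (0, (Pi.single (.magnetic i) 1, 0))) = c
  have hc' : ∀ i, m (0, (Pi.single (.magnetic i) 1, 0)) = c i := fun i => congrFun hc i
  simp only [hc'] at h6 h7
  have h8 : ∀ k i, magnetic (forget Z) k * c i
      = if k = i then density (forget Z) * a + ∑ l, magnetic (forget Z) l * c l else 0 :=
    fun k i => by
      have h9 := h7 fun k' i' => if k' = k then if i' = i then 1 else 0 else 0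
      fin_cases k <;> fin_cases i <;> simp [Fin.sum_univ_three] at h9 ⊢ <;>
        first | exact h9 | linarith
  -- Where `B_k ≠ 0`, off-diagonal gradients kill every `c i` with `i ≠ k`. The diagonal relation at
  -- `k + 1` then shows that the common diagonal value is zero, and the one at `k` gives `c k = 0`.
  have hcz : ∀ i, c i = 0 := by
    obtain ⟨k, hk⟩ := Function.ne_iff.1 hz.2
    have h9 : ∀ i, k ≠ i → c i = 0 := fun i hi => by
      have h10 := h8 k i
      rw [if_neg hi] at h10
      exact (mul_eq_zero.1 h10).resolve_left hk
    have h10 := h8 (k + 1) (k + 1)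
    have h11 := h8 k k
    rw [h9 (k + 1) (by simp), mul_zero, if_pos rfl] at h10
    rw [if_pos rfl, ← h10] at h11
    intro i
    by_cases hi : k = i
    · exact hi ▸ (mul_eq_zero.1 h11).resolve_left hk
    · exact h9 i hi
  have haz : a = 0 := by
    have h9 := h8 0 0
    simpa [hcz, hρ] using h9.symm
  exact ContinuousLinearMap.ext fun V => by rw [h6]; simp [hcz, haz]

end Advected

end CGL

end
open scoped ContDiff

noncomputable section

namespace CGL

/-! ### The point symmetries of the full system -/

section FullClassification

variable {μ₀ : ℝ} {U : Set FullSpace} {X : FullSpace → FullSpace} {φ : FullSpace → ℝ}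
  {c : Generator → ℝ}

/-- A smooth function is constant along the solutions if and only if its differential is a
combination of those of the three advected scalars. -/
theorem forall_mem_span_iff (hU : IsOpen U) (hr : ∀ Z ∈ U, forget Z ∈ region)
    (hφ : ContDiffOn ℝ ∞ φ U) : (∀ Z ∈ U, fderiv ℝ φ Z ∈ Submodule.span ℝ
      {fderiv ℝ entropy Z, fderiv ℝ parInvariant Z, fderiv ℝ perpInvariant Z}) ↔
    ∀ Z ∈ U, ∀ L, ReducedEqs μ₀ (forget Z) L →
      fderiv ℝ φ Z ((1, velocity (forget Z)), (L (1, velocity (forget Z)), 0)) = 0 := by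
  constructor
  · intro h Z hZ L hL
    obtain ⟨a, b, d, h1⟩ := Submodule.mem_span_triple.1 (h Z hZ)
    rw [← h1]
    simp only [add_apply, smul_apply, fderiv_entropy,
      fderiv_parInvariant_material (hr Z hZ) hL, fderiv_perpInvariant_material (hr Z hZ) hL]
    simp
  · intro h Z hZ
    -- With zero gradients and free acceleration the state changes along the velocity only, which
    -- separates `∂_t φ + u·∇φ = 0` from `∂_u φ = 0`.
    have hj : ∀ (y : Fin 3 → ℝ), ∀ Z ∈ U, fderiv ℝ φ Z ((1, velocity (forget Z)),
        (jetD μ₀ (forget Z) { r := 0, y := y, s := 0, g := 0, b := 0 }, 0)) = 0 :=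
      fun y Z hZ => by
        have h1 := h Z hZ _ (reducedEqs_jetMap (j := { r := 0, y := y, s := 0, g := 0, b := 0 })
          (hr Z hZ) (by simp))
        rwa [jetMap_mat] at h1
    have hD : ∀ (z : Space) (y : Fin 3 → ℝ),
        jetD μ₀ z { r := 0, y := y, s := 0, g := 0, b := 0 }
          = ∑ i, y i • Pi.single (.velocity i) 1 := fun z y => by
      funext f
      rw [Finset.sum_apply]
      cases f <;> simp [jetD, frameVec, PointData.Drho, PointData.div, PointData.DB, PointData.DP,
        PointData.Ds, PointData.strain, Pi.single_apply]
    have h0 : ∀ Z ∈ U, fderiv ℝ φ Z ((1, velocity (forget Z)), 0) = 0 := fun Z hZ => by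
      have h1 := hj 0 Z hZ
      rw [hD] at h1
      simp only [Pi.zero_apply, zero_smul, Finset.sum_const_zero] at h1
      exact h1
    have hu : ∀ i, ∀ Z ∈ U, fderiv ℝ φ Z (0, (Pi.single (.velocity i) 1, 0)) = 0 :=
      fun i Z hZ => by
        have h1 := hj (Pi.single i 1) Z hZ
        have h2 := h0 Z hZ
        rw [hD] at h1
        have h3 : ((0, (Pi.single (.velocity i) 1, 0)) : FullSpace)
            = ((1, velocity (forget Z)),
              (∑ k, (Pi.single i 1 : Fin 3 → ℝ) k • Pi.single (Field.velocity k) 1, 0))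
            - ((1, velocity (forget Z)), 0) := by
          simp [Pi.single_apply]
        rw [h3, map_sub, h1, h2, sub_zero]
    -- The commutator of `∂_{u_i}` with `∂_t + u·∇` is `∂_{x_i}`. Both operators annihilate `φ` on
    -- the open set, hence so does the commutator, computed here from the symmetric second
    -- derivative.
    have hx : ∀ i, fderiv ℝ φ Z (eX i, 0) = 0 := fun i => by
      set v : FullSpace := (0, (Pi.single (.velocity i) 1, 0)) with hv
      have hφ' : ContDiffAt ℝ 2 φ Z :=
        (hφ.contDiffAt (hU.mem_nhds hZ)).of_le (WithTop.coe_le_coe.2 le_top)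
      have hc : HasFDerivAt (fun Z : FullSpace => (((1, velocity (forget Z)), 0) : FullSpace))
          (((0 : FullSpace →L[ℝ] ℝ).prod (ContinuousLinearMap.pi fun k => coordL (.velocity k))).prod
            0) Z :=
        ((hasFDerivAt_const _ _).prodMk
          (ContinuousLinearMap.pi fun k => coordL (.velocity k)).hasFDerivAt).prodMk
            (hasFDerivAt_const _ _)
      have h1 := fderiv_fderiv_apply hφ' hc.differentiableAt v
      have h2 := fderiv_fderiv_apply hφ' (differentiableAt_const v) ((1, velocity (forget Z)), 0)
      rw [Filter.EventuallyEq.fderiv_eq (f := fun _ => (0 : ℝ))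
        (Filter.eventuallyEq_of_mem (hU.mem_nhds hZ) fun Y hY => h0 Y hY)] at h1
      rw [Filter.EventuallyEq.fderiv_eq (f := fun _ => (0 : ℝ))
        (Filter.eventuallyEq_of_mem (hU.mem_nhds hZ) fun Y hY => hu i Y hY)] at h2
      rw [(hφ'.isSymmSndFDerivAt (by simp)).eq, hc.fderiv] at h1
      have h3 : (((0 : FullSpace →L[ℝ] ℝ).prod (ContinuousLinearMap.pi fun k =>
          coordL (.velocity k))).prod (0 : FullSpace →L[ℝ] State × ℝ)) v = (eX i, 0) := by
        refine Prod.ext (Prod.ext rfl (funext fun k => ?_)) rfl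
        simp [hv, coordL_apply, Pi.single_apply]
      rw [h3] at h1
      simp at h1 h2
      rw [← h2, zero_add] at h1
      exact h1.symm
    refine mem_span_of_material (hr Z hZ) _ (fun e => ?_) (fun i => hu i Z hZ) (h Z hZ)
    have h1 : ((e, 0) : FullSpace) = e.1 • ((1, velocity (forget Z)), 0)
        + ∑ k, (e.2 k - e.1 * velocity (forget Z) k) • (eX k, 0) := by
      refine Prod.ext (Prod.ext ?_ (funext fun i => ?_)) ?_
      · simp [Prod.fst_sum]
      · simp [Prod.fst_sum, Prod.snd_sum, Pi.single_apply]
      · simp [Prod.snd_sum]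
    rw [h1, map_add, map_sum, map_smul, h0 Z hZ]
    simp only [map_smul, hx, smul_zero, Finset.sum_const_zero, add_zero]

/-- In the entropy equation the field changes the material direction by a multiple of itself, which
the equation annihilates, and by the variation of `u`, which cancels the one in `u·∇S`. Only the
material derivative of the component along `S` survives. -/
theorem fderiv_cglFullSystem_combo (hU : IsOpen U) (hr : ∀ Z ∈ U, forget Z ∈ region)
    (hX : ContDiffOn ℝ ∞ X U) (h : ∀ Z ∈ U, forget (X Z) = combo c (forget Z)) {Z : FullSpace}
    (hZ : Z ∈ U) {L : FullJet} (hL : cglFullSystem μ₀ (Z, L) = 0) :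
    fderiv ℝ (cglFullSystem μ₀) (Z, L) (X Z, prolongation X Z L)
      = (0, fderiv ℝ (fun Z => (X Z).2.2) Z
        ((1, velocity (forget Z)), ((L (1, velocity (forget Z))).1, 0))) := by
  have hd : DifferentiableAt ℝ X Z := (hX.contDiffAt (hU.mem_nhds hZ)).differentiableAt (by simp)
  have hc : DifferentiableAt ℝ (combo c) (forget Z) :=
    (contDiff_combo c (n := 1)).differentiable (by simp) _
  have h1 : forgetL.comp (fderiv ℝ X Z) = (fderiv ℝ (combo c) (forget Z)).comp forgetL := by
    have h2 : HasFDerivAt (fun Z => forget (X Z)) (forgetL.comp (fderiv ℝ X Z)) Z :=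
      forgetL.hasFDerivAt.comp (f := X) Z hd.hasFDerivAt
    have h3 : HasFDerivAt (fun Z => combo c (forget Z)) _ Z :=
      hc.hasFDerivAt.comp (f := forget) Z forgetL.hasFDerivAt
    exact h2.unique (h3.congr_of_eventuallyEq
      (Filter.eventuallyEq_of_mem (hU.mem_nhds hZ) fun Y hY => h Y hY))
  have h2 : ∀ V, forget (fderiv ℝ X Z V) = fderiv ℝ (combo c) (forget Z) (forget V) := fun V =>
    DFunLike.congr_fun h1 V
  have h3 : ∀ V, (fderiv ℝ X Z V).1 = (fderiv ℝ (combo c) (forget Z) (forget V)).1 := fun V =>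
    congrArg Prod.fst (h2 V)
  have h4 : ∀ V, (fderiv ℝ X Z V).2.1 = (fderiv ℝ (combo c) (forget Z) (forget V)).2 := fun V =>
    congrArg Prod.snd (h2 V)
  have hL1 : cglSystem μ₀ (forget Z, (forgetJet (Z, L)).2) = 0 := congrArg Prod.fst hL
  have hL2 : (L (1, velocity (forget Z))).2 = 0 := by
    rw [← entropyEq_eq' (Z, L)]
    exact congrArg Prod.snd hL
  have hp : ∀ e, prolongation X Z L e
      = (fderiv ℝ X Z (e, L e)).2 - L (fderiv ℝ X Z (e, L e)).1 := fun e => by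
    simp only [prolongation, totalDeriv, hd.hasFDerivAt.fst.fderiv, hd.hasFDerivAt.snd.fderiv]
    rfl
  rw [fderiv_cglFullSystem (hr Z hZ)]
  refine Prod.ext ?_ ?_
  · have h5 : forgetJet (X Z, prolongation X Z L) = (combo c (forget Z),
        prolongation (combo c) (forget Z) (forgetJet (Z, L)).2) := by
      refine Prod.ext (h Z hZ) (ContinuousLinearMap.ext fun e => ?_)
      change (prolongation X Z L e).1 = _
      rw [hp, Prod.fst_sub, h3, h4]
      simp only [prolongation, totalDeriv, hc.hasFDerivAt.fst.fderiv, hc.hasFDerivAt.snd.fderiv]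
      rfl
    change fderiv ℝ (cglSystem μ₀) (forgetJet (Z, L)) (forgetJet (X Z, prolongation X Z L)) = 0
    rw [h5]
    exact fderiv_cglSystem_combo (hr Z hZ) hL1
  · have h5 : (fderiv ℝ (combo c) (forget Z) (forget ((1, velocity (forget Z)),
        L (1, velocity (forget Z))))).1 = (c .S1 + c .S2) • (1, velocity (forget Z))
          + ∑ k, (combo c (forget Z)).2 (.velocity k) • eX k := by
      have h6 := totalDeriv_combo_fst (z := forget Z) (L := (forgetJet (Z, L)).2) c
        (1, velocity (forget Z))
      rw [totalDeriv, hc.hasFDerivAt.fst.fderiv] at h6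
      refine h6.trans (Prod.ext ?_ (funext fun i => ?_))
      · simp [Prod.fst_sum]
      · simp [Prod.snd_sum, Pi.single_apply, combo_eq, mkVec]
        ring
    have h6 : ∀ k, (X Z).2.1 (.velocity k) = (combo c (forget Z)).2 (.velocity k) := fun k =>
      congrArg (fun y : Space => y.2 (.velocity k)) (h Z hZ)
    have h7 : ((1, velocity (forget Z)), L (1, velocity (forget Z)))
        = (((1, velocity (forget Z)), ((L (1, velocity (forget Z))).1, 0)) : FullSpace) :=
      Prod.ext rfl (Prod.ext rfl hL2)
    change (prolongation X Z L (1, velocity (forget Z))).2 + ∑ k, _ = _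
    rw [hp, Prod.snd_sub, h3, h5, hd.hasFDerivAt.snd.snd.fderiv, ← h7]
    simp only [map_add, map_sum, map_smul, Prod.snd_add, Prod.snd_sum, Prod.smul_snd, smul_eq_mul,
      hL2, h6]
    simp

theorem isLiePointSymmetry_full_iff_of_combo (hU : IsOpen U) (hr : ∀ Z ∈ U, forget Z ∈ region)
    (hX : ContDiffOn ℝ ∞ X U) (h : ∀ Z ∈ U, forget (X Z) = combo c (forget Z)) :
    IsLiePointSymmetry (cglFullSystem μ₀) U X ↔ IsAdvectedFunction U fun Z => (X Z).2.2 := by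
  have hφ : ContDiffOn ℝ ∞ (fun Z => (X Z).2.2) U := hX.snd.snd
  rw [IsAdvectedFunction, forall_mem_span_iff (μ₀ := μ₀) hU hr hφ, IsLiePointSymmetry,
    and_iff_right hX, and_iff_right hφ]
  constructor
  · intro h1 Z hZ L hL
    -- The reduced condition contains no derivative of `S`, so jets with zero entropy gradient test
    -- it completely.
    have hL' : cglFullSystem μ₀ (Z, L.prod 0) = 0 :=
      cglFullSystem_prod_eq_zero_iff.2 ⟨(cglSystem_eq_zero_iff (hr Z hZ)).2 hL, rfl⟩
    have h2 := h1 Z hZ _ hL'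
    rw [fderiv_cglFullSystem_combo hU hr hX h hZ hL'] at h2
    exact congrArg Prod.snd h2
  · intro h1 Z hZ L hL
    rw [fderiv_cglFullSystem_combo hU hr hX h hZ hL]
    refine Prod.ext rfl (h1 Z hZ (forgetJet (Z, L)).2 ?_)
    exact (cglSystem_eq_zero_iff (hr Z hZ)).1 (congrArg Prod.fst hL)

/-- A linear combination of the generators on the full space. -/
def fullCombo (c : Generator → ℝ) (Z : FullSpace) : FullSpace :=
  ((combo c (forget Z)).1, ((combo c (forget Z)).2, 0))

theorem contDiff_fullCombo : ContDiff ℝ ∞ (fullCombo c) := by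
  have h : ContDiff ℝ ∞ fun Z => combo c (forget Z) := (contDiff_combo c).comp forgetL.contDiff
  exact h.fst.prodMk (h.snd.prodMk contDiff_const)

theorem sum_smul_domRestrict_full (c : Generator → ℝ) :
    ∑ g, c g • U.domRestrict (fullGenerator g) = U.domRestrict (fullCombo c) := by
  ext1 Z
  rw [Finset.sum_apply]
  change ∑ g, c g • fullGenerator g Z = fullCombo c Z
  refine Prod.ext ?_ (Prod.ext ?_ ?_)
  · simp [Prod.fst_sum, fullGenerator, fullCombo, combo]
  · simp [Prod.fst_sum, Prod.snd_sum, fullGenerator, fullCombo, combo]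
  · simp [Prod.snd_sum, fullGenerator, fullCombo]

theorem linearIndependent_fullGenerator (hU : IsOpen U) (hne : U.Nonempty) :
    LinearIndependent ℝ fun g => U.domRestrict (fullGenerator g) := by
  rw [Fintype.linearIndependent_iff]
  intro c hc
  rw [sum_smul_domRestrict_full] at hc
  obtain ⟨Z, hZ⟩ := hne
  refine congrFun (eq_zero_of_combo (hU.preimage (contDiff_withEntropy Z.2.2).continuous)
    ⟨forget Z, hZ⟩ fun y hy => ?_)
  have h : fullCombo c (withEntropy Z.2.2 y) = 0 := congrFun hc ⟨_, hy⟩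
  have h1 : combo c y = 0 := congrArg forget h
  rw [h1]
  exact ⟨rfl, fun _ => rfl⟩

theorem isLiePointSymmetry_full_iff (hμ₀ : μ₀ ≠ 0) (hU : IsOpen U) (hc : IsConnected U)
    (hr : ∀ Z ∈ U, forget Z ∈ region) : IsLiePointSymmetry (cglFullSystem μ₀) U X ↔
      ∃ φ, IsAdvectedFunction U φ ∧ U.domRestrict (X - entropyField φ) ∈
        Submodule.span ℝ (Set.range fun g => U.domRestrict (fullGenerator g)) := by
  simp only [Submodule.mem_span_range_iff_exists_fun, sum_smul_domRestrict_full]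
  constructor
  · intro h
    obtain ⟨c, hc⟩ := exists_combo_full hμ₀ hU hc hr h
    refine ⟨fun Z => (X Z).2.2, (isLiePointSymmetry_full_iff_of_combo hU hr h.1 hc).1 h, c,
      funext fun Z => ?_⟩
    have h1 := hc Z Z.2
    change fullCombo c Z = X Z - entropyField _ Z
    rw [fullCombo, ← h1]
    exact Prod.ext (sub_zero _).symm (Prod.ext (sub_zero _).symm (sub_self _).symm)
  · rintro ⟨φ, hφ, c, hc⟩
    have h1 : Set.EqOn X (fun Z => fullCombo c Z + entropyField φ Z) U := fun Z hZ =>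
      (sub_eq_iff_eq_add.1 (congrFun hc ⟨Z, hZ⟩).symm)
    have h2 : ∀ Z ∈ U, forget (X Z) = combo c (forget Z) := fun Z hZ => by
      rw [h1 hZ]
      exact Prod.ext (add_zero _) (add_zero _)
    have h3 : ∀ Z ∈ U, (X Z).2.2 = φ Z := fun Z hZ => by
      rw [h1 hZ]
      exact zero_add _
    have h4 : ContDiffOn ℝ ∞ X U :=
      (contDiff_fullCombo.contDiffOn.add
        (contDiffOn_const.prodMk (contDiffOn_const.prodMk hφ.1))).congr h1
    refine (isLiePointSymmetry_full_iff_of_combo hU hr h4 h2).2 ⟨h4.snd.snd, fun Z hZ => ?_⟩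
    rw [Filter.EventuallyEq.fderiv_eq (Filter.eventuallyEq_of_mem (hU.mem_nhds hZ) h3)]
    exact hφ.2 Z hZ

end FullClassification

end CGL

end
-- The classification of the point symmetries
theorem mainTheorem5 (μ₀ : ℝ) (hμ₀ : 0 < μ₀) :
    Fintype.card CGL.Generator = 13 ∧
    (∀ U : Set CGL.Space, IsOpen U → IsConnected U → U ⊆ CGL.region →
      LinearIndependent ℝ (fun g => U.domRestrict (CGL.generator g)) ∧
      ∀ X : CGL.Space → CGL.Space,
        CGL.IsLiePointSymmetry (CGL.cglSystem μ₀) U X ↔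
          U.domRestrict X ∈
            Submodule.span ℝ (Set.range fun g => U.domRestrict (CGL.generator g))) ∧
    (∀ U : Set CGL.FullSpace, IsOpen U → IsConnected U → (∀ z ∈ U, CGL.forget z ∈ CGL.region) →
      LinearIndependent ℝ (fun g => U.domRestrict (CGL.fullGenerator g)) ∧
      ∀ X : CGL.FullSpace → CGL.FullSpace,
        CGL.IsLiePointSymmetry (CGL.cglFullSystem μ₀) U X ↔
          ∃ φ : CGL.FullSpace → ℝ, CGL.IsAdvectedFunction U φ ∧
            U.domRestrict (X - CGL.entropyField φ) ∈
              Submodule.span ℝ (Set.range fun g => U.domRestrict (CGL.fullGenerator g))) := by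
  refine ⟨by rfl, fun U hU hc hr => ⟨CGL.linearIndependent_generator hU hc.nonempty,
    fun X => CGL.isLiePointSymmetry_iff hμ₀.ne' hU hc hr⟩, fun U hU hc hr =>
    ⟨CGL.linearIndependent_fullGenerator hU hc.nonempty,
      fun X => CGL.isLiePointSymmetry_full_iff hμ₀.ne' hU hc hr⟩⟩
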